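/- A finite tree with a distinguished root is initially unknown; the edges at each node $v$ are numbered by local ports $0,\dots,\deg(v)-1$, where the numberings at different nodes are unrelated. A team of $k$ agents starts at the root. Each agent has a private memory, initialised depending on its identifier, and each node carries a whiteboard, initially blank; memories and whiteboards may hold arbitrary data. A (deterministic) \emph{distributed algorithm} is a rule that all agents follow: when activated at a node, an agent sees only its own memory, the whiteboard of that node, the degree of the node and the port through which it last arrived, and from these it determines its new memory, the new content of the whiteboard and the port through which it leaves, and it traverses the corresponding edge; this is one \emph{move}. The algorithm is run \emph{asynchronously}: before each move, an adversary chooses which agent makes it, with no fairness constraint. The tree is \emph{explored} once every node has been visited by at least one agent. There is an absolute constant $C$ such that for every $k\ge 1$ there is a distributed algorithm for $k$ agents (not depending on the tree or on its size) that, for every tree with $n$ nodes and depth $D$ (the largest distance of a node from the root), every port numbering, and every choice of the adversary, explores the tree in at most $2n + C\,k\,2^k D$ moves. -/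

import Mathlib

/-- A finite rooted tree on the vertex set `V`, whose edges carry local port numbers: the edges
at `v` are numbered `0, …, degree v - 1`, and `port v p` is the neighbour reached from `v` through
port `p`. The numberings at different vertices are unrelated. -/
structure PortTree (V : Type) where
  /-- The underlying graph. -/
  graph : SimpleGraph V
  isTree : graph.IsTree
  /-- The vertex at which all agents start. -/
  root : V
  /-- The number of edges at a vertex (forced by `port`). -/
  degree : V → ℕ
  /-- The port numbering at each vertex. -/
  port : ∀ v : V, Fin (degree v) ≃ graph.neighborSet v

/-- The depth of a rooted tree: the largest distance of a vertex from the root. -/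
noncomputable def PortTree.depth {V : Type} [Fintype V] (T : PortTree V) : ℕ :=
  Finset.univ.sup fun v => T.graph.dist T.root v

/-- A deterministic distributed algorithm for a team of `k` agents. Each agent has a private
memory, and each vertex of the tree carries a whiteboard; whiteboards are the only means of
communication. An agent that is activated at a vertex sees only its own memory, the
whiteboard of that vertex, the number of ports there, and the port through which it came (`none` if
it has not moved yet). From these it computes its new memory, the new content of the whiteboard,
and the port through which it leaves. -/
structure DistributedAlgorithm (k : ℕ) where
  /-- Possible contents of the private memory of an agent. -/
  Memory : Type
  /-- Possible contents of a whiteboard. -/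
  Board : Type
  /-- The initial memory of each agent; it may encode the identifier of the agent. -/
  init : Fin k → Memory
  /-- The initial content of all whiteboards. -/
  blank : Board
  /-- The program that is run by all agents. -/
  act : Memory → Board → (d : ℕ) → 0 < d → Option ℕ → Memory × Board × Fin d

/-- A global configuration of `k` agents in the tree `T`. -/
structure Configuration {k : ℕ} (A : DistributedAlgorithm k) {V : Type} (T : PortTree V) where
  /-- The current vertex of each agent. -/
  pos : Fin k → V
  /-- The number of the port of the current vertex through which the agent last arrived, or
  `none` if it has not moved yet. -/
  entry : Fin k → Option ℕ
  /-- The private memories. -/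
  mem : Fin k → A.Memory
  /-- The whiteboards. -/
  board : V → A.Board

namespace DistributedAlgorithm

variable {k : ℕ} (A : DistributedAlgorithm k) {V : Type} [DecidableEq V] (T : PortTree V)

/-- At the beginning all agents are at the root and all whiteboards are blank. -/
def start : Configuration A T where
  pos := fun _ => T.root
  entry := fun _ => none
  mem := A.init
  board := fun _ => A.blank

/-- Activation of agent `i`: it reads and rewrites the whiteboard of its vertex, and traverses
one edge. (Only in the tree with a single vertex there is no edge to traverse.) -/
def activate (c : Configuration A T) (i : Fin k) : Configuration A T :=
  if h : 0 < T.degree (c.pos i) then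
    let v := c.pos i
    let r := A.act (c.mem i) (c.board v) (T.degree v) h (c.entry i)
    let w := T.port v r.2.2
    { pos := fun j => if j = i then (w : V) else c.pos j
      entry := fun j =>
        if j = i then some ((T.port w).symm ⟨v, (T.graph.mem_neighborSet w v).2 w.2.symm⟩ : ℕ)
        else c.entry j
      mem := fun j => if j = i then r.1 else c.mem j
      board := fun u => if u = v then r.2.1 else c.board u }
  else c

/-- The configuration after `t` moves, when agent `σ s` makes the move number `s + 1`. -/
def run (σ : ℕ → Fin k) : ℕ → Configuration A T
  | 0 => A.start T
  | t + 1 => A.activate T (run σ t) (σ t)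

/-- Within the first `t` moves, every vertex of the tree has been visited by some agent. -/
def ExploredWithin (σ : ℕ → Fin k) (t : ℕ) : Prop :=
  ∀ v : V, ∃ s ≤ t, ∃ i : Fin k, (A.run T σ s).pos i = v

end DistributedAlgorithm

/-! Suppose a vertex `u` is still unvisited; it suffices to bound the number of moves made so far.

The algorithm. An agent takes a fresh port whenever it sees one and works depth-first below. A port
to an unfinished child is open, and walking down again through an open port costs a token. Tokens
are created only at the root. At a fork, a vertex with several open ports, tokens are shared equally
among the open ports. Once a port has saved `(k + 1) * s` tokens, where `s` is the length of the
known segment behind it, an agent may leave there: `s` tokens cover the first `s` edges and `k * s`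
go into its purse. Where only one port is open the agent passes through, paying one token per edge
beyond the first `s`; at the next fork it hands over tokens. With an empty purse it climbs back and
records the length it reached as the new segment length.

Counting moves. A downward move opens a fresh port, which happens at most `n - 1` times, or uses up
a token, and upward moves do not outnumber downward ones. Hence the number of moves is at most `2 *
n` plus twice the number of tokens issued (`Count.le`).

Guards. Behind each open port there is an agent, or one has just come out and is about to close it
(`Guarded`). Hence the open ports beside the path to `u`, together with the agents carrying a purse
for the path, number at most `k` (`PathInv.agents_le`).

The potential. Only tokens on the path to `u` are valued. At level `h`, a saved token is worth `k`;
a carried token, a token already paid for edges, and a leftover one are worth `k + 1`. They are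
weighted by the product of `1 + lam k * s l` over the levels above, where `s l` is the number of
open ports beside the path; savings and purses taken at `h` include the factor of `h` itself,
leftovers do not. As `k * lam k = k + 2`, the even split among `s l + 1` ports loses nothing in
value (`Covers.issue`, `Covers.pay`), and a departure balances: `k * ((k + 1) * s) = (k + 1) * (k *
s)`. So `k` times the tokens issued stays below the potential, except when a port beside the path
closes. Then the potential from that level down is written off as a loss (`Covers.close`). Levels
inside a segment carry no potential, so the write-off is at most one `cap k r` per saturated level,
where `r` is the number of open ports beside the path down to that level (`Bounded.sum_le`). As `r`
decreases at each such level, potential and losses are together at most `capSum k k` per level,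
which is of order `k ^ 2 * 2 ^ k`. This bounds the tokens by `96 * (k * 2 ^ k * D)` (`Covers.le`).
-/

namespace PortTree

/-! ### Geometry of the rooted tree: depths, ancestors, children, ports. -/

variable {V : Type} (T : PortTree V)

/-- The distance of a vertex from the root. -/
noncomputable def dep (v : V) : ℕ := T.graph.dist T.root v

lemma dep_root : T.dep T.root = 0 := by simp [dep]

lemma dep_eq_zero {v : V} : T.dep v = 0 ↔ v = T.root := by
  rw [dep, T.isTree.connected.dist_eq_zero_iff, eq_comm]

lemma dep_adj {v w : V} (h : T.graph.Adj v w) : T.dep w = T.dep v + 1 ∨ T.dep v = T.dep w + 1 := by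
  have h1 := T.isTree.dist_ne_of_adj T.root h
  have h2 := h.diff_dist_adj (u := T.root)
  unfold dep
  omega

lemma exists_parent {v : V} (h : v ≠ T.root) : ∃ w, T.graph.Adj v w ∧ T.dep v = T.dep w + 1 := by
  obtain ⟨p, hp⟩ := T.isTree.connected.exists_walk_length_eq_dist T.root v
  have hnil : ¬ p.Nil := fun hn => h hn.eq.symm
  have hadj := p.adj_penultimate hnil
  refine ⟨p.penultimate, hadj.symm, ?_⟩
  rcases T.dep_adj hadj with h1 | h1
  · exact h1
  · exfalso
    have h2 : T.graph.dist T.root p.penultimate ≤ p.dropLast.length := SimpleGraph.dist_le _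
    have h3 : p.dropLast.length = p.length - 1 := by simp
    unfold dep at h1
    omega

/-- Shortest walks from the root to `w` and `w'` extend to paths ending at `v`; in a tree these
coincide, hence so do their penultimate vertices. -/
lemma parent_unique {v w w' : V} (h : T.graph.Adj v w) (h' : T.graph.Adj v w')
    (hd : T.dep v = T.dep w + 1) (hd' : T.dep v = T.dep w' + 1) : w = w' := by
  obtain ⟨p, hp⟩ := T.isTree.connected.exists_walk_length_eq_dist T.root w
  obtain ⟨q, hq⟩ := T.isTree.connected.exists_walk_length_eq_dist T.root w'
  unfold dep at hd hd'
  have hp' : (p.concat h.symm).IsPath := SimpleGraph.Walk.isPath_of_length_eq_dist _ (by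
    simp [SimpleGraph.Walk.length_concat]; omega)
  have hq' : (q.concat h'.symm).IsPath := SimpleGraph.Walk.isPath_of_length_eq_dist _ (by
    simp [SimpleGraph.Walk.length_concat]; omega)
  have := (T.isTree.isAcyclic.subsingleton_path T.root v).elim ⟨_, hp'⟩ ⟨_, hq'⟩
  have h2 : p.concat h.symm = q.concat h'.symm := congrArg Subtype.val this
  have h3 := congrArg SimpleGraph.Walk.penultimate h2
  simpa using h3

open Classical in
/-- The parent of a vertex; the root is its own parent. -/
noncomputable def par (v : V) : V := if h : v = T.root then v else (T.exists_parent h).choose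

lemma par_adj {v : V} (h : v ≠ T.root) : T.graph.Adj v (T.par v) := by
  simp only [par, h, dite_false]; exact (T.exists_parent h).choose_spec.1

lemma dep_par {v : V} (h : v ≠ T.root) : T.dep v = T.dep (T.par v) + 1 := by
  have := (T.exists_parent h).choose_spec.2
  simpa only [par, h, dite_false] using this

lemma par_eq {v w : V} (h : T.graph.Adj v w) (hd : T.dep w = T.dep v + 1) : T.par w = v := by
  have hw : w ≠ T.root := by rintro rfl; simp [dep_root] at hd
  exact T.parent_unique (T.par_adj hw) h.symm (T.dep_par hw) hd

lemma dep_par_sub (v : V) : T.dep (T.par v) = T.dep v - 1 := by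
  by_cases h : v = T.root
  · subst h; simp [par, dep_root]
  · have := T.dep_par h; omega

/-- The ancestor of `v` at depth `i` (and `v` itself if `v` is not that deep). -/
noncomputable def anc (v : V) (i : ℕ) : V := T.par^[T.dep v - i] v

lemma anc_of_le {v : V} {i : ℕ} (h : T.dep v ≤ i) : T.anc v i = v := by
  simp [anc, Nat.sub_eq_zero_of_le h]

lemma anc_self (v : V) : T.anc v (T.dep v) = v := T.anc_of_le le_rfl

lemma dep_iter (v : V) (n : ℕ) : T.dep (T.par^[n] v) = T.dep v - n := by
  induction n with
  | zero => simp
  | succ n ih => rw [Function.iterate_succ_apply' T.par, dep_par_sub, ih]; omega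

lemma dep_anc {v : V} {i : ℕ} (h : i ≤ T.dep v) : T.dep (T.anc v i) = i := by
  rw [anc, dep_iter]; omega

lemma par_anc {v : V} {i : ℕ} (h : i + 1 ≤ T.dep v) : T.par (T.anc v (i + 1)) = T.anc v i := by
  rw [anc, anc, ← Function.iterate_succ_apply' T.par]
  congr 2; omega

lemma anc_par {v : V} {i : ℕ} (h : i + 1 ≤ T.dep v) : T.anc (T.par v) i = T.anc v i := by
  rw [anc, anc, dep_par_sub, ← Function.iterate_succ_apply]
  congr 2; omega

lemma anc_anc {v : V} {i j : ℕ} (h : i ≤ j) : T.anc (T.anc v j) i = T.anc v i := by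
  by_cases hj : j ≤ T.dep v
  · rw [anc, dep_anc T hj, anc, anc, ← Function.iterate_add_apply]
    congr 2; omega
  · rw [T.anc_of_le (i := j) (by omega)]

lemma anc_zero (v : V) : T.anc v 0 = T.root := by
  rw [← dep_eq_zero]; exact T.dep_anc (Nat.zero_le _)

lemma anc_child {v w : V} (h : T.graph.Adj v w) (hd : T.dep w = T.dep v + 1) {i : ℕ}
    (hi : i ≤ T.dep v) : T.anc w i = T.anc v i := by
  rw [← T.anc_par (v := w) (by omega), T.par_eq h hd]

lemma adj_anc {v : V} {i : ℕ} (h : i + 1 ≤ T.dep v) :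
    T.graph.Adj (T.anc v i) (T.anc v (i + 1)) := by
  have h1 : T.anc v (i + 1) ≠ T.root := by
    intro h2
    have := T.dep_anc h
    rw [h2, dep_root] at this; omega
  have := (T.par_adj h1).symm
  rwa [T.par_anc h] at this

/-- The neighbour of `v` behind the port `p`. -/
noncomputable def nb (v : V) (p : ℕ) : V := if h : p < T.degree v then (T.port v ⟨p, h⟩ : V) else v

lemma adj_nb {v : V} {p : ℕ} (h : p < T.degree v) : T.graph.Adj v (T.nb v p) := by
  simp only [nb, h, dite_true]
  exact (T.graph.mem_neighborSet _ _).1 (T.port v ⟨p, h⟩).2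

lemma nb_inj {v : V} {p q : ℕ} (hp : p < T.degree v) (hq : q < T.degree v)
    (h : T.nb v p = T.nb v q) : p = q := by
  simp only [nb, hp, hq, dite_true] at h
  have := (T.port v).injective (Subtype.ext h)
  simpa using this

lemma exists_port {v w : V} (h : T.graph.Adj v w) : ∃ p < T.degree v, T.nb v p = w := by
  refine ⟨(T.port v).symm ⟨w, (T.graph.mem_neighborSet _ _).2 h⟩, Fin.is_lt _, ?_⟩
  simp [nb]

open Classical in
/-- The port at `v` that leads to `w`. -/
noncomputable def portTo (v w : V) : ℕ :=
  if h : T.graph.Adj v w then (T.exists_port h).choose else 0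

lemma portTo_lt {v w : V} (h : T.graph.Adj v w) : T.portTo v w < T.degree v := by
  simp only [portTo, h, dite_true]; exact (T.exists_port h).choose_spec.1

lemma nb_portTo {v w : V} (h : T.graph.Adj v w) : T.nb v (T.portTo v w) = w := by
  simp only [portTo, h, dite_true]; exact (T.exists_port h).choose_spec.2

/-- The vertex `w` is a child of `v`, reached through the port `p`. -/
def Child (v : V) (p : ℕ) (w : V) : Prop := p < T.degree v ∧ T.nb v p = w ∧ T.dep w = T.dep v + 1

lemma Child.adj {T : PortTree V} {v w : V} {p : ℕ} (h : T.Child v p w) : T.graph.Adj v w := by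
  rw [← h.2.1]; exact T.adj_nb h.1

lemma Child.anc {T : PortTree V} {v w : V} {p : ℕ} (h : T.Child v p w) {i : ℕ} (hi : i ≤ T.dep v) :
    T.anc w i = T.anc v i := T.anc_child h.adj h.2.2 hi

lemma Child.inj {T : PortTree V} {v v' w : V} {p p' : ℕ} (h : T.Child v p w)
    (h' : T.Child v' p' w) : v = v' ∧ p = p' := by
  have h1 : v = v' := by rw [← T.par_eq h.adj h.2.2, ← T.par_eq h'.adj h'.2.2]
  subst h1
  exact ⟨rfl, T.nb_inj h.1 h'.1 (h.2.1.trans h'.2.1.symm)⟩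

lemma child_or {v : V} {p : ℕ} (h : p < T.degree v) :
    T.Child v p (T.nb v p) ∨ (T.dep v = T.dep (T.nb v p) + 1 ∧ v ≠ T.root) := by
  rcases T.dep_adj (T.adj_nb h) with h1 | h1
  · exact Or.inl ⟨h, rfl, h1⟩
  · refine Or.inr ⟨h1, ?_⟩
    rintro rfl
    simp [dep_root] at h1

lemma child_anc {v : V} {i : ℕ} (h : i + 1 ≤ T.dep v) :
    T.Child (T.anc v i) (T.portTo (T.anc v i) (T.anc v (i + 1))) (T.anc v (i + 1)) :=
  ⟨T.portTo_lt (T.adj_anc h), T.nb_portTo (T.adj_anc h), by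
    rw [T.dep_anc h, T.dep_anc (by omega)]⟩

lemma dep_le_depth [Fintype V] (v : V) : T.dep v ≤ T.depth :=
  Finset.le_sup (f := fun v => T.graph.dist T.root v) (Finset.mem_univ v)


/-- The vertex `w` is `x` or an ancestor of `x`. -/
def Above (w x : V) : Prop := T.anc x (T.dep w) = w

lemma Above.dep_le {T : PortTree V} {w x : V} (h : T.Above w x) : T.dep w ≤ T.dep x := by
  by_contra hlt
  have h2 : T.anc x (T.dep w) = w := h
  rw [T.anc_of_le (by omega)] at h2
  rw [h2] at hlt
  exact hlt le_rfl

lemma above_refl (x : V) : T.Above x x := T.anc_self x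

lemma above_anc (x : V) (i : ℕ) : T.Above (T.anc x i) x := by
  unfold Above
  by_cases h : i ≤ T.dep x
  · rw [T.dep_anc h]
  · rw [T.anc_of_le (i := i) (by omega), T.anc_self]

lemma Above.eq_anc {T : PortTree V} {w x : V} (h : T.Above w x) {i : ℕ} (hi : T.dep w = i) :
    T.anc x i = w := by rw [← hi]; exact h

lemma Above.trans {T : PortTree V} {v w x : V} (h : T.Above v w) (h' : T.Above w x) :
    T.Above v x := by
  have h1 := h.dep_le
  unfold Above at *
  rw [← T.anc_anc h1, h', h]

lemma Child.above {T : PortTree V} {v w : V} {p : ℕ} (h : T.Child v p w) : T.Above v w := by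
  unfold Above
  rw [h.anc le_rfl, T.anc_self]

/-- Subtrees of different children are disjoint. This is what makes guards of different ports
different agents. -/
lemma Above.child {T : PortTree V} {v w x : V} {p : ℕ} (hc : T.Child v p w)
    (hw : T.Above w x) {q : ℕ} {w' : V} (hc' : T.Child v q w') (hw' : T.Above w' x) : p = q := by
  have h1 := hw.eq_anc hc.2.2
  have h2 := hw'.eq_anc hc'.2.2
  have : w = w' := h1.symm.trans h2
  subst this
  exact (hc.inj hc').2

lemma Above.exists_child {T : PortTree V} {v x : V} (h : T.Above v x) (hne : v ≠ x) :
    ∃ p w, T.Child v p w ∧ T.Above w x := by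
  have h1 : T.dep v + 1 ≤ T.dep x := by
    have h2 := h.dep_le
    by_contra h3
    have h4 : T.anc x (T.dep v) = v := h
    rw [T.anc_of_le (by omega)] at h4
    exact hne h4.symm
  have h2 := T.child_anc h1
  rw [h] at h2
  exact ⟨_, _, h2, T.above_anc _ _⟩

lemma Above.eq_or_parent {T : PortTree V} {w v x : V} {p : ℕ} (h : T.Above w x)
    (hc : T.Child v p x) : w = x ∨ T.Above w v := by
  by_cases h1 : T.dep w ≤ T.dep v
  · right
    have h2 : T.anc x (T.dep w) = w := h
    rw [hc.anc h1] at h2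
    exact h2
  · left
    have h2 := hc.2.2
    have h3 : T.anc x (T.dep w) = w := h
    rw [T.anc_of_le (by omega)] at h3
    exact h3.symm

end PortTree

/-! ### The algorithm: memories, whiteboards, permitted operations and moves. -/

/-- What is known about a port: nothing, it leads to the parent, it leads to a child whose subtree
is in progress, or to one whose subtree has been finished. -/
inductive PortStatus
  | fresh
  | up
  | opn
  | closed

/-- The tokens an agent carries for the fork at which it departed, the length of the segment that is
free of charge, the depth reached, and the port of departure. -/
structure Purse where
  B : ℕ
  sd : ℕ
  far : ℕ
  port : ℕ

/-- The memory of an agent: the depth of the coordinated part of its path, the number of edges of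
the exploratory part below, the purses along the path, and whether it just left a finished
subtree. -/
structure Mem where
  kd : ℕ
  dig : ℕ
  fr : ℕ → Option Purse
  cf : Prop

/-- The whiteboard of a vertex: whether it was visited, the states of the ports, the tokens saved
and the length of the known segment behind each port, and the tokens left over. The whiteboard of
the root also counts the tokens issued. -/
structure Board where
  vis : Prop
  st : ℕ → PortStatus
  sav : ℕ → ℕ
  seg : ℕ → ℕ
  rem : ℕ
  tot : ℕ

namespace TokenSearch

open Classical PortStatus

/-- The initial memory. -/
def init : Mem := ⟨0, 0, fun _ => none, False⟩

/-- The empty whiteboard. -/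
def blank : Board := ⟨False, fun _ => fresh, fun _ => 0, fun _ => 1, 0, 0⟩

/-- The number of open ports. -/
noncomputable def nopen (d : ℕ) (b : Board) : ℕ := ((Finset.range d).filter fun p => b.st p = opn).card

/-- The whiteboard when each open port is given `n` tokens. -/
noncomputable def addTokens (b : Board) (n : ℕ) : Board :=
  { b with sav := fun p => if b.st p = opn then b.sav p + n else b.sav p }

/-- The agent is ready to act. -/
def Ready (m : Mem) (b : Board) : Prop := b.vis ∧ ¬ m.cf ∧ m.fr (m.kd + 1) = none

/-- There is no fresh port. -/
def NoFresh (d : ℕ) (b : Board) : Prop := ∀ p < d, b.st p ≠ fresh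

/-- The purse `j` is the last one. -/
def Active (m : Mem) (j : ℕ) : Prop := j ≤ m.kd ∧ ∀ i, j < i → i ≤ m.kd → m.fr i = none

/-- The operations on memory and whiteboard that precede a move. -/
inductive Prep (k d : ℕ) (e : Option ℕ) : Mem → Board → Mem → Board → Prop
  | mark {m b} (h : ¬ b.vis) :
      Prep k d e m b m { b with vis := True, st := fun p => if e = some p then up else b.st p }
  | close {m b} (p : ℕ) (hv : b.vis) (h : m.cf) (hp : e = some p) :
      Prep k d e m b { m with cf := False } { b with st := Function.update b.st p closed }
  -- The owner is back at the fork of departure; `far - kd` is the length it reached with this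
  -- purse, which is free of charge on later trips.
  | dissolve {m b} (pu : Purse) (hv : b.vis) (hc : ¬ m.cf) (h : m.fr (m.kd + 1) = some pu) :
      Prep k d e m b { m with fr := Function.update m.fr (m.kd + 1) none }
        { b with seg := Function.update b.seg pu.port (max (b.seg pu.port) (pu.far - m.kd)) }
  -- The only source of tokens; `kd = dig = 0` means that the agent is at the root.
  | issue {m b} (n : ℕ) (hr : Ready m b) (hf : NoFresh d b) (hd : m.dig = 0) (h0 : m.kd = 0)
      (hn : ∀ p < d, b.st p = opn → b.sav p + n ≤ (k + 1) * b.seg p) :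
      Prep k d e m b m { addTokens b n with tot := b.tot + n * nopen d b }
  -- `x` tokens and the old leftovers give `n` to each open port; the rest `r` stays on the
  -- whiteboard.
  | pay {m b} (n x r j : ℕ) (pu : Purse) (hr : Ready m b) (hf : NoFresh d b) (hd : m.dig = 0)
      (hn : ∀ p < d, b.st p = opn → b.sav p + n ≤ (k + 1) * b.seg p) (hj : Active m j)
      (hp : m.fr j = some pu) (hx : x ≤ pu.B) (hs : x + b.rem = n * nopen d b + r) (hrk : r ≤ k)
      (h2 : 2 ≤ nopen d b) :
      Prep k d e m b { m with fr := Function.update m.fr j (some { pu with B := pu.B - x }) }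
        { addTokens b n with rem := r }
  -- The zero is written `pu.B - pu.B` so that `drop` and `pay` share the lemmas on spending.
  | drop {m b} (j : ℕ) (pu : Purse) (hr : Ready m b) (hf : NoFresh d b) (hd : m.dig = 0)
      (ho : ∀ p < d, b.st p ≠ opn) (hj : Active m j) (hp : m.fr j = some pu) :
      Prep k d e m b { m with fr := Function.update m.fr j (some { pu with B := pu.B - pu.B }) } b

/-- The moves. -/
inductive Move (k d : ℕ) : Mem → Board → Mem → Board → ℕ → Prop
  | fresh {m b} (p : ℕ) (hr : Ready m b) (hp : p < d) (h : b.st p = fresh) :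
      Move k d m b { m with dig := m.dig + 1 } { b with st := Function.update b.st p opn } p
  -- With neither fresh nor open ports left, the subtree is finished, and `cf` tells the parent to
  -- close its port.
  | digUp {m b} (p : ℕ) (hr : Ready m b) (hf : NoFresh d b) (hd : 0 < m.dig) (hp : p < d)
      (h : b.st p = up) :
      Move k d m b { m with dig := m.dig - 1, cf := ∀ q < d, b.st q ≠ opn } b p
  | kUp {m b} (p : ℕ) (hr : Ready m b) (hf : NoFresh d b) (hd : m.dig = 0) (hk : 0 < m.kd)
      (hp : p < d) (h : b.st p = up) (hB : ∀ j pu, Active m j → m.fr j = some pu → pu.B = 0) :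
      Move k d m b { m with kd := m.kd - 1, cf := ∀ q < d, b.st q ≠ opn } b p
  -- Of the `(k + 1) * seg` tokens, `k * seg` enter the purse; the remaining `seg` pay in advance
  -- for the first `seg` edges. The purse is stored at the depth of the child.
  | depart {m b} (p : ℕ) (hr : Ready m b) (hf : NoFresh d b) (hd : m.dig = 0) (hp : p < d)
      (h : b.st p = opn) (hs : (k + 1) * b.seg p ≤ b.sav p) :
      Move k d m b
        { m with
          kd := m.kd + 1
          fr := Function.update m.fr (m.kd + 1) (some ⟨k * b.seg p, b.seg p, m.kd + 1, p⟩) }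
        { b with sav := Function.update b.sav p (b.sav p - (k + 1) * b.seg p) } p
  -- Purse `j` was taken at depth `j - 1`, so the new distance from its fork is `kd + 2 - j`; the
  -- edge is free exactly when this is at most `sd`.
  | pass {m b} (p j x : ℕ) (pu : Purse) (hr : Ready m b) (hf : NoFresh d b) (hd : m.dig = 0)
      (hp : p < d) (h : b.st p = opn) (hu : ∀ q < d, b.st q = opn → q = p) (hj : Active m j)
      (hpu : m.fr j = some pu) (hB : 1 ≤ pu.B)
      (hx : x = 0 ∧ m.kd + 2 ≤ pu.sd + j ∨ x = 1 ∧ pu.sd + j < m.kd + 2) :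
      Move k d m b
        { m with
          kd := m.kd + 1
          fr := Function.update m.fr j (some { pu with B := pu.B - x, far := m.kd + 1 }) } b p

/-- A sequence of operations. -/
inductive Preps (k d : ℕ) (e : Option ℕ) : Mem → Board → Mem → Board → Prop
  | refl {m b} : Preps k d e m b m b
  | head {m b m' b' m'' b''} (h : Prep k d e m b m' b') (h' : Preps k d e m' b' m'' b'') :
      Preps k d e m b m'' b''

/-- What an agent may do when it is activated. -/
def Step (k d : ℕ) (e : Option ℕ) (m : Mem) (b : Board) (r : Mem × Board × ℕ) : Prop :=
  ∃ m' b', Preps k d e m b m' b' ∧ Move k d m' b' r.1 r.2.1 r.2.2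

lemma Move.lt {k d : ℕ} {m m' : Mem} {b b' : Board} {p : ℕ} (h : Move k d m b m' b' p) : p < d := by
  cases h <;> assumption

/-- The token algorithm. -/
noncomputable def algo (k : ℕ) : DistributedAlgorithm k where
  Memory := Mem
  Board := Board
  init := fun _ => init
  blank := blank
  act := fun m b d hd e =>
    -- Any permitted step will do, as the proof uses only the permissions. The other branch is not
    -- reached while a vertex is unvisited (`Inv.exists_step`).
    if h : ∃ r, Step k d e m b r then
      (h.choose.1, h.choose.2.1, ⟨h.choose.2.2, h.choose_spec.choose_spec.choose_spec.2.lt⟩)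
    else (m, b, ⟨0, hd⟩)

end TokenSearch

/-! ### Configurations of the token algorithm and their relation to runs. -/

/-- A configuration of the token algorithm. -/
@[ext]
structure TokenConfig (k : ℕ) (V : Type) where
  pos : Fin k → V
  entry : Fin k → Option ℕ
  mem : Fin k → Mem
  board : V → Board

namespace TokenConfig

open TokenSearch

variable {k : ℕ} {V : Type} (T : PortTree V)

/-- The start. -/
def start : TokenConfig k V := ⟨fun _ => T.root, fun _ => none, fun _ => init, fun _ => blank⟩

/-- The configurations of the token algorithm as a `TokenConfig`. -/
def of (c : Configuration (algo k) T) : TokenConfig k V := ⟨c.pos, c.entry, c.mem, c.board⟩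

variable [DecidableEq V]

/-- Rewrite memory and whiteboard. -/
def upd (c : TokenConfig k V) (i : Fin k) (m : Mem) (b : Board) : TokenConfig k V :=
  { c with mem := Function.update c.mem i m, board := Function.update c.board (c.pos i) b }

/-- Rewrite memory and whiteboard, then move through the port `p`. -/
noncomputable def go
    (c : TokenConfig k V) (i : Fin k) (m : Mem) (b : Board) (p : ℕ) : TokenConfig k V :=
  { pos := Function.update c.pos i (T.nb (c.pos i) p)
    entry := Function.update c.entry i (some (T.portTo (T.nb (c.pos i) p) (c.pos i)))
    mem := Function.update c.mem i m
    board := Function.update c.board (c.pos i) b }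


@[simp] lemma upd_pos (c : TokenConfig k V) (i : Fin k) (m : Mem) (b : Board) :
    (c.upd i m b).pos = c.pos := rfl

lemma upd_upd (c : TokenConfig k V) (i : Fin k) (m m' : Mem) (b b' : Board) :
    (c.upd i m b).upd i m' b' = c.upd i m' b' := by
  simp [upd]

lemma upd_go (c : TokenConfig k V) (i : Fin k) (m m' : Mem) (b b' : Board) (p : ℕ) :
    (c.upd i m b).go T i m' b' p = c.go T i m' b' p := by
  simp [upd, go]

/-- One activation of the agent `i` of the token algorithm. -/
def Next (c : TokenConfig k V) (i : Fin k) (c' : TokenConfig k V) : Prop :=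
  ∃ m' b' p, Step k (T.degree (c.pos i)) (c.entry i) (c.mem i) (c.board (c.pos i)) (m', b', p) ∧
    c' = c.go T i m' b' p

lemma of_activate (c : Configuration (algo k) T) (i : Fin k) (hd : 0 < T.degree (c.pos i))
    (m : Mem) (b : Board) (p : Fin (T.degree (c.pos i)))
    (hr : (algo k).act (c.mem i) (c.board (c.pos i)) (T.degree (c.pos i)) hd (c.entry i) =
      (m, b, p)) :
    of T ((algo k).activate T c i) = (of T c).go T i m b p := by
  have h1 : m = ((algo k).act (c.mem i) (c.board (c.pos i)) (T.degree (c.pos i)) hd (c.entry i)).1 := by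
    rw [hr]
  have h2 : b = ((algo k).act (c.mem i) (c.board (c.pos i)) (T.degree (c.pos i)) hd (c.entry i)).2.1 := by
    rw [hr]
  have h3 : p = ((algo k).act (c.mem i) (c.board (c.pos i)) (T.degree (c.pos i)) hd (c.entry i)).2.2 := by
    rw [hr]
  clear hr
  subst h1 h2 h3
  set p := ((algo k).act (c.mem i) (c.board (c.pos i)) (T.degree (c.pos i)) hd (c.entry i)).2.2
  have hnb : T.nb (c.pos i) p = (T.port (c.pos i) p : V) := by
    simp only [PortTree.nb, p.2, dite_true]
  have hadj : T.graph.Adj (T.port (c.pos i) p : V) (c.pos i) :=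
    ((T.graph.mem_neighborSet _ _).1 (T.port (c.pos i) p).2).symm
  unfold DistributedAlgorithm.activate
  rw [dif_pos hd]
  refine TokenConfig.ext ?_ ?_ ?_ ?_
  · funext j
    simp only [of, go, Function.update_apply, hnb, p]
  · funext j
    simp only [of, go, Function.update_apply]
    split
    · congr 1
      rw [hnb]
      refine T.nb_inj (Fin.is_lt _) (T.portTo_lt hadj) ?_
      rw [T.nb_portTo hadj]
      simp [PortTree.nb]
    · rfl
  · funext j
    exact (Function.update_apply _ _ _ _).symm
  · funext j
    exact (Function.update_apply _ _ _ _).symm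

lemma next_activate (c : Configuration (algo k) T) (i : Fin k)
    (h : ∃ r, Step k (T.degree ((of T c).pos i)) ((of T c).entry i) ((of T c).mem i)
      ((of T c).board ((of T c).pos i)) r) :
    Next T (of T c) i (of T ((algo k).activate T c i)) := by
  have hd : 0 < T.degree (c.pos i) := by
    obtain ⟨r, m', b', -, hm⟩ := h
    exact lt_of_le_of_lt (Nat.zero_le _) hm.lt
  exact ⟨h.choose.1, h.choose.2.1, h.choose.2.2, h.choose_spec,
    of_activate T c i hd _ _ ⟨_, h.choose_spec.choose_spec.choose_spec.2.lt⟩ (dif_pos h)⟩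

end TokenConfig

/-! ### Structural invariants, and their preservation by the operations before a move. -/

namespace TokenSearch

open Classical PortStatus

/-- The changes that whiteboards undergo. -/
def Evolves (b b' : Board) : Prop :=
  (b.vis → b'.vis) ∧ ∀ p, b.st p = fresh ∨ b'.st p = b.st p ∨ b.st p = opn ∧ b'.st p = closed

/-- The port leads to a child. -/
def Taken (s : PortStatus) : Prop := s = opn ∨ s = closed

variable {k : ℕ} {V : Type} (T : PortTree V) (u : V)

/-- The vertex has been visited and has no fresh port. -/
def Saturated (bd : V → Board) (v : V) : Prop := (bd v).vis ∧ NoFresh (T.degree v) (bd v)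

/-- At most one port is open. -/
def Unary (bd : V → Board) (v : V) : Prop :=
  ∀ p < T.degree v, ∀ q < T.degree v, (bd v).st p = opn → (bd v).st q = opn → p = q

/-- Invariants of the whiteboards, as long as `u` is not visited. -/
structure BoardInv (k : ℕ) (bd : V → Board) : Prop where
  nonvis : ∀ v, ¬ (bd v).vis → bd v = blank
  up_iff : ∀ v p, (bd v).vis → p < T.degree v → ((bd v).st p = up ↔ T.dep v = T.dep (T.nb v p) + 1)
  taken : ∀ v p w, T.Child v p w → (bd w).vis → Taken ((bd v).st p)
  unseen : ¬ (bd u).vis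
  closed : ∀ v p w, T.Child v p w → (bd v).st p = closed → ¬ T.Above w u
  seg_pos : ∀ v p, 1 ≤ (bd v).seg p
  sav_le : ∀ v p, p < T.degree v → (bd v).sav p ≤ (k + 1) * (bd v).seg p
  rem_le : ∀ v, (bd v).rem ≤ k

/-- Invariants of an agent at `x` that entered through `e`. -/
structure AgentInv (bd : V → Board) (x : V) (e : Option ℕ) (m : Mem) : Prop where
  depth : T.dep x = m.kd + m.dig
  unseen : x ≠ u
  entry_up : ¬ (bd x).vis → ∀ p, e = some p → p < T.degree x ∧ T.dep x = T.dep (T.nb x p) + 1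
  entry_some : ¬ (bd x).vis → x ≠ T.root → e ≠ none
  taken : ∀ v p, T.Child v p x → Taken ((bd v).st p)
  cf : m.cf → (bd x).vis ∧ ∃ p w, e = some p ∧ T.Child x p w ∧ Taken ((bd x).st p) ∧ ¬ T.Above w u
  fr_zero : m.fr 0 = none
  fr_beyond : ∀ j, m.kd + 1 < j → m.fr j = none
  -- A purse below the current depth belongs to an agent that has just returned to its fork and has
  -- not yet dissolved it.
  fr_next : ∀ pu, m.fr (m.kd + 1) = some pu →
    m.dig = 0 ∧ pu.B = 0 ∧ e = some pu.port ∧ Saturated T bd x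
  fr_one : 1 ≤ m.kd → m.fr 1 ≠ none
  fr_port : ∀ j pu, j + 1 ≤ m.kd → m.fr (j + 1) = some pu →
    T.Child (T.anc x j) pu.port (T.anc x (j + 1))
  sat_above : ∀ j < m.kd, Saturated T bd (T.anc x j)
  -- An agent climbs only when its last purse is empty, so it never backs out of the stretch covered
  -- by a nonempty purse.
  reach : ∀ j pu, m.fr j = some pu → 1 ≤ pu.B →
    ∀ i, j < i → i ≤ pu.far → i ≤ m.kd ∧ m.fr i = none
  -- An edge without a purse was passed through the only open port, which at an ancestor of `u` is
  -- the one towards `u`.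
  through : ∀ j, j + 1 ≤ m.kd → m.fr (j + 1) = none → T.anc x j = T.anc u j →
    T.anc x (j + 1) = T.anc u (j + 1) ∧ Unary T bd (T.anc x j)

/-- Every open port is guarded by an agent. -/
def Guarded (c : TokenConfig k V) : Prop :=
  ∀ v p w, T.Child v p w → (c.board v).st p = opn →
    ∃ a, T.Above w (c.pos a) ∨ c.pos a = v ∧ (c.mem a).cf ∧ c.entry a = some p

/-- The structural invariants. -/
structure Inv (c : TokenConfig k V) : Prop where
  board : BoardInv T u k c.board
  agent : ∀ a, AgentInv T u c.board (c.pos a) (c.entry a) (c.mem a)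
  guarded : Guarded T c

variable {T u}

lemma Evolves.refl (b : Board) : Evolves b b := ⟨id, fun _ => .inr (.inl rfl)⟩

lemma Evolves.taken {b b' : Board} (h : Evolves b b') {p : ℕ} (hp : Taken (b.st p)) :
    Taken (b'.st p) := by
  unfold Taken at *
  rcases h.2 p with h1 | h1 | h1 <;> aesop

lemma Evolves.noFresh {b b' : Board} (h : Evolves b b') {d : ℕ} (hp : NoFresh d b) :
    NoFresh d b' := by
  intro p hpd hf
  have := hp p hpd
  rcases h.2 p with h1 | h1 | h1 <;> aesop

/-- Only fresh ports can become open; hence at a saturated vertex the set of open ports only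
shrinks. -/
lemma Evolves.opn {b b' : Board} (h : Evolves b b') {p : ℕ} (hf : b.st p ≠ fresh)
    (hp : b'.st p = opn) : b.st p = opn := by
  rcases h.2 p with h1 | h1 | h1 <;> aesop

lemma saturated_mono {bd bd' : V → Board} (h : ∀ v, Evolves (bd v) (bd' v)) {v : V}
    (hs : Saturated T bd v) : Saturated T bd' v := ⟨(h v).1 hs.1, (h v).noFresh hs.2⟩

lemma unary_mono {bd bd' : V → Board} (h : ∀ v, Evolves (bd v) (bd' v)) {v : V}
    (hs : Saturated T bd v) (hu : Unary T bd v) : Unary T bd' v := fun p hp q hq h1 h2 =>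
  hu p hp q hq ((h v).opn (hs.2 p hp) h1) ((h v).opn (hs.2 q hq) h2)

/-- What an agent relies on cannot be spoiled by others: each condition on whiteboards is stable
under `Evolves`. -/
lemma AgentInv.mono {bd bd' : V → Board} (h : ∀ v, Evolves (bd v) (bd' v)) {x : V} {e : Option ℕ}
    {m : Mem} (hi : AgentInv T u bd x e m) : AgentInv T u bd' x e m where
  depth := hi.depth
  unseen := hi.unseen
  entry_up hv := hi.entry_up fun h' => hv ((h x).1 h')
  entry_some hv := hi.entry_some fun h' => hv ((h x).1 h')
  taken v p hc := (h v).taken (hi.taken v p hc)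
  cf hc := by
    obtain ⟨h1, p, w, h2, h3, h4, h5⟩ := hi.cf hc
    exact ⟨(h x).1 h1, p, w, h2, h3, (h x).taken h4, h5⟩
  fr_zero := hi.fr_zero
  fr_beyond := hi.fr_beyond
  fr_next pu hp := by
    obtain ⟨h1, h2, h3, h4⟩ := hi.fr_next pu hp
    exact ⟨h1, h2, h3, saturated_mono h h4⟩
  fr_one := hi.fr_one
  fr_port := hi.fr_port
  sat_above j hj := saturated_mono h (hi.sat_above j hj)
  reach := hi.reach
  through j hj h1 h2 := ⟨(hi.through j hj h1 h2).1,
    unary_mono h (hi.sat_above j hj) (hi.through j hj h1 h2).2⟩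

lemma evolves_update [DecidableEq V] {bd : V → Board} {v : V} {b : Board} (h : Evolves (bd v) b) (w : V) :
    Evolves (bd w) (Function.update bd v b w) := by
  by_cases hw : w = v
  · subst hw; simpa using h
  · simpa [hw] using Evolves.refl _

lemma Prep.evolves {d : ℕ} {e : Option ℕ} {m m' : Mem} {b b' : Board} (h : Prep k d e m b m' b')
    (hb : ¬ b.vis → b = blank) (hc : m.cf → ∃ p, e = some p ∧ Taken (b.st p)) : Evolves b b' := by
  cases h with
  | mark h =>
    refine ⟨fun _ => trivial, fun p => .inl ?_⟩
    rw [hb h]; rfl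
  | close p hv h hp =>
    refine ⟨id, fun q => ?_⟩
    obtain ⟨p', hp', ht⟩ := hc h
    rw [hp] at hp'
    obtain rfl : p = p' := by simpa using hp'
    by_cases hq : q = p
    · subst hq
      simp only [Function.update_self]
      rcases ht with ht | ht
      · exact .inr (.inr ⟨ht, trivial⟩)
      · exact .inr (.inl ht.symm)
    · exact .inr (.inl (by simp [hq]))
  | dissolve => exact ⟨id, fun _ => .inr (.inl rfl)⟩
  | issue => exact ⟨id, fun _ => .inr (.inl rfl)⟩
  | pay | drop => exact ⟨id, fun _ => .inr (.inl rfl)⟩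

lemma Move.evolves {d : ℕ} {m m' : Mem} {b b' : Board} {p : ℕ} (h : Move k d m b m' b' p) :
    Evolves b b' := by
  cases h with
  | fresh _ hr hp h =>
    refine ⟨id, fun q => ?_⟩
    by_cases hq : q = p
    · subst hq; exact .inl h
    · exact .inr (.inl (by simp [hq]))
  | digUp | kUp | depart | pass => exact ⟨id, fun _ => .inr (.inl rfl)⟩

lemma BoardInv.update [DecidableEq V] {bd : V → Board} (hI : BoardInv T u k bd) {x : V} {b : Board}
    (he : Evolves (bd x) b) (hv : b.vis) (hx : x ≠ u)
    (hup : ∀ p < T.degree x, b.st p = up ↔ T.dep x = T.dep (T.nb x p) + 1)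
    (ht : ∀ v p, T.Child v p x → Taken ((bd v).st p))
    (hc : ∀ p w, T.Child x p w → b.st p = .closed → (bd x).st p = .closed ∨ ¬ T.Above w u)
    (hseg : ∀ p, 1 ≤ b.seg p) (hsav : ∀ p < T.degree x, b.sav p ≤ (k + 1) * b.seg p)
    (hrem : b.rem ≤ k) : BoardInv T u k (Function.update bd x b) where
  nonvis v h := by
    by_cases hvx : v = x
    · subst hvx; simp [hv] at h
    · rw [Function.update_of_ne hvx] at h ⊢
      exact hI.nonvis v h
  up_iff v p h hp := by
    by_cases hvx : v = x
    · subst hvx; simpa using hup p hp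
    · rw [Function.update_of_ne hvx] at h ⊢
      exact hI.up_iff v p h hp
  taken v p w hcw hw := by
    refine (evolves_update he v).taken ?_
    by_cases hwx : w = x
    · subst hwx; exact ht v p hcw
    · rw [Function.update_of_ne hwx] at hw
      exact hI.taken v p w hcw hw
  unseen := by
    rw [Function.update_of_ne (Ne.symm hx)]
    exact hI.unseen
  closed v p w hcw hcl := by
    by_cases hvx : v = x
    · subst hvx
      rw [Function.update_self] at hcl
      rcases hc p w hcw hcl with h | h
      · exact hI.closed v p w hcw h
      · exact h
    · rw [Function.update_of_ne hvx] at hcl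
      exact hI.closed v p w hcw hcl
  seg_pos v p := by
    by_cases hvx : v = x
    · subst hvx; simpa using hseg p
    · rw [Function.update_of_ne hvx]; exact hI.seg_pos v p
  sav_le v p hp := by
    by_cases hvx : v = x
    · subst hvx; simpa using hsav p hp
    · rw [Function.update_of_ne hvx]; exact hI.sav_le v p hp
  rem_le v := by
    by_cases hvx : v = x
    · subst hvx; simpa using hrem
    · rw [Function.update_of_ne hvx]; exact hI.rem_le v

lemma Prep.vis {d : ℕ} {e : Option ℕ} {m m' : Mem} {b b' : Board} (h : Prep k d e m b m' b') :
    b'.vis := by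
  cases h with
  | mark => trivial
  | close _ h | dissolve _ h => exact h
  | issue _ h | pay _ _ _ _ _ h | drop _ _ h => exact h.1

lemma Prep.boardInv [DecidableEq V] {bd : V → Board} {x : V} {e : Option ℕ} {m m' : Mem} {b : Board}
    (hI : BoardInv T u k bd) (hA : AgentInv T u bd x e m)
    (h : Prep k (T.degree x) e m (bd x) m' b) : BoardInv T u k (Function.update bd x b) := by
  have hev : Evolves (bd x) b := h.evolves (hI.nonvis x) fun hc => by
    obtain ⟨-, p, w, h2, -, h4, -⟩ := hA.cf hc
    exact ⟨p, h2, h4⟩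
  have hvis := h.vis
  refine hI.update hev hvis hA.unseen ?_ hA.taken ?_ ?_ ?_ ?_
  · intro p hp
    cases h with
    | mark h =>
      simp only
      by_cases hep : e = some p
      · simpa [hep] using (hA.entry_up h p hep).2
      · have : (bd x).st p ≠ up := by rw [hI.nonvis x h]; simp [blank]
        simp only [hep, if_false, this, false_iff]
        -- The first agent activated at a vertex below the root came from the parent, so the port to
        -- the unique parent is its entry port.
        intro hd
        have hxr : x ≠ T.root := by
          rintro rfl
          simp [T.dep_root] at hd
        obtain ⟨q, hq⟩ := Option.ne_none_iff_exists'.1 (hA.entry_some h hxr)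
        obtain ⟨hq1, hq2⟩ := hA.entry_up h q hq
        have := T.parent_unique (T.adj_nb hp) (T.adj_nb hq1) hd hq2
        exact hep (by rw [hq, T.nb_inj hp hq1 this])
    | close q hv hc hq =>
      simp only
      by_cases hpq : p = q
      · subst hpq
        simp only [Function.update_self]
        obtain ⟨-, p', w, h2, h3, -, -⟩ := hA.cf hc
        obtain rfl : p = p' := by rw [hq] at h2; simpa using h2
        have := h3.2.2
        rw [h3.2.1]
        constructor
        · simp
        · omega
      · simpa [hpq] using hI.up_iff x p hv hp
    | dissolve _ hv => exact hI.up_iff x p hv hp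
    | issue _ hr | pay _ _ _ _ _ hr | drop _ _ hr => exact hI.up_iff x p hr.1 hp
  · intro p w hw hcl
    cases h with
    | mark h =>
      simp only at hcl
      split at hcl
      · simp at hcl
      · exact .inl hcl
    | close q hv hc hq =>
      simp only at hcl
      by_cases hpq : p = q
      · subst hpq
        obtain ⟨-, p', w', h2, h3, -, h5⟩ := hA.cf hc
        obtain rfl : p = p' := by rw [hq] at h2; simpa using h2
        rw [← hw.2.1, h3.2.1]
        exact .inr h5
      · exact .inl (by simpa [hpq] using hcl)
    | dissolve | issue | pay | drop => exact .inl hcl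
  · intro p
    have h0 := hI.seg_pos x p
    cases h with
    | mark | close | issue | pay | drop => exact h0
    | dissolve pu =>
      by_cases hpq : p = pu.port
      · subst hpq
        simpa using .inl h0
      · simpa [hpq] using h0
  · intro p hp
    have h0 := hI.sav_le x p hp
    cases h with
    | mark | close | drop => exact h0
    | issue _ _ _ _ _ hn | pay _ _ _ _ _ _ _ _ hn =>
      simp only [addTokens]
      split
      · exact hn p hp ‹_›
      · exact h0
    | dissolve pu =>
      refine h0.trans (Nat.mul_le_mul_left _ ?_)
      by_cases hpq : p = pu.port
      · subst hpq
        simp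
      · simp [hpq]
  · have h0 := hI.rem_le x
    cases h with
    | mark | close | issue | dissolve | drop => exact h0
    | pay => assumption

/-- Spending does not change which levels have purses, and `reach` only gets weaker when a purse
loses tokens. -/
lemma AgentInv.spend {bd : V → Board} {x : V} {e : Option ℕ} {m : Mem} (hA : AgentInv T u bd x e m)
    {j : ℕ} {pu : Purse} (hj : Active m j) (hp : m.fr j = some pu) (y : ℕ) :
    AgentInv T u bd x e
      { m with fr := Function.update m.fr j (some { pu with B := pu.B - y }) } := by
  have hj0 : j ≠ 0 := by
    rintro rfl
    rw [hA.fr_zero] at hp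
    simp at hp
  have hj1 := hj.1
  have hnone : ∀ i, Function.update m.fr j (some { pu with B := pu.B - y }) i = none ↔
      m.fr i = none := fun i => by
    by_cases hij : i = j
    · subst hij; simp [hp]
    · rw [Function.update_of_ne hij]
  exact
  { hA with
    fr_zero := (hnone 0).2 hA.fr_zero
    fr_beyond := fun i hi => (hnone i).2 (hA.fr_beyond i hi)
    fr_next := fun pu' h => by
      simp only at h
      rw [Function.update_of_ne (by omega)] at h
      exact hA.fr_next pu' h
    fr_one := fun hk h => hA.fr_one hk ((hnone 1).1 h)
    fr_port := fun i pu' hi h => by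
      simp only [Function.update_apply] at h
      split at h
      · simp only [Option.some.injEq] at h
        subst h
        exact hA.fr_port i pu hi (by rwa [‹i + 1 = j›])
      · exact hA.fr_port i pu' hi h
    reach := fun i pu' h hB l hl hlf => by
      simp only [hnone]
      simp only [Function.update_apply] at h
      split at h
      · simp only [Option.some.injEq] at h
        subst h
        simp only at hB hlf
        subst i
        exact hA.reach j pu hp (by omega) l hl hlf
      · exact hA.reach i pu' h hB l hl hlf
    through := fun i hi h => hA.through i hi ((hnone _).1 h) }

lemma Prep.agentInv [DecidableEq V] {bd : V → Board} {x : V} {e : Option ℕ} {m m' : Mem} {b : Board}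
    (hI : BoardInv T u k bd) (hA : AgentInv T u bd x e m)
    (h : Prep k (T.degree x) e m (bd x) m' b) :
    AgentInv T u (Function.update bd x b) x e m' := by
  have hev : Evolves (bd x) b := h.evolves (hI.nonvis x) fun hc => by
    obtain ⟨-, p, w, h2, -, h4, -⟩ := hA.cf hc
    exact ⟨p, h2, h4⟩
  refine AgentInv.mono (evolves_update hev) ?_
  cases h with
  | mark | issue => exact hA
  | close => exact { hA with cf := False.elim }
  | dissolve pu hv hc h =>
    exact
    { hA with
      cf := hc.elim
      fr_zero := by simpa using hA.fr_zero
      fr_beyond := fun j hj => by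
        have := hA.fr_beyond j hj
        dsimp only at hj ⊢
        rwa [Function.update_of_ne (by omega)]
      fr_next := fun pu h => by simp at h
      fr_one := fun hk => by
        dsimp only at hk ⊢
        have := hA.fr_one hk
        rwa [Function.update_of_ne (by omega)]
      fr_port := fun j pu hj h => by
        dsimp only at hj h
        rw [Function.update_of_ne (by omega)] at h
        exact hA.fr_port j pu hj h
      reach := fun j pu h hB i hj hi => by
        simp only [Function.update_apply] at h ⊢
        split at h
        · simp at h
        · obtain ⟨h1, h2⟩ := hA.reach j pu h hB i hj hi
          exact ⟨h1, by simp [h2]⟩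
      through := fun j hj h => by
        dsimp only at hj h
        rw [Function.update_of_ne (by omega)] at h
        exact hA.through j hj h }
  | pay n y r j pu _ _ _ _ hj hp => exact hA.spend hj hp y
  | drop j pu _ _ _ _ hj hp => exact hA.spend hj hp _

/-- Operations that precede a move preserve the structural invariants. -/
lemma Inv.prep [DecidableEq V] {c : TokenConfig k V} (hI : Inv T u c) {i : Fin k} {m : Mem} {b : Board}
    (h : Prep k (T.degree (c.pos i)) (c.entry i) (c.mem i) (c.board (c.pos i)) m b) :
    Inv T u (c.upd i m b) := by
  have hev : Evolves (c.board (c.pos i)) b := h.evolves (hI.board.nonvis _) fun hc => by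
    obtain ⟨-, p, w, h2, -, h4, -⟩ := (hI.agent i).cf hc
    exact ⟨p, h2, h4⟩
  refine ⟨h.boardInv hI.board (hI.agent i), fun a => ?_, ?_⟩
  · by_cases ha : a = i
    · subst ha
      simpa [TokenConfig.upd] using h.agentInv hI.board (hI.agent a)
    · simpa [TokenConfig.upd, ha] using (hI.agent a).mono (evolves_update hev)
  · intro v p w hc ho
    have ho' : (c.board v).st p = opn := by
      simp only [TokenConfig.upd, Function.update_apply] at ho
      split at ho
      · subst v
        rcases hev.2 p with h1 | h1 | h1
        · exfalso
          cases h with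
          | mark =>
            simp only at ho
            split at ho
            · simp at ho
            · simp [h1] at ho
          | close q =>
            simp only [Function.update_apply] at ho
            split at ho
            · simp at ho
            · simp [h1] at ho
          | dissolve | issue | pay | drop => simp [addTokens, h1] at ho
        · rw [← h1, ho]
        · exact h1.1
      · exact ho
    obtain ⟨a, ha⟩ := hI.guarded v p w hc ho'
    refine ⟨a, ?_⟩
    rcases ha with ha | ⟨h1, h2, h3⟩
    · exact .inl ha
    · refine .inr ⟨h1, ?_, h3⟩
      by_cases hai : a = i
      · subst hai
        simp only [TokenConfig.upd, Function.update_self]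
        subst h1
        cases h with
        | close q hv hcf hq =>
          exfalso
          rw [h3] at hq
          obtain rfl : p = q := by simpa using hq
          simp [TokenConfig.upd] at ho
        | mark | dissolve | issue | pay | drop => exact h2
      · simpa [TokenConfig.upd, hai] using h2

end TokenSearch

/-! ### Preservation of the structural invariants by moves. -/

namespace TokenSearch

open Classical PortStatus

variable {k : ℕ} {V : Type} {T : PortTree V} {u : V}

lemma BoardInv.vis_of_taken {bd : V → Board} (hI : BoardInv T u k bd) {v : V} {p : ℕ}
    (h : Taken ((bd v).st p)) : (bd v).vis := by
  by_contra hv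
  rw [hI.nonvis v hv] at h
  rcases h with h | h <;> simp [blank] at h

lemma BoardInv.child {bd : V → Board} (hI : BoardInv T u k bd) {v : V} {p : ℕ} (hv : (bd v).vis)
    (hp : p < T.degree v) (h : (bd v).st p ≠ up) : T.Child v p (T.nb v p) := by
  rcases T.child_or hp with h1 | h1
  · exact h1
  · exact absurd ((hI.up_iff v p hv hp).2 h1.1) h

/-- The port towards `u` is not fresh by saturation, does not lead up, and is not closed because
closed subtrees do not contain `u`. -/
lemma BoardInv.exists_open {bd : V → Board} (hI : BoardInv T u k bd) {v : V}
    (hs : Saturated T bd v) (ha : T.Above v u) :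
    ∃ p w, T.Child v p w ∧ T.Above w u ∧ (bd v).st p = opn := by
  have hne : v ≠ u := by
    rintro rfl
    exact hI.unseen hs.1
  obtain ⟨p, w, hc, hw⟩ := ha.exists_child hne
  refine ⟨p, w, hc, hw, ?_⟩
  have h1 := hs.2 p hc.1
  have h2 := mt (hI.up_iff v p hs.1 hc.1).1 (by have := hc.2.2; rw [hc.2.1]; omega)
  have h3 := hI.closed v p w hc
  cases h : (bd v).st p <;> simp_all

lemma Move.ready {d : ℕ} {m m' : Mem} {b b' : Board} {p : ℕ} (h : Move k d m b m' b' p) :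
    Ready m b := by
  cases h <;> assumption

lemma Move.boardInv [DecidableEq V] {bd : V → Board} {x : V} {e : Option ℕ} {m m' : Mem} {b : Board}
    {p : ℕ} (hI : BoardInv T u k bd) (hA : AgentInv T u bd x e m)
    (h : Move k (T.degree x) m (bd x) m' b p) : BoardInv T u k (Function.update bd x b) := by
  have hev := h.evolves
  have hv : (bd x).vis := h.ready.1
  refine hI.update hev (hev.1 hv) hA.unseen ?_ hA.taken ?_ ?_ ?_ ?_
  · intro q hq
    have h0 := hI.up_iff x q hv hq
    cases h with
    | fresh p hr hp h =>
      by_cases hqp : q = p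
      · subst hqp
        rw [h] at h0
        simpa using h0
      · simpa [hqp] using h0
    | digUp | kUp | depart | pass => exact h0
  · intro q w hc hcl
    cases h with
    | fresh p hr hp h =>
      simp only [Function.update_apply] at hcl
      split at hcl
      · simp at hcl
      · exact .inl hcl
    | digUp | kUp | depart | pass => exact .inl hcl
  · intro q
    cases h <;> exact hI.seg_pos x q
  · intro q hq
    have h0 := hI.sav_le x q hq
    cases h with
    | depart p =>
      by_cases hqp : q = p
      · subst hqp
        simp only [Function.update_self]
        omega
      · simpa [hqp] using h0
    | digUp | kUp | fresh | pass => exact h0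
  · cases h <;> exact hI.rem_le x

/-- The direction of a move. -/
lemma Move.direction {bd : V → Board} {x : V} {m m' : Mem} {b : Board} {p : ℕ}
    (hI : BoardInv T u k bd) (h : Move k (T.degree x) m (bd x) m' b p) :
    T.Child x p (T.nb x p) ∧ (b.st p = opn) ∨
    (bd x).st p = up ∧ T.Child (T.nb x p) (T.portTo (T.nb x p) x) x := by
  have hv : (bd x).vis := h.ready.1
  have hp := h.lt
  by_cases hup : (bd x).st p = up
  · refine .inr ⟨hup, T.portTo_lt (T.adj_nb hp).symm, T.nb_portTo (T.adj_nb hp).symm, ?_⟩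
    exact (hI.up_iff x p hv hp).1 hup
  · refine .inl ⟨hI.child hv hp hup, ?_⟩
    cases h with
    | fresh => simp
    | digUp _ _ _ _ _ h | kUp _ _ _ _ _ _ h => exact absurd h hup
    | depart _ _ _ _ _ h => exact h
    | pass _ _ _ _ _ _ _ _ h => exact h

lemma Move.agentInv [DecidableEq V] {bd : V → Board} {x : V} {e : Option ℕ} {m m' : Mem} {b : Board}
    {p : ℕ} (hI : BoardInv T u k bd) (hA : AgentInv T u bd x e m)
    (h : Move k (T.degree x) m (bd x) m' b p) (hu : T.nb x p ≠ u) :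
    AgentInv T u (Function.update bd x b) (T.nb x p) (some (T.portTo (T.nb x p) x)) m' := by
  have hevo : ∀ w, Evolves (bd w) (Function.update bd x b w) := evolves_update h.evolves
  have hr : Ready m (bd x) := h.ready
  have hp := h.lt
  have hdepth := hA.depth
  rcases h.direction hI with ⟨hc, hopn⟩ | ⟨hup, hc⟩
  · set y := T.nb x p with hy
    have hcd := hc.2.2
    have hanc : ∀ j ≤ T.dep x, T.anc y j = T.anc x j := fun j hj => hc.anc hj
    have hancx : T.anc y (T.dep x) = x := by rw [hanc _ le_rfl, T.anc_self]
    have hancy : T.anc y (T.dep x + 1) = y := by rw [← hcd, T.anc_self]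
    have hentry : ∀ q, some (T.portTo y x) = some q → q < T.degree y ∧ T.dep y = T.dep (T.nb y q) + 1 := by
      intro q hq
      obtain rfl : T.portTo y x = q := by simpa using hq
      have hadj := hc.adj.symm
      exact ⟨T.portTo_lt hadj, by rw [T.nb_portTo hadj, hcd]⟩
    have htaken : ∀ v q, T.Child v q y → Taken ((Function.update bd x b v).st q) := by
      intro v q hvq
      obtain ⟨rfl, rfl⟩ := hvq.inj hc
      rw [Function.update_self]
      exact .inl hopn
    cases h with
    | fresh p _ hp h =>
      exact
      { depth := by dsimp only; omega
        unseen := hu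
        entry_up := fun _ => hentry
        entry_some := fun _ _ => by simp
        taken := htaken
        cf := fun h => absurd h hr.2.1
        fr_zero := hA.fr_zero
        fr_beyond := hA.fr_beyond
        fr_next := fun pu h => by
          have := hr.2.2
          simp_all
        fr_one := hA.fr_one
        fr_port := fun j pu hj h => by
          dsimp only at hj
          rw [hanc j (by omega), hanc (j + 1) (by omega)]
          exact hA.fr_port j pu hj h
        sat_above := fun j hj => by
          dsimp only at hj
          rw [hanc j (by omega)]
          exact saturated_mono hevo (hA.sat_above j hj)
        reach := hA.reach
        through := fun j hj h h' => by
          dsimp only at hj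
          rw [hanc j (by omega)] at h' ⊢
          rw [hanc (j + 1) (by omega)]
          obtain ⟨h1, h2⟩ := hA.through j hj h h'
          exact ⟨h1, unary_mono hevo (hA.sat_above j hj) h2⟩ }
    | digUp _ _ hf hd _ hq | kUp _ _ hf hd _ _ hq =>
      exfalso
      have := (hI.up_iff x p hr.1 hp).1 hq
      rw [← hy] at this
      omega
    | depart p _ hf hd _ ho hs =>
      have hsat : Saturated T bd x := ⟨hr.1, hf⟩
      exact
      { depth := by dsimp only; omega
        unseen := hu
        entry_up := fun _ => hentry
        entry_some := fun _ _ => by simp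
        taken := htaken
        cf := fun h => absurd h hr.2.1
        fr_zero := by
          dsimp only
          rw [Function.update_of_ne (by omega)]
          exact hA.fr_zero
        fr_beyond := fun j hj => by
          dsimp only at hj ⊢
          rw [Function.update_of_ne (by omega)]
          exact hA.fr_beyond j (by omega)
        fr_next := fun pu h => by
          dsimp only at h
          rw [Function.update_of_ne (by omega), hA.fr_beyond _ (by omega)] at h
          simp at h
        fr_one := fun _ => by
          dsimp only
          by_cases h0 : m.kd = 0
          · simp [h0]
          · rw [Function.update_of_ne (by omega)]
            exact hA.fr_one (by omega)
        fr_port := fun j pu hj h => by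
          dsimp only at hj h
          by_cases hjm : j = m.kd
          · subst hjm
            simp only [Function.update_self, Option.some.injEq] at h
            subst h
            have hd0 : m.kd = T.dep x := by omega
            rw [hd0, hancx, hancy]
            exact hc
          · rw [Function.update_of_ne (by omega)] at h
            rw [hanc j (by omega), hanc (j + 1) (by omega)]
            exact hA.fr_port j pu (by omega) h
        sat_above := fun j hj => by
          dsimp only at hj
          by_cases hjm : j = m.kd
          · have hd0 : j = T.dep x := by omega
            rw [hd0, hancx]
            exact saturated_mono hevo hsat
          · rw [hanc j (by omega)]
            exact saturated_mono hevo (hA.sat_above j (by omega))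
        reach := fun j pu h hB i hi hif => by
          dsimp only at h ⊢
          by_cases hjm : j = m.kd + 1
          · subst hjm
            simp only [Function.update_self, Option.some.injEq] at h
            subst h
            dsimp only at hif
            omega
          · rw [Function.update_of_ne hjm] at h
            obtain ⟨h1, h2⟩ := hA.reach j pu h hB i hi hif
            rw [Function.update_of_ne (by omega)]
            exact ⟨by omega, h2⟩
        through := fun j hj h h' => by
          dsimp only at hj h
          by_cases hjm : j = m.kd
          · subst hjm
            simp at h
          · rw [Function.update_of_ne (by omega)] at h
            rw [hanc j (by omega)] at h' ⊢
            rw [hanc (j + 1) (by omega)]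
            obtain ⟨h1, h2⟩ := hA.through j (by omega) h h'
            exact ⟨h1, unary_mono hevo (hA.sat_above j (by omega)) h2⟩ }
    | pass p j y' pu _ hf hd _ ho hun hj hpu hB hx =>
      have hsat : Saturated T bd x := ⟨hr.1, hf⟩
      have hj0 : j ≠ 0 := by
        rintro rfl
        rw [hA.fr_zero] at hpu
        simp at hpu
      have hj1 := hj.1
      have hnone : ∀ i, Function.update m.fr j (some { pu with B := pu.B - y', far := m.kd + 1 }) i
          = none ↔ m.fr i = none := fun i => by
        by_cases hij : i = j
        · subst hij; simp [hpu]
        · rw [Function.update_of_ne hij]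
      exact
      { depth := by dsimp only; omega
        unseen := hu
        entry_up := fun _ => hentry
        entry_some := fun _ _ => by simp
        taken := htaken
        cf := fun h => absurd h hr.2.1
        fr_zero := (hnone _).2 hA.fr_zero
        fr_beyond := fun i hi => (hnone _).2 (hA.fr_beyond i (by dsimp only at hi; omega))
        fr_next := fun pu' h => by
          dsimp only at h
          rw [Function.update_of_ne (by omega), hA.fr_beyond _ (by omega)] at h
          simp at h
        fr_one := fun _ h => hA.fr_one (by omega) ((hnone 1).1 h)
        fr_port := fun i pu' hi h => by
          dsimp only at hi h
          by_cases him : i = m.kd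
          · subst him
            rw [Function.update_of_ne (by omega), hr.2.2] at h
            simp at h
          · rw [hanc i (by omega), hanc (i + 1) (by omega)]
            by_cases hij : i + 1 = j
            · subst hij
              simp only [Function.update_self, Option.some.injEq] at h
              subst h
              exact hA.fr_port i pu (by omega) hpu
            · rw [Function.update_of_ne hij] at h
              exact hA.fr_port i pu' (by omega) h
        sat_above := fun j hj => by
          dsimp only at hj
          by_cases hjm : j = m.kd
          · have hd0 : j = T.dep x := by omega
            rw [hd0, hancx]
            exact saturated_mono hevo hsat
          · rw [hanc j (by omega)]
            exact saturated_mono hevo (hA.sat_above j (by omega))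
        reach := fun i pu' h hB l hl hlf => by
          dsimp only at h ⊢
          rw [hnone]
          by_cases hij : i = j
          · subst hij
            simp only [Function.update_self, Option.some.injEq] at h
            subst h
            dsimp only at hlf
            refine ⟨hlf, ?_⟩
            by_cases hlm : l = m.kd + 1
            · rw [hlm]; exact hr.2.2
            · exact hj.2 l hl (by omega)
          · rw [Function.update_of_ne hij] at h
            obtain ⟨h1, h2⟩ := hA.reach i pu' h hB l hl hlf
            exact ⟨by omega, h2⟩
        through := fun i hi h h' => by
          dsimp only at hi h
          rw [hnone] at h
          by_cases him : i = m.kd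
          · have hd0 : i = T.dep x := by omega
            have hun' : Unary T (Function.update bd x (bd x)) x := by
              intro q hq q' hq' h1 h2
              rw [Function.update_self] at h1 h2
              rw [hun q hq h1, hun q' hq' h2]
            subst hd0
            rw [hancx] at h' ⊢
            rw [hancy]
            refine ⟨?_, hun'⟩
            -- Some open port leads towards `u`, and `p` is the only open one.
            have hab : T.Above x u := h'.symm
            obtain ⟨q, w, hcq, hw, hqo⟩ := hI.exists_open hsat hab
            have hqp := hun q hcq.1 hqo
            subst hqp
            have hwy : w = y := hcq.2.1.symm
            rw [← hwy] at hcd ⊢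
            exact (hw.eq_anc hcd).symm
          · rw [hanc i (by omega)] at h' ⊢
            rw [hanc (i + 1) (by omega)]
            obtain ⟨h1, h2⟩ := hA.through i (by omega) h h'
            exact ⟨h1, unary_mono hevo (hA.sat_above i (by omega)) h2⟩ }
  · set y := T.nb x p with hy
    have hcd := hc.2.2
    have hanc : ∀ j ≤ T.dep y, T.anc y j = T.anc x j := fun j hj => (hc.anc hj).symm
    have hvy : (bd y).vis := hI.vis_of_taken (hA.taken _ _ hc)
    have hvy' := (hevo y).1 hvy
    have htaken : ∀ v q, T.Child v q y → Taken ((Function.update bd x b v).st q) :=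
      fun v q hvq => (hevo v).taken (hI.taken v q y hvq hvy)
    -- Above `u` there is always a fresh or an open port, so an exhausted vertex does not lie above
    -- `u`.
    have hcf : NoFresh (T.degree x) (bd x) → (∀ q < T.degree x, (bd x).st q ≠ opn) →
        (Function.update bd x b y).vis ∧ ∃ p w, some (T.portTo y x) = some p ∧ T.Child y p w ∧
          Taken ((Function.update bd x b y).st p) ∧ ¬ T.Above w u := by
      intro hf h
      refine ⟨hvy', _, x, rfl, hc, (hevo y).taken (hA.taken _ _ hc), fun hab => ?_⟩
      obtain ⟨q, w, hcq, -, hqo⟩ := hI.exists_open ⟨hr.1, hf⟩ hab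
      exact h q hcq.1 hqo
    cases h with
    | fresh _ _ _ h => rw [hup] at h; simp at h
    | depart _ _ _ _ _ h => rw [hup] at h; simp at h
    | pass _ _ _ _ _ _ _ _ h => rw [hup] at h; simp at h
    | digUp p _ hf hd _ _ =>
      exact
      { depth := by dsimp only; omega
        unseen := hu
        entry_up := fun h => absurd hvy' h
        entry_some := fun h => absurd hvy' h
        taken := htaken
        cf := hcf hf
        fr_zero := hA.fr_zero
        fr_beyond := hA.fr_beyond
        fr_next := fun pu h => by
          have := hr.2.2
          simp_all
        fr_one := hA.fr_one
        fr_port := fun j pu hj h => by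
          dsimp only at hj
          rw [hanc j (by omega), hanc (j + 1) (by omega)]
          exact hA.fr_port j pu hj h
        sat_above := fun j hj => by
          dsimp only at hj
          rw [hanc j (by omega)]
          exact saturated_mono hevo (hA.sat_above j hj)
        reach := hA.reach
        through := fun j hj h h' => by
          dsimp only at hj
          rw [hanc j (by omega)] at h' ⊢
          rw [hanc (j + 1) (by omega)]
          obtain ⟨h1, h2⟩ := hA.through j hj h h'
          exact ⟨h1, unary_mono hevo (hA.sat_above j hj) h2⟩ }
    | kUp p _ hf hd hk _ _ hB =>
      exact
      { depth := by dsimp only; omega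
        unseen := hu
        entry_up := fun h => absurd hvy' h
        entry_some := fun h => absurd hvy' h
        taken := htaken
        cf := hcf hf
        fr_zero := hA.fr_zero
        fr_beyond := fun j hj => by
          dsimp only at hj
          by_cases hjm : j = m.kd + 1
          · rw [hjm]; exact hr.2.2
          · exact hA.fr_beyond j (by omega)
        -- After climbing, the old level `kd` is the next one; its purse was the last, hence empty.
        fr_next := fun pu h => by
          dsimp only at h
          rw [Nat.sub_add_cancel hk] at h
          obtain ⟨l, hl⟩ : ∃ l, m.kd = l + 1 := ⟨m.kd - 1, by omega⟩
          have hxl : T.anc x (l + 1) = x := T.anc_of_le (by omega)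
          have hyl : T.anc x l = y := by rw [← hanc l (by omega)]; exact T.anc_of_le (by omega)
          refine ⟨hd, hB m.kd pu ⟨le_rfl, fun i h1 h2 => by omega⟩ h, ?_, ?_⟩
          · have h1 := hA.fr_port l pu (by omega) (by rw [← hl]; exact h)
            rw [hxl] at h1
            rw [(hc.inj h1).2]
          · rw [← hyl]
            exact saturated_mono hevo (hA.sat_above l (by omega))
        fr_one := fun h => hA.fr_one (by dsimp only at h; omega)
        fr_port := fun j pu hj h => by
          dsimp only at hj
          rw [hanc j (by omega), hanc (j + 1) (by omega)]
          exact hA.fr_port j pu (by omega) h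
        sat_above := fun j hj => by
          dsimp only at hj
          rw [hanc j (by omega)]
          exact saturated_mono hevo (hA.sat_above j (by omega))
        reach := fun j pu h hB' i hi hif => by
          have h1 := hA.reach j pu h hB'
          obtain ⟨h2, h3⟩ := h1 i hi hif
          refine ⟨?_, h3⟩
          dsimp only
          -- If the reach included the level being left, no purse would lie below this one, so it
          -- would be the last and therefore empty.
          by_contra hlt
          have hik : i = m.kd := by omega
          have := hB j pu ⟨by omega, fun l hl hlk => (h1 l hl (by omega)).2⟩ h
          omega
        through := fun j hj h h' => by
          dsimp only at hj
          rw [hanc j (by omega)] at h' ⊢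
          rw [hanc (j + 1) (by omega)]
          obtain ⟨h1, h2⟩ := hA.through j (by omega) h h'
          exact ⟨h1, unary_mono hevo (hA.sat_above j (by omega)) h2⟩ }

/-- Moves that do not reach `u` preserve the structural invariants. -/
lemma Inv.move [DecidableEq V] {c : TokenConfig k V} (hI : Inv T u c) {i : Fin k} {m : Mem}
    {b : Board} {p : ℕ}
    (h : Move k (T.degree (c.pos i)) (c.mem i) (c.board (c.pos i)) m b p)
    (hu : T.nb (c.pos i) p ≠ u) : Inv T u (c.go T i m b p) := by
  have hev : Evolves (c.board (c.pos i)) b := h.evolves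
  have hr : Ready (c.mem i) (c.board (c.pos i)) := h.ready
  have hdir := h.direction hI.board
  refine ⟨h.boardInv hI.board (hI.agent i), fun a => ?_, ?_⟩
  · by_cases ha : a = i
    · subst ha
      simpa [TokenConfig.go] using h.agentInv hI.board (hI.agent a) hu
    · simpa [TokenConfig.go, ha] using (hI.agent a).mono (evolves_update hev)
  · intro v q w hc ho
    by_cases hnew : v = c.pos i ∧ q = p ∧ (c.board v).st q = fresh
    · obtain ⟨rfl, rfl, -⟩ := hnew
      refine ⟨i, .inl ?_⟩
      simp only [TokenConfig.go, Function.update_self]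
      rw [hc.2.1]
      exact T.above_refl w
    have ho' : (c.board v).st q = opn := by
      simp only [TokenConfig.go, Function.update_apply] at ho
      split at ho
      · subst v
        cases h with
        | fresh =>
          simp only [Function.update_apply] at ho
          split at ho
          · simp_all
          · exact ho
        | digUp | kUp | depart | pass => exact ho
      · exact ho
    obtain ⟨a, ha⟩ := hI.guarded v q w hc ho'
    by_cases hai : a = i
    · subst hai
      rcases ha with ha | ⟨-, h2, -⟩
      · rcases hdir with ⟨hd, -⟩ | ⟨hup, hd⟩
        · refine ⟨a, .inl ?_⟩
          simp only [TokenConfig.go, Function.update_self]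
          exact ha.trans hd.above
        · rcases ha.eq_or_parent hd with rfl | hab
          · obtain ⟨rfl, rfl⟩ := hc.inj hd
            by_cases hno : ∀ q < T.degree (c.pos a), (c.board (c.pos a)).st q ≠ opn
            · refine ⟨a, .inr ?_⟩
              simp only [TokenConfig.go, Function.update_self, and_true, true_and]
              cases h with
              | fresh _ _ _ h => rw [hup] at h; simp at h
              | depart _ _ _ _ _ h => rw [hup] at h; simp at h
              | pass _ _ _ _ _ _ _ _ h => rw [hup] at h; simp at h
              | digUp | kUp => exact hno
            -- The vertex being left still has an open port. Its guard is another agent, which is at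
            -- or below this vertex and so takes over the guarding.
            · push Not at hno
              obtain ⟨q', hq', hqo⟩ := hno
              have hc' := hI.board.child hr.1 hq' (by rw [hqo]; simp)
              obtain ⟨a', ha'⟩ := hI.guarded _ _ _ hc' hqo
              have hne : a' ≠ a := by
                rintro rfl
                rcases ha' with ha' | ⟨-, h2, -⟩
                · have := ha'.dep_le
                  have := hc'.2.2
                  omega
                · exact hr.2.1 h2
              refine ⟨a', .inl ?_⟩
              simp only [TokenConfig.go, Function.update_of_ne hne]
              rcases ha' with ha' | ⟨h1, -, -⟩
              · exact hc'.above.trans ha'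
              · rw [h1]; exact T.above_refl _
          · refine ⟨a, .inl ?_⟩
            simpa only [TokenConfig.go, Function.update_self] using hab
      · exact absurd h2 hr.2.1
    · refine ⟨a, ?_⟩
      simpa only [TokenConfig.go, Function.update_of_ne hai] using ha

end TokenSearch

/-! ### Initial state, a bound on open ports by guards, and absence of deadlock. -/

namespace TokenSearch

open Classical PortStatus

variable {k : ℕ} {V : Type} {T : PortTree V} {u : V}

lemma inv_start (hu : u ≠ T.root) : Inv T u (TokenConfig.start T : TokenConfig k V) where
  board :=
  { nonvis := fun v _ => rfl
    up_iff := fun v p h => h.elim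
    taken := fun v p w _ h => h.elim
    unseen := fun h => h
    closed := fun v p w _ h => by simp [TokenConfig.start, blank] at h
    seg_pos := fun v p => le_rfl
    sav_le := fun v p _ => Nat.zero_le _
    rem_le := fun v => Nat.zero_le _ }
  agent a :=
  { depth := T.dep_root
    unseen := hu.symm
    entry_up := fun _ p h => by simp [TokenConfig.start] at h
    entry_some := fun _ h => absurd rfl h
    taken := fun v p h => by
      have := h.2.2
      simp [TokenConfig.start, T.dep_root] at this
    cf := False.elim
    fr_zero := rfl
    fr_beyond := fun _ _ => rfl
    fr_next := fun pu h => by simp [TokenConfig.start, init] at h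
    fr_one := fun h => by simp [TokenConfig.start, init] at h
    fr_port := fun j pu h => by simp [TokenConfig.start, init] at h
    sat_above := fun j h => by simp [TokenConfig.start, init] at h
    reach := fun j pu h => by simp [TokenConfig.start, init] at h
    through := fun j h => by simp [TokenConfig.start, init] at h }
  guarded v p w _ h := by simp [TokenConfig.start, blank] at h

/-- Choosing guards embeds `S` into the complement of `N`. -/
lemma card_add_card_le {ι : Type*} (S : Finset ι) (N : Finset (Fin k)) (G : ι → Fin k → Prop)
    (h1 : ∀ s ∈ S, ∃ a, a ∉ N ∧ G s a) (h2 : ∀ s ∈ S, ∀ s' ∈ S, ∀ a, G s a → G s' a → s = s') :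
    S.card + N.card ≤ k := by
  rcases S.eq_empty_or_nonempty with rfl | ⟨s0, hs0⟩
  · simpa using Finset.card_le_univ N
  have : Nonempty (Fin k) := ⟨(h1 s0 hs0).choose⟩
  choose! f hf using h1
  have h3 : S.card ≤ (Finset.univ \ N).card := by
    refine Finset.card_le_card_of_injOn f (fun s hs => ?_) fun s hs s' hs' h => ?_
    · simpa using (hf s hs).1
    · exact h2 s hs s' hs' (f s) (hf s hs).2 (h ▸ (hf s' hs').2)
  have h4 := Finset.card_sdiff_add_card_inter Finset.univ N
  simp only [Finset.univ_inter, Finset.card_univ, Fintype.card_fin] at h4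
  omega

/-- Different open ports of a vertex have different guards. This keeps the remainder of an even
division at most `k`. -/
lemma Inv.nopen_le {c : TokenConfig k V} (hI : Inv T u c) {v : V} (hv : (c.board v).vis) :
    nopen (T.degree v) (c.board v) ≤ k := by
  have := card_add_card_le (k := k) ((Finset.range (T.degree v)).filter fun p => (c.board v).st p = opn) ∅
    (fun p a => T.Above (T.nb v p) (c.pos a) ∨ c.pos a = v ∧ (c.mem a).cf ∧ c.entry a = some p)
    (fun p hp => by
      simp only [Finset.mem_filter, Finset.mem_range] at hp
      have hc := hI.board.child hv hp.1 (by rw [hp.2]; simp)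
      obtain ⟨a, ha⟩ := hI.guarded v p _ hc hp.2
      exact ⟨a, by simp, ha⟩)
    (fun p hp q hq a h1 h2 => by
      simp only [Finset.mem_filter, Finset.mem_range] at hp hq
      have hcp := hI.board.child hv hp.1 (by rw [hp.2]; simp)
      have hcq := hI.board.child hv hq.1 (by rw [hq.2]; simp)
      rcases h1 with h1 | ⟨h1, -, h1'⟩ <;> rcases h2 with h2 | ⟨h2, -, h2'⟩
      · exact h1.child hcp hcq h2
      · have := h1.dep_le; have := hcp.2.2; rw [h2] at *; omega
      · have := h2.dep_le; have := hcq.2.2; rw [h1] at *; omega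
      · rw [h1'] at h2'; simpa using h2')
  simpa [nopen] using this

lemma nopen_eq_zero {d : ℕ} {b : Board} : nopen d b = 0 ↔ ∀ p < d, b.st p ≠ opn := by
  simp [nopen, Finset.filter_eq_empty_iff]

lemma Prep.step {d : ℕ} {e : Option ℕ} {m m' : Mem} {b b' : Board} (h : Prep k d e m b m' b')
    (hs : ∃ r, Step k d e m' b' r) : ∃ r, Step k d e m b r := by
  obtain ⟨r, m'', b'', h1, h2⟩ := hs
  exact ⟨r, m'', b'', .head h h1, h2⟩

lemma Move.step {d : ℕ} {e : Option ℕ} {m m' : Mem} {b b' : Board} {p : ℕ}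
    (h : Move k d m b m' b' p) : ∃ r, Step k d e m b r := ⟨(m', b', p), m, b, .refl, h⟩

/-- Take `n` to be the smallest deficit: it fills one port and overfills none. -/
lemma exists_least_demand (d : ℕ) (b : Board) (h : nopen d b ≠ 0) :
    ∃ n p, p < d ∧ b.st p = opn ∧ (k + 1) * b.seg p ≤ b.sav p + n ∧
      ∀ q < d, b.st q = opn → b.sav q ≤ (k + 1) * b.seg q → b.sav q + n ≤ (k + 1) * b.seg q := by
  have hne : ((Finset.range d).filter fun p => b.st p = opn).Nonempty := by
    rw [Finset.nonempty_iff_ne_empty]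
    intro h'
    exact h (by rw [nopen, h']; rfl)
  obtain ⟨p, hp, hmin⟩ := Finset.exists_min_image _ (fun p => (k + 1) * b.seg p - b.sav p) hne
  simp only [Finset.mem_filter, Finset.mem_range] at hp hmin
  refine ⟨(k + 1) * b.seg p - b.sav p, p, hp.1, hp.2, by omega, fun q hq ho hs => ?_⟩
  have := hmin q ⟨hq, ho⟩
  omega

lemma exists_active {m : Mem} (hk : 0 < m.kd) (h : m.fr 1 ≠ none) :
    ∃ j pu, Active m j ∧ m.fr j = some pu := by
  have h1 := Nat.findGreatest_spec (P := fun j => m.fr j ≠ none) hk h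
  obtain ⟨pu, hpu⟩ := Option.ne_none_iff_exists'.1 h1
  refine ⟨_, pu, ⟨Nat.findGreatest_le _, fun i h2 h3 => ?_⟩, hpu⟩
  by_contra h4
  exact Nat.findGreatest_is_greatest h2 h3 h4

lemma Active.unique {m : Mem} {j j' : ℕ} {pu pu' : Purse} (h : Active m j) (hp : m.fr j = some pu)
    (h' : Active m j') (hp' : m.fr j' = some pu') : j = j' := by
  rcases lt_trichotomy j j' with h1 | h1 | h1
  · rw [h.2 j' h1 h'.1] at hp'; simp at hp'
  · exact h1
  · rw [h'.2 j h1 h.1] at hp; simp at hp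

lemma Inv.exists_up {c : TokenConfig k V} (hI : Inv T u c) {v : V} (hv : (c.board v).vis)
    (hd : 0 < T.dep v) : ∃ p < T.degree v, (c.board v).st p = up := by
  have hr : v ≠ T.root := by
    rintro rfl
    simp [T.dep_root] at hd
  have hadj := T.par_adj hr
  refine ⟨T.portTo v (T.par v), T.portTo_lt hadj, ?_⟩
  rw [hI.board.up_iff v _ hv (T.portTo_lt hadj), T.nb_portTo hadj]
  exact T.dep_par hr

/-- At the root, the port towards `u` ensures that there is something to fill and to leave through.
Elsewhere in the coordinated part the last purse decides: with two open ports it is paid out until a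
port is full or it is empty, with one it carries the agent on, with none it is dropped. -/
lemma Inv.step_of_ready {c : TokenConfig k V} (hI : Inv T u c) (i : Fin k)
    (hr : Ready (c.mem i) (c.board (c.pos i))) :
    ∃ r, Step k (T.degree (c.pos i)) (c.entry i) (c.mem i) (c.board (c.pos i)) r := by
  have hA := hI.agent i
  set x := c.pos i
  set m := c.mem i
  set b := c.board x with hb
  set d := T.degree x
  have hdep := hA.depth
  by_cases hf : NoFresh d b
  swap
  · unfold NoFresh at hf
    push Not at hf
    obtain ⟨p, hp, h⟩ := hf
    exact (Move.fresh p hr hp h).step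
  by_cases hd : m.dig = 0
  swap
  · obtain ⟨p, hp, h⟩ := hI.exists_up (v := x) hr.1 (by omega)
    exact (Move.digUp p hr hf (by omega) hp h).step
  by_cases hk : m.kd = 0
  · have hno : nopen d b ≠ 0 := by
      rw [Ne, nopen_eq_zero]
      intro h
      have hx : x = T.root := T.dep_eq_zero.1 (by omega)
      have hab : T.Above x u := by
        unfold PortTree.Above
        rw [hx, T.dep_root, T.anc_zero]
      obtain ⟨p, w, hc, -, ho⟩ := hI.board.exists_open ⟨hr.1, hf⟩ hab
      exact h p hc.1 ho
    obtain ⟨n, p, hp, ho, hfull, hn⟩ := exists_least_demand (k := k) d b hno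
    refine Prep.step (Prep.issue n hr hf hd hk fun q hq hqo =>
      hn q hq hqo (hI.board.sav_le x q hq)) ?_
    refine Move.step (Move.depart p hr hf hd hp ho ?_)
    simpa [addTokens, ho] using hfull
  obtain ⟨p, hp, hup⟩ := hI.exists_up (v := x) hr.1 (by omega)
  obtain ⟨j, pu, hj, hpu⟩ := exists_active (by omega) (hA.fr_one (by omega))
  have hjk := hj.1
  by_cases hB : pu.B = 0 ∧ nopen d b ≤ 1
  · refine (Move.kUp p hr hf hd (by omega) hp hup fun j' pu' hj' hpu' => ?_).step
    obtain rfl := hj.unique hpu hj' hpu'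
    rw [hpu] at hpu'
    obtain rfl : pu = pu' := by simpa using hpu'
    exact hB.1
  have hspend : ∀ (y : ℕ) (b' : Board), pu.B - y = 0 → b'.vis → b'.st = b.st → ∃ r, Step k d (c.entry i)
      { m with fr := Function.update m.fr j (some { pu with B := pu.B - y }) } b' r := by
    intro y b' hy hv hst
    have hact : ∀ j', Active { m with fr := Function.update m.fr j (some { pu with B := pu.B - y }) } j' →
        j' ≤ j → j' = j := by
      intro j' hj' hle
      by_contra hne
      have := hj'.2 j (by omega) hj.1
      simp at this
    refine Move.step (Move.kUp p ⟨hv, hr.2.1, ?_⟩ ?_ hd (Nat.pos_of_ne_zero hk) hp (by rw [hst]; exact hup)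
      fun j' pu' hj' hpu' => ?_)
    · dsimp only
      rw [Function.update_of_ne (by omega)]
      exact hr.2.2
    · intro q hq
      rw [hst]; exact hf q hq
    · by_cases hle : j' ≤ j
      · obtain rfl := hact j' hj' hle
        simp only [Function.update_self, Option.some.injEq] at hpu'
        subst hpu'
        exact hy
      · dsimp only at hpu'
        rw [Function.update_of_ne (by omega), hj.2 j' (by omega) hj'.1] at hpu'
        simp at hpu'
  rcases Nat.lt_or_ge 1 (nopen d b) with h2 | h2
  · obtain ⟨n, p', hp', ho, hfull, hn⟩ := exists_least_demand (k := k) d b (by omega)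
    have hn' : ∀ q < d, b.st q = opn → b.sav q + n ≤ (k + 1) * b.seg q := fun q hq hqo =>
      hn q hq hqo (hI.board.sav_le x q hq)
    have hrem : b.rem ≤ k := hI.board.rem_le x
    by_cases hav : n * nopen d b ≤ pu.B + b.rem
    -- There is enough to fill a port; the purse is used before the leftovers, so the leftovers do
    -- not grow.
    · refine Prep.step (Prep.pay n (min pu.B (n * nopen d b))
        (min pu.B (n * nopen d b) + b.rem - n * nopen d b) j pu hr hf hd hn' hj hpu
        (min_le_left _ _) (by omega) (by omega) h2) ?_
      refine Move.step (Move.depart p' ⟨hr.1, hr.2.1, ?_⟩ hf hd hp' ho ?_)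
      · dsimp only
        rw [Function.update_of_ne (by omega)]
        exact hr.2.2
      · simpa [addTokens, ho] using hfull
    -- The whole purse is spent without filling a port; the remainder of the division is left over,
    -- and the agent climbs.
    · have hmod := Nat.div_add_mod' (pu.B + b.rem) (nopen d b)
      have hlt := Nat.mod_lt (pu.B + b.rem) (by omega : 0 < nopen d b)
      have hkn := hI.nopen_le (v := x) hr.1
      refine Prep.step (Prep.pay ((pu.B + b.rem) / nopen d b) pu.B ((pu.B + b.rem) % nopen d b) j pu
        hr hf hd (fun q hq hqo => ?_) hj hpu le_rfl hmod.symm ?_ h2)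
        (hspend _ _ (Nat.sub_self _) hr.1 rfl)
      · have h3 := hn' q hq hqo
        have h4 : (pu.B + b.rem) / nopen d b ≤ n := by
          by_contra h5
          have := Nat.mul_le_mul_right (nopen d b) (show n ≤ (pu.B + b.rem) / nopen d b by omega)
          omega
        omega
      · exact hlt.le.trans hkn
  · rcases Nat.eq_zero_or_pos (nopen d b) with h0 | h0
    · exact Prep.step (Prep.drop j pu hr hf hd (nopen_eq_zero.1 h0) hj hpu)
        (hspend _ _ (Nat.sub_self _) hr.1 rfl)
    · have h1 : nopen d b = 1 := by omega
      obtain ⟨q, hq⟩ := Finset.card_eq_one.1 h1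
      have hq' : ∀ p, p < d ∧ b.st p = opn ↔ p = q := fun p => by
        have := congrArg (fun s => p ∈ s) hq
        simpa using this
      obtain ⟨hqd, hqo⟩ := (hq' q).2 rfl
      have hex : ∃ y, y = 0 ∧ m.kd + 2 ≤ pu.sd + j ∨ y = 1 ∧ pu.sd + j < m.kd + 2 := by
        rcases Nat.lt_or_ge (pu.sd + j) (m.kd + 2) with h | h
        · exact ⟨1, .inr ⟨rfl, h⟩⟩
        · exact ⟨0, .inl ⟨rfl, h⟩⟩
      obtain ⟨y, hy⟩ := hex
      exact (Move.pass q j y pu hr hf hd hqd hqo (fun p hp ho => (hq' p).1 ⟨hp, ho⟩) hj hpu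
        (by omega) hy).step

/-- Marking, closing and dissolving, in this order and as far as needed, make the agent ready. -/
lemma Inv.exists_step [DecidableEq V] {c : TokenConfig k V} (hI : Inv T u c) (i : Fin k) :
    ∃ r, Step k (T.degree (c.pos i)) (c.entry i) (c.mem i) (c.board (c.pos i)) r := by
  have key : ∀ c : TokenConfig k V, Inv T u c → (c.board (c.pos i)).vis → ¬ (c.mem i).cf →
      ∃ r, Step k (T.degree (c.pos i)) (c.entry i) (c.mem i) (c.board (c.pos i)) r := by
    intro c hI hv hc
    by_cases hn : (c.mem i).fr ((c.mem i).kd + 1) = none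
    · exact hI.step_of_ready i ⟨hv, hc, hn⟩
    · obtain ⟨pu, hpu⟩ := Option.ne_none_iff_exists'.1 hn
      have hp := Prep.dissolve (k := k) (d := T.degree (c.pos i)) (e := c.entry i) pu hv hc hpu
      refine hp.step ?_
      have := (hI.prep hp).step_of_ready i
      simp only [TokenConfig.upd, Function.update_self] at this
      exact this ⟨hv, hc, by simp⟩
  have key2 : ∀ c : TokenConfig k V, Inv T u c → (c.board (c.pos i)).vis →
      ∃ r, Step k (T.degree (c.pos i)) (c.entry i) (c.mem i) (c.board (c.pos i)) r := by
    intro c hI hv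
    by_cases hc : (c.mem i).cf
    · obtain ⟨-, p, -, hp, -⟩ := (hI.agent i).cf hc
      have hp := Prep.close (k := k) (d := T.degree (c.pos i)) p hv hc hp
      refine hp.step ?_
      have := key _ (hI.prep hp)
      simp only [TokenConfig.upd, Function.update_self] at this
      exact this hv not_false
    · exact key c hI hv hc
  by_cases hv : (c.board (c.pos i)).vis
  · exact key2 c hI hv
  · have hp := Prep.mark (k := k) (d := T.degree (c.pos i)) (e := c.entry i) (m := c.mem i) hv
    refine hp.step ?_
    have := key2 _ (hI.prep hp)
    simp only [TokenConfig.upd, Function.update_self] at this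
    exact this trivial

end TokenSearch

/-! ### Counting moves by entered edges and tokens. -/

namespace TokenSearch

open Classical PortStatus

variable {k : ℕ} {V : Type} {T : PortTree V} {u : V}

lemma sum_change {ι : Type*} {s : Finset ι} {g g' : ι → ℕ} {i : ι} (hi : i ∈ s)
    (h : ∀ j, j ≠ i → g' j = g j) : ∑ j ∈ s, g' j + g i = ∑ j ∈ s, g j + g' i := by
  rw [← Finset.add_sum_erase s g hi, ← Finset.add_sum_erase s g' hi,
    Finset.sum_congr (g := g) rfl fun j hj => h j (Finset.ne_of_mem_erase hj)]
  ring

/-- The tokens of a purse, including one for each edge that is still free of charge. -/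
def credit (j : ℕ) (o : Option Purse) : ℕ :=
  o.elim 0 fun pu => pu.B + (pu.sd - (pu.far - (j - 1)))

/-- The tokens in a memory. -/
def memTokens (M : ℕ) (m : Mem) : ℕ := ∑ j ∈ Finset.range M, credit j (m.fr j)

/-- The tokens on a whiteboard. -/
def boardTokens (d : ℕ) (b : Board) : ℕ := ∑ p ∈ Finset.range d, b.sav p + b.rem

/-- The number of ports that lead to entered children. -/
noncomputable def ntaken (d : ℕ) (b : Board) : ℕ :=
  ((Finset.range d).filter fun p => Taken (b.st p)).card

lemma memTokens_update {M : ℕ} {m : Mem} {j : ℕ} (hj : j < M) (o : Option Purse) (kd dig : ℕ)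
    (cf : Prop) :
    memTokens M ⟨kd, dig, Function.update m.fr j o, cf⟩ + credit j (m.fr j) =
      memTokens M m + credit j o := by
  have := sum_change (s := Finset.range M) (g := fun j => credit j (m.fr j))
    (g' := fun i => credit i (Function.update m.fr j o i)) (i := j) (by simpa using hj)
    fun i hi => by simp [hi]
  simpa [memTokens] using this

lemma sum_addTokens (d : ℕ) (b : Board) (n : ℕ) :
    ∑ p ∈ Finset.range d, (addTokens b n).sav p = ∑ p ∈ Finset.range d, b.sav p + n * nopen d b := by
  have h : ∀ p, (addTokens b n).sav p = b.sav p + if b.st p = opn then n else 0 := fun p => by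
    simp only [addTokens]; split <;> simp
  simp only [h, Finset.sum_add_distrib, nopen]
  rw [← Finset.sum_filter, Finset.sum_const, smul_eq_mul, mul_comm]

/-- Tokens are created only by `issue`, which enters them in `tot`; the other operations shift or
destroy them. A change of `tot` happens only at the root. -/
lemma Prep.tokens {M d : ℕ} {e : Option ℕ} {m m' : Mem} {b b' : Board}
    (h : Prep k d e m b m' b') (hM : m.kd + 1 < M) :
    boardTokens d b' + memTokens M m' + b.tot ≤ boardTokens d b + memTokens M m + b'.tot ∧
      (b'.tot = b.tot ∨ m.kd = 0 ∧ m.dig = 0) := by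
  cases h with
  | mark => exact ⟨le_rfl, .inl rfl⟩
  | close => exact ⟨le_rfl, .inl rfl⟩
  | dissolve pu hv hc h =>
    refine ⟨?_, .inl rfl⟩
    have := memTokens_update (m := m) hM none m.kd m.dig m.cf
    have h0 : credit (m.kd + 1) none = 0 := rfl
    simp only [boardTokens]
    omega
  | issue n hr hf hd h0 hn =>
    refine ⟨?_, .inr ⟨h0, hd⟩⟩
    have := sum_addTokens d b n
    have h1 : (addTokens b n).rem = b.rem := rfl
    simp only [boardTokens] at *
    omega
  | pay n y r j pu hr hf hd hn hj hp hx hs hrk h2 =>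
    refine ⟨?_, .inl rfl⟩
    have h1 := sum_addTokens d b n
    have h3 := memTokens_update (m := m) (by have := hj.1; omega : j < M)
      (some { pu with B := pu.B - y }) m.kd m.dig m.cf
    have h4 : credit j (some { pu with B := pu.B - y }) + y = credit j (m.fr j) := by
      simp only [credit, hp, Option.elim]
      omega
    have h5 : (addTokens b n).tot = b.tot := rfl
    simp only [boardTokens] at *
    omega
  | drop j pu hr hf hd ho hj hp =>
    refine ⟨?_, .inl rfl⟩
    have h3 := memTokens_update (m := m) (by have := hj.1; omega : j < M)
      (some { pu with B := pu.B - pu.B }) m.kd m.dig m.cf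
    have h4 : credit j (some { pu with B := pu.B - pu.B }) ≤ credit j (m.fr j) := by
      simp only [credit, hp, Option.elim]
      omega
    simp only [boardTokens] at *
    omega

lemma ntaken_congr {d : ℕ} {b b' : Board} (h : ∀ p < d, Taken (b'.st p) ↔ Taken (b.st p)) :
    ntaken d b' = ntaken d b := by
  unfold ntaken
  congr 1
  refine Finset.filter_congr fun p hp => h p (by simpa using hp)

lemma Prep.ntaken_eq {d : ℕ} {e : Option ℕ} {m m' : Mem} {b b' : Board}
    (h : Prep k d e m b m' b') (hb : ¬ b.vis → b = blank)
    (hc : m.cf → ∃ p, e = some p ∧ Taken (b.st p)) : ntaken d b' = ntaken d b := by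
  cases h with
  | mark h =>
    refine ntaken_congr fun p _ => ?_
    have h1 : b.st p = fresh := by rw [hb h]; rfl
    simp only [h1]
    split <;> simp [Taken]
  | close p hv h hp =>
    obtain ⟨p', hp', ht⟩ := hc h
    obtain rfl : p = p' := by rw [hp] at hp'; simpa using hp'
    refine ntaken_congr fun q _ => ?_
    by_cases hq : q = p
    · subst hq
      simp only [Function.update_self, ht, iff_true]
      exact .inr rfl
    · simp [hq]
  | dissolve | issue | pay | drop => rfl

/-- A move takes a fresh port, or pays a token, or goes up. -/
lemma Move.tokens {M d : ℕ} {m m' : Mem} {b b' : Board} {p : ℕ}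
    (h : Move k d m b m' b' p) (hM : m.kd + 1 < M)
    (hre : ∀ j pu, m.fr j = some pu → 1 ≤ pu.B →
      ∀ i, j < i → i ≤ pu.far → i ≤ m.kd ∧ m.fr i = none) (h0 : m.fr 0 = none) (hsp : ∀ p, 1 ≤ b.seg p) :
    b'.tot = b.tot ∧
    (b.st p = up ∧ ntaken d b' = ntaken d b ∧
        boardTokens d b' + memTokens M m' = boardTokens d b + memTokens M m ∨
      b.st p ≠ up ∧ ntaken d b' = ntaken d b + 1 ∧
        boardTokens d b' + memTokens M m' = boardTokens d b + memTokens M m ∨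
      b.st p ≠ up ∧ ntaken d b' = ntaken d b ∧
        boardTokens d b' + memTokens M m' + 1 ≤ boardTokens d b + memTokens M m) := by
  cases h with
  | fresh p hr hp h =>
    refine ⟨rfl, .inr (.inl ⟨by rw [h]; simp, ?_, rfl⟩)⟩
    unfold ntaken
    rw [← Finset.card_insert_of_notMem (a := p) (by
      rw [Finset.mem_filter, h]
      simp [Taken])]
    congr 1
    ext q
    by_cases hq : q = p
    · subst hq
      rw [Finset.mem_filter, Finset.mem_range]
      simpa [Taken] using hp
    · simp [hq]
  | digUp p _ _ _ _ h => exact ⟨rfl, .inl ⟨h, rfl, rfl⟩⟩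
  | kUp p _ _ _ _ _ h => exact ⟨rfl, .inl ⟨h, rfl, rfl⟩⟩
  | depart p hr hf hd hp h hs =>
    refine ⟨rfl, .inr (.inr ⟨by rw [h]; simp, rfl, ?_⟩)⟩
    have h3 := memTokens_update (m := m) hM (some ⟨k * b.seg p, b.seg p, m.kd + 1, p⟩) (m.kd + 1)
      m.dig m.cf
    have h4 : credit (m.kd + 1) (m.fr (m.kd + 1)) = 0 := by rw [hr.2.2]; rfl
    have h5 : credit (m.kd + 1) (some ⟨k * b.seg p, b.seg p, m.kd + 1, p⟩) + 1 =
        (k + 1) * b.seg p := by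
      have := hsp p
      simp only [credit, Option.elim, add_mul]
      omega
    have h6 := sum_change (s := Finset.range d) (g := b.sav)
      (g' := Function.update b.sav p (b.sav p - (k + 1) * b.seg p)) (i := p) (by simpa using hp)
      fun j hj => by simp [hj]
    simp only [Function.update_self] at h6
    simp only [boardTokens] at *
    omega
  | pass p j y pu hr hf hd hp h hu hj hpu hB hx =>
    refine ⟨rfl, .inr (.inr ⟨by rw [h]; simp, rfl, ?_⟩)⟩
    have hj1 := hj.1
    have hj0 : j ≠ 0 := by
      rintro rfl
      rw [h0] at hpu
      simp at hpu
    have h3 := memTokens_update (m := m) (by omega : j < M)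
      (some { pu with B := pu.B - y, far := m.kd + 1 }) (m.kd + 1) m.dig m.cf
    -- A purse with tokens left has not been carried back, so `far` strictly increases, and either a
    -- free edge or a token is used up.
    have hfar : pu.far ≤ m.kd := by
      by_contra hlt
      have := hre j pu hpu hB (m.kd + 1) (by omega) (by omega)
      omega
    have h4 : credit j (some { pu with B := pu.B - y, far := m.kd + 1 }) + 1 ≤ credit j (m.fr j) := by
      simp only [credit, hpu, Option.elim]
      omega
    omega

variable [Fintype V]

/-- The number of edges that were entered. -/
noncomputable def edges (T : PortTree V) (c : TokenConfig k V) : ℕ := ∑ v, ntaken (T.degree v) (c.board v)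

/-- The number of tokens in the system. -/
noncomputable def tokens (T : PortTree V) (c : TokenConfig k V) : ℕ :=
  ∑ v, boardTokens (T.degree v) (c.board v) + ∑ a, memTokens (T.depth + 2) (c.mem a)

/-- The accounting of the moves. -/
def Count (T : PortTree V) (c : TokenConfig k V) (t : ℕ) : Prop :=
  -- `N` counts the downward moves through ports that were not fresh. There are `edges + N` downward
  -- moves, and the sum of the depths is downward minus upward moves.
  ∃ N, t + ∑ a, T.dep (c.pos a) = 2 * (edges T c + N) ∧ N + tokens T c ≤ (c.board T.root).tot

lemma count_start : Count T (TokenConfig.start T : TokenConfig k V) 0 := by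
  refine ⟨0, ?_, ?_⟩
  · simp [TokenConfig.start, T.dep_root, edges, ntaken, blank, Taken]
  · simp [TokenConfig.start, tokens, boardTokens, memTokens, credit, blank, init]

lemma Inv.kd_lt {c : TokenConfig k V} (hI : Inv T u c) (i : Fin k) :
    (c.mem i).kd + 1 < T.depth + 2 := by
  have h1 := T.dep_le_depth (c.pos i)
  have h2 := (hI.agent i).depth
  omega

lemma Count.prep [DecidableEq V] {c : TokenConfig k V} (hI : Inv T u c) {t : ℕ} (hC : Count T c t)
    {i : Fin k} {m : Mem} {b : Board}
    (h : Prep k (T.degree (c.pos i)) (c.entry i) (c.mem i) (c.board (c.pos i)) m b) :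
    Count T (c.upd i m b) t := by
  obtain ⟨N, h1, h2⟩ := hC
  have h3 := h.ntaken_eq (hI.board.nonvis _) fun hc => by
    obtain ⟨-, p, w, h2, -, h4, -⟩ := (hI.agent i).cf hc
    exact ⟨p, h2, h4⟩
  obtain ⟨h4, h5⟩ := h.tokens (hI.kd_lt i)
  have h6 := sum_change (s := Finset.univ) (g := fun v => boardTokens (T.degree v) (c.board v))
    (g' := fun v => boardTokens (T.degree v) ((c.upd i m b).board v)) (i := c.pos i) (by simp)
    fun j hj => by simp [TokenConfig.upd, hj]
  have h7 := sum_change (s := Finset.univ) (g := fun v => ntaken (T.degree v) (c.board v))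
    (g' := fun v => ntaken (T.degree v) ((c.upd i m b).board v)) (i := c.pos i) (by simp)
    fun j hj => by simp [TokenConfig.upd, hj]
  have h8 := sum_change (s := Finset.univ) (g := fun a => memTokens (T.depth + 2) (c.mem a))
    (g' := fun a => memTokens (T.depth + 2) ((c.upd i m b).mem a)) (i := i) (by simp)
    fun j hj => by simp [TokenConfig.upd, hj]
  have e1 : (c.upd i m b).board (c.pos i) = b := by simp [TokenConfig.upd]
  have e2 : (c.upd i m b).mem i = m := by simp [TokenConfig.upd]
  simp only [e1, e2] at h6 h7 h8
  have h9 : (c.board T.root).tot + b.tot = ((c.upd i m b).board T.root).tot + (c.board (c.pos i)).tot := by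
    by_cases hr : T.root = c.pos i
    · rw [hr, e1]; omega
    · have h10 : (c.upd i m b).board T.root = c.board T.root := by
        simp [TokenConfig.upd, hr]
      rw [h10]
      rcases h5 with h5 | h5
      · omega
      · exfalso
        have := (hI.agent i).depth
        exact hr (T.dep_eq_zero.1 (by omega)).symm
  refine ⟨N, ?_, ?_⟩
  · simp only [edges, TokenConfig.upd_pos] at *
    omega
  · simp only [tokens] at *
    omega

lemma Count.move [DecidableEq V] {c : TokenConfig k V} (hI : Inv T u c) {t : ℕ} (hC : Count T c t)
    {i : Fin k} {m : Mem} {b : Board} {p : ℕ}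
    (h : Move k (T.degree (c.pos i)) (c.mem i) (c.board (c.pos i)) m b p) :
    Count T (c.go T i m b p) (t + 1) := by
  obtain ⟨N, h1, h2⟩ := hC
  have hA := hI.agent i
  obtain ⟨h4, h5⟩ := h.tokens (hI.kd_lt i) hA.reach hA.fr_zero (hI.board.seg_pos _)
  have h6 := sum_change (s := Finset.univ) (g := fun v => boardTokens (T.degree v) (c.board v))
    (g' := fun v => boardTokens (T.degree v) ((c.go T i m b p).board v)) (i := c.pos i) (by simp)
    fun j hj => by simp [TokenConfig.go, hj]
  have h7 := sum_change (s := Finset.univ) (g := fun v => ntaken (T.degree v) (c.board v))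
    (g' := fun v => ntaken (T.degree v) ((c.go T i m b p).board v)) (i := c.pos i) (by simp)
    fun j hj => by simp [TokenConfig.go, hj]
  have h8 := sum_change (s := Finset.univ) (g := fun a => memTokens (T.depth + 2) (c.mem a))
    (g' := fun a => memTokens (T.depth + 2) ((c.go T i m b p).mem a)) (i := i) (by simp)
    fun j hj => by simp [TokenConfig.go, hj]
  have h9 := sum_change (s := Finset.univ) (g := fun a => T.dep (c.pos a))
    (g' := fun a => T.dep ((c.go T i m b p).pos a)) (i := i) (by simp)
    fun j hj => by simp [TokenConfig.go, hj]
  have e1 : (c.go T i m b p).board (c.pos i) = b := by simp [TokenConfig.go]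
  have e2 : (c.go T i m b p).mem i = m := by simp [TokenConfig.go]
  have e3 : (c.go T i m b p).pos i = T.nb (c.pos i) p := by simp [TokenConfig.go]
  simp only [e1, e2, e3] at h6 h7 h8 h9
  have h10 : ((c.go T i m b p).board T.root).tot = (c.board T.root).tot := by
    by_cases hr : T.root = c.pos i
    · rw [hr, e1, h4]
    · simp [TokenConfig.go, hr]
  have hup := hI.board.up_iff (c.pos i) p h.ready.1 h.lt
  have hadj := T.dep_adj (T.adj_nb h.lt)
  rcases h5 with ⟨h5, h11, h12⟩ | ⟨h5, h11, h12⟩ | ⟨h5, h11, h12⟩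
  · have := hup.1 h5
    refine ⟨N, ?_, ?_⟩
    · simp only [edges] at *
      omega
    · simp only [tokens] at *
      omega
  · have := hadj.resolve_right (mt hup.2 h5)
    refine ⟨N, ?_, ?_⟩
    · simp only [edges] at *
      omega
    · simp only [tokens] at *
      omega
  · have := hadj.resolve_right (mt hup.2 h5)
    refine ⟨N + 1, ?_, ?_⟩
    · simp only [edges] at *
      omega
    · simp only [tokens] at *
      omega

/-- Entered ports are sent injectively to the children behind them, none of which is the root. -/
lemma Inv.edges_lt {c : TokenConfig k V} (hI : Inv T u c) : edges T c + 1 ≤ Fintype.card V := by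
  have h1 : edges T c = ((Finset.univ : Finset V).sigma fun v =>
      (Finset.range (T.degree v)).filter fun p => Taken ((c.board v).st p)).card := by
    rw [Finset.card_sigma]; rfl
  have hchild : ∀ s : (_ : V) × ℕ, s ∈ (Finset.univ : Finset V).sigma (fun v =>
      (Finset.range (T.degree v)).filter fun p => Taken ((c.board v).st p)) →
      T.Child s.1 s.2 (T.nb s.1 s.2) := by
    rintro ⟨v, p⟩ h
    simp only [Finset.mem_sigma, Finset.mem_univ, Finset.mem_filter, Finset.mem_range, true_and] at h
    refine hI.board.child (hI.board.vis_of_taken h.2) h.1 ?_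
    rcases h.2 with h | h <;> rw [h] <;> simp
  have h2 := Finset.card_le_card_of_injOn (s := (Finset.univ : Finset V).sigma fun v =>
      (Finset.range (T.degree v)).filter fun p => Taken ((c.board v).st p))
      (t := Finset.univ.erase T.root) (fun s => T.nb s.1 s.2) (fun s hs => by
        have := (hchild s hs).2.2
        simp only [Finset.coe_erase, Finset.coe_univ, Set.mem_sdiff, Set.mem_univ, true_and,
          Set.mem_singleton_iff]
        intro hr
        simp only [hr, T.dep_root] at this
        omega) (fun s hs s' hs' h => by
        have h3 := hchild s hs
        have h4 := hchild s' hs'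
        simp only at h
        rw [← h] at h4
        obtain ⟨h5, h6⟩ := h3.inj h4
        exact Sigma.ext h5 (heq_of_eq h6))
  rw [Finset.card_erase_of_mem (Finset.mem_univ _), Finset.card_univ] at h2
  have : 0 < Fintype.card V := Fintype.card_pos_iff.2 ⟨T.root⟩
  omega

/-- The number of moves in terms of the number of tokens that were issued. -/
lemma Count.le {c : TokenConfig k V} (hI : Inv T u c) {t : ℕ} (hC : Count T c t) :
    t + 2 ≤ 2 * Fintype.card V + 2 * (c.board T.root).tot := by
  obtain ⟨N, h1, h2⟩ := hC
  have := hI.edges_lt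
  omega

end TokenSearch

/-! ### The potential of an abstract path and the bound on the tokens issued. -/

namespace TokenSearch

/-- The state of the path to a vertex: which levels are saturated, the numbers of open ports beside
the path, the values of the tokens saved and carried, and the tokens left over. -/
structure PathState where
  ps : ℕ → Prop
  sg : ℕ → ℕ
  val : ℕ → ℕ
  rm : ℕ → ℕ

namespace PathState

open Classical

/-- The growth of the weight per open port. -/
noncomputable def lam (k : ℕ) : ℝ := (k + 2) / k

/-- The weight of a level. -/
noncomputable def wt (k : ℕ) (s : ℕ → ℕ) (h : ℕ) : ℝ := ∏ l ∈ Finset.range h, (1 + lam k * s l)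

/-- The number of open ports beside the path above a level. -/
def rho (s : ℕ → ℕ) (h : ℕ) : ℕ := ∑ l ∈ Finset.range h, s l

/-- The largest value of a level with `r` open ports beside the path above it. -/
noncomputable def cap (k r : ℕ) : ℝ := (k + 1) ^ 2 * (k + 3 - r) * (1 + lam k) ^ r

/-- The sum of the largest values. -/
noncomputable def capSum (k r : ℕ) : ℝ := ∑ x ∈ Finset.range (r + 1), cap k x

/-- The contribution of a level to the potential. -/
noncomputable def term (k : ℕ) (D : PathState) (h : ℕ) : ℝ :=
  -- Only forks count, so that segments of counted levels do not overlap. The root is kept because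
  -- tokens enter there even if it is no fork.
  if h = 0 ∨ 1 ≤ D.sg h then wt k D.sg (h + 1) * D.val h + (k + 1) * wt k D.sg h * D.rm h else 0

/-- The value of the losses at a level. -/
noncomputable def loss (k : ℕ) (D : PathState) (e : ℕ) : ℝ :=
  if D.ps e then capSum k k - capSum k (rho D.sg (e + 1)) else 0

/-- The tokens issued are accounted for by the potential and the losses. -/
def Covers (k L : ℕ) (D : PathState) (R : ℕ) : Prop :=
  (k : ℝ) * R ≤ ∑ h ∈ Finset.range L, term k D h + ∑ e ∈ Finset.range L, loss k D e

/-- The bounds that hold for the states of a path. -/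
structure Bounded (k L : ℕ) (D : PathState) (seg n : ℕ → ℕ) : Prop where
  down : ∀ e, D.ps (e + 1) → D.ps e
  sg_zero : ∀ e, ¬ D.ps e → D.sg e = 0
  seg_pos : ∀ h, 1 ≤ seg h
  seg_le : ∀ h < L, D.ps h → h + seg h ≤ L
  chain : ∀ h < L, D.ps h → ∀ x, h < x → x < h + seg h → D.ps x ∧ D.sg x = 0
  val_le : ∀ h < L, D.ps h → D.val h ≤ (k + 1) ^ 2 * (seg h * (n h + 2))
  agents : ∀ h < L, D.ps h → n h + rho D.sg (h + 1) ≤ k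
  val_zero : ∀ h < L, ¬ D.ps h → D.val h = 0
  rm_zero : ∀ h < L, ¬ D.ps h → D.rm h = 0
  rm_le : ∀ h < L, D.rm h ≤ k

variable {k L : ℕ}

lemma lam_pos (hk : 1 ≤ k) : 0 < lam k := by
  have : (1 : ℝ) ≤ k := by exact_mod_cast hk
  unfold lam; positivity

lemma k_mul_lam (hk : 1 ≤ k) : k * lam k = k + 2 := by
  have : (1 : ℝ) ≤ k := by exact_mod_cast hk
  unfold lam; field_simp

lemma wt_pos (hk : 1 ≤ k) (s : ℕ → ℕ) (h : ℕ) : 0 < wt k s h :=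
  Finset.prod_pos fun l _ => by have := lam_pos hk; positivity

lemma wt_succ (s : ℕ → ℕ) (h : ℕ) : wt k s (h + 1) = wt k s h * (1 + lam k * s h) :=
  Finset.prod_range_succ _ _

/-- Bernoulli's inequality in each factor. -/
lemma wt_le (hk : 1 ≤ k) (s : ℕ → ℕ) (h : ℕ) : wt k s h ≤ (1 + lam k) ^ rho s h := by
  unfold wt rho
  rw [← Finset.prod_pow_eq_pow_sum]
  refine Finset.prod_le_prod (fun l _ => by have := lam_pos hk; positivity) fun l _ => ?_
  have := one_add_mul_le_pow (a := lam k) (by have := lam_pos hk; linarith) (s l)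
  linarith [mul_comm (lam k) (s l : ℝ)]

lemma wt_congr {s s' : ℕ → ℕ} {h : ℕ} (hs : ∀ l < h, s l = s' l) : wt k s h = wt k s' h :=
  Finset.prod_congr rfl fun l hl => by rw [hs l (Finset.mem_range.1 hl)]

lemma rho_congr {s s' : ℕ → ℕ} {h : ℕ} (hs : ∀ l < h, s l = s' l) : rho s h = rho s' h :=
  Finset.sum_congr rfl fun l hl => hs l (Finset.mem_range.1 hl)

lemma rho_mono {s : ℕ → ℕ} {h h' : ℕ} (hh : h ≤ h') : rho s h ≤ rho s h' :=
  Finset.sum_le_sum_of_subset (Finset.range_mono hh)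

lemma cap_nonneg (hk : 1 ≤ k) {r : ℕ} (hr : r ≤ k) : 0 ≤ cap k r := by
  have h1 : (r : ℝ) ≤ k := by exact_mod_cast hr
  have h2 := lam_pos hk
  have : (0 : ℝ) ≤ k + 3 - r := by linarith
  unfold cap; positivity

lemma capSum_mono (hk : 1 ≤ k) {r r' : ℕ} (h : r ≤ r') (hr : r' ≤ k) : capSum k r ≤ capSum k r' :=
  Finset.sum_le_sum_of_subset_of_nonneg (Finset.range_mono (by omega)) fun x hx _ =>
    cap_nonneg hk (by simp at hx; omega)

lemma term_nonneg (hk : 1 ≤ k) (D : PathState) (h : ℕ) : 0 ≤ term k D h := by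
  unfold term
  have h1 := wt_pos hk D.sg (h + 1)
  have h2 := wt_pos hk D.sg h
  split <;> positivity

lemma Bounded.rho_le {D : PathState} {seg n : ℕ → ℕ} (hD : Bounded k L D seg n) {e : ℕ} (he : e < L)
    (hp : D.ps e) : rho D.sg (e + 1) ≤ k := by
  have := hD.agents e he hp; omega

/-- The value is at most `(k + 1) ^ 2 * seg * (n + 2)`, the leftovers raise `n + 2` to `n + 3`, and
`n + rho ≤ k` turns this into the factor `k + 3 - r` of `cap`. -/
lemma Bounded.term_le (hk : 1 ≤ k) {D : PathState} {seg n : ℕ → ℕ} (hD : Bounded k L D seg n) {h : ℕ}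
    (hL : h < L) (hp : D.ps h) : term k D h ≤ seg h * cap k (rho D.sg (h + 1)) := by
  have h1 := hD.val_le h hL hp
  have h2 := hD.agents h hL hp
  have h3 := hD.rm_le h hL
  have h4 := wt_le hk D.sg (h + 1)
  have h5 := wt_le hk D.sg h
  have h6 := lam_pos hk
  have h7 : (1 + lam k) ^ rho D.sg h ≤ (1 + lam k) ^ rho D.sg (h + 1) :=
    pow_le_pow_right₀ (by linarith) (rho_mono (Nat.le_succ h))
  have hs : (1 : ℝ) ≤ seg h := by exact_mod_cast hD.seg_pos h
  have hnn : 0 ≤ (seg h : ℝ) * cap k (rho D.sg (h + 1)) :=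
    mul_nonneg (by linarith) (cap_nonneg hk (by omega))
  unfold term
  split
  swap
  · exact hnn
  unfold cap
  set P := (1 + lam k) ^ rho D.sg (h + 1)
  set r := rho D.sg (h + 1)
  have hP : 0 < P := by positivity
  have h1' : (D.val h : ℝ) ≤ (k + 1) ^ 2 * (seg h * (n h + 2)) := by exact_mod_cast h1
  have h2' : (n h : ℝ) + r ≤ k := by exact_mod_cast h2
  have h3' : (D.rm h : ℝ) ≤ k := by exact_mod_cast h3
  have a1 : wt k D.sg (h + 1) * D.val h ≤ P * ((k + 1) ^ 2 * (seg h * (n h + 2))) :=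
    mul_le_mul h4 h1' (by positivity) hP.le
  have a2 : (k + 1) * wt k D.sg h * D.rm h ≤ (k + 1) * P * (k + 1) := by
    have := wt_pos hk D.sg h
    refine mul_le_mul (mul_le_mul_of_nonneg_left (h5.trans h7) (by positivity)) (by linarith)
      (by positivity) (by positivity)
  have a3 : P * ((k + 1 : ℝ) ^ 2 * (seg h * (n h + 2))) + (k + 1) * P * (k + 1) ≤
      P * (k + 1) ^ 2 * (seg h * (n h + 3)) := by
    have : 0 ≤ P * (k + 1 : ℝ) ^ 2 * (seg h - 1) := by
      refine mul_nonneg (by positivity) (by linarith)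
    nlinarith
  have a4 : P * (k + 1 : ℝ) ^ 2 * (seg h * (n h + 3)) ≤ P * (k + 1) ^ 2 * (seg h * (k + 3 - r)) := by
    refine mul_le_mul_of_nonneg_left (mul_le_mul_of_nonneg_left (by linarith) (by linarith))
      (by positivity)
  linarith

/-- The levels from `l` on have at most the largest values. -/
lemma Bounded.sum_le (hk : 1 ≤ k) {D : PathState} {seg n : ℕ → ℕ} (hD : Bounded k L D seg n) (l : ℕ) :
    ∑ h ∈ Finset.Ico l L, term k D h ≤
      ∑ e ∈ Finset.Ico l L, if D.ps e then cap k (rho D.sg (e + 1)) else 0 := by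
  obtain ⟨d, hd⟩ : ∃ d, d = L - l := ⟨_, rfl⟩
  induction d using Nat.strong_induction_on generalizing l with
  | _ d ih =>
    have hnn : ∀ e ∈ Finset.Ico l L, 0 ≤ if D.ps e then cap k (rho D.sg (e + 1)) else 0 := by
      intro e he
      split
      · exact cap_nonneg hk (hD.rho_le (Finset.mem_Ico.1 he).2 ‹_›)
      · exact le_rfl
    rcases Nat.lt_or_ge l L with hl | hl
    swap
    · simp [Finset.Ico_eq_empty_of_le hl]
    by_cases hp : D.ps l
    · have hsp := hD.seg_pos l
      have hsl := hD.seg_le l hl hp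
      have hch := hD.chain l hl hp
      have hle : l + seg l ≤ L := hsl
      rw [← Finset.sum_Ico_consecutive _ (show l ≤ l + seg l by omega) hle,
        ← Finset.sum_Ico_consecutive _ (show l ≤ l + seg l by omega) hle]
      refine add_le_add ?_ (ih _ (by omega) _ rfl)
      have h1 : ∑ h ∈ Finset.Ico l (l + seg l), term k D h = term k D l := by
        refine Finset.sum_eq_single_of_mem l (by simp; omega) fun x hx hne => ?_
        rw [Finset.mem_Ico] at hx
        have := (hch x (by omega) hx.2).2
        unfold term
        rw [if_neg (by omega)]
      have h2 : ∑ e ∈ Finset.Ico l (l + seg l), (if D.ps e then cap k (rho D.sg (e + 1)) else 0) =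
          seg l * cap k (rho D.sg (l + 1)) := by
        have : ∀ e ∈ Finset.Ico l (l + seg l), (if D.ps e then cap k (rho D.sg (e + 1)) else 0) =
            cap k (rho D.sg (l + 1)) := by
          intro e he
          rw [Finset.mem_Ico] at he
          have hpe : D.ps e := by
            by_cases hel : e = l
            · rwa [hel]
            · exact (hch e (by omega) he.2).1
          rw [if_pos hpe]
          congr 1
          unfold rho
          symm
          refine Finset.sum_subset (Finset.range_mono (by omega)) fun x hx hx' => ?_
          simp only [Finset.mem_range] at hx hx'
          exact (hch x (by omega) (by omega)).2
        rw [Finset.sum_congr rfl this]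
        simp
      rw [h1, h2]
      exact hD.term_le hk hl hp
    · rw [Finset.sum_eq_sum_Ico_succ_bot hl, Finset.sum_eq_sum_Ico_succ_bot hl, if_neg hp]
      have h1 : term k D l = 0 := by
        unfold term
        rw [hD.val_zero l hl hp, hD.rm_zero l hl hp]
        simp
      rw [h1]
      exact add_le_add le_rfl (ih _ (by omega) _ rfl)

/-- The potential may only grow where further levels become saturated. -/
lemma Covers.mono (hk : 1 ≤ k) {D D' : PathState} {seg n seg' n' : ℕ → ℕ} {R : ℕ}
    (hD : Bounded k L D seg n) (hD' : Bounded k L D' seg' n') (hC : Covers k L D R)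
    (hps : ∀ e, D.ps e → D'.ps e) (hsg : ∀ e < L, D.ps e → D'.sg e = D.sg e)
    (hval : ∀ h < L, D.val h = D'.val h) (hrm : ∀ h < L, D.rm h = D'.rm h) : Covers k L D' R := by
  have hdown : ∀ e l, l ≤ e → D.ps e → D.ps l := by
    intro e
    induction e with
    | zero => intro l hl h; rwa [Nat.le_zero.1 hl]
    | succ e ih =>
      intro l hl h
      rcases Nat.lt_or_ge e l with h1 | h1
      · rwa [show l = e + 1 by omega]
      · exact ih l h1 (hD.down e h)
  unfold Covers at *
  refine hC.trans (add_le_add (Finset.sum_le_sum fun h hh => ?_) (Finset.sum_le_sum fun e he => ?_))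
  · rw [Finset.mem_range] at hh
    by_cases hp : D.ps h
    · have h1 : ∀ l < h + 1, D.sg l = D'.sg l := fun l hl =>
        (hsg l (by omega) (hdown h l (by omega) hp)).symm
      unfold term
      rw [hval h hh, hrm h hh, wt_congr h1, wt_congr (h := h) fun l hl => h1 l (by omega),
        h1 h (by omega)]
    -- An unsaturated level holds no tokens, so whatever weight it obtains later does no harm.
    · have h1 : term k D h = 0 := by
        unfold term
        rw [hD.val_zero h hh hp, hD.rm_zero h hh hp]
        simp
      rw [h1]
      exact term_nonneg hk _ _
  · rw [Finset.mem_range] at he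
    unfold loss
    by_cases hp : D.ps e
    · have h1 : ∀ l < e + 1, D.sg l = D'.sg l := fun l hl =>
        (hsg l (by omega) (hdown e l (by omega) hp)).symm
      rw [if_pos hp, if_pos (hps e hp), rho_congr h1]
    · rw [if_neg hp]
      split
      · exact sub_nonneg.2 (capSum_mono hk (hD'.rho_le he ‹_›) le_rfl)
      · exact le_rfl

/-- When an open port beside the path is closed, the potential of the levels below is replaced by
losses. -/
lemma Covers.close (hk : 1 ≤ k) {D D' : PathState} {seg n : ℕ → ℕ} {R l : ℕ}
    (hD : Bounded k L D seg n) (hC : Covers k L D R) (hl : l < L)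
    (hps : ∀ e, D.ps e ↔ D'.ps e) (hsg : ∀ e, e ≠ l → D'.sg e = D.sg e)
    (hsl : D'.sg l + 1 = D.sg l)
    (hval : ∀ h < L, D.val h = D'.val h) (hrm : ∀ h < L, D.rm h = D'.rm h) : Covers k L D' R := by
  unfold Covers at *
  refine hC.trans ?_
  have h0 := hD.sum_le hk l
  have hrho : ∀ e, l ≤ e → rho D'.sg (e + 1) + 1 = rho D.sg (e + 1) := by
    intro e he
    have := sum_change (s := Finset.range (e + 1)) (g := D.sg) (g' := D'.sg) (i := l)
      (by simp; omega) hsg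
    unfold rho
    omega
  rw [Finset.range_eq_Ico, ← Finset.sum_Ico_consecutive _ (Nat.zero_le l) hl.le,
    ← Finset.sum_Ico_consecutive (fun h => term k D' h) (Nat.zero_le l) hl.le,
    ← Finset.sum_Ico_consecutive (fun h => loss k D h) (Nat.zero_le l) hl.le,
    ← Finset.sum_Ico_consecutive (fun h => loss k D' h) (Nat.zero_le l) hl.le]
  have h1 : ∑ h ∈ Finset.Ico 0 l, term k D h = ∑ h ∈ Finset.Ico 0 l, term k D' h := by
    refine Finset.sum_congr rfl fun h hh => ?_
    rw [Finset.mem_Ico] at hh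
    have h1 : ∀ x < h + 1, D.sg x = D'.sg x := fun x hx => (hsg x (by omega)).symm
    unfold term
    rw [hval h (by omega), hrm h (by omega), wt_congr h1, wt_congr (h := h) fun l hl => h1 l (by omega),
      h1 h (by omega)]
  have h2 : ∑ e ∈ Finset.Ico 0 l, loss k D e = ∑ e ∈ Finset.Ico 0 l, loss k D' e := by
    refine Finset.sum_congr rfl fun h hh => ?_
    rw [Finset.mem_Ico] at hh
    have h1 : ∀ x < h + 1, D.sg x = D'.sg x := fun x hx => (hsg x (by omega)).symm
    unfold loss
    simp only [hps, rho_congr h1]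
  have h3 : 0 ≤ ∑ h ∈ Finset.Ico l L, term k D' h := Finset.sum_nonneg fun h _ => term_nonneg hk _ _
  -- From `l` on, `rho` drops by one, so at each saturated level the loss grows by the cap of the
  -- old `rho`. By `h0` this pays for all terms discarded.
  have h4 : ∑ e ∈ Finset.Ico l L, loss k D' e = ∑ e ∈ Finset.Ico l L, loss k D e +
      ∑ e ∈ Finset.Ico l L, if D.ps e then cap k (rho D.sg (e + 1)) else 0 := by
    rw [← Finset.sum_add_distrib]
    refine Finset.sum_congr rfl fun e he => ?_
    rw [Finset.mem_Ico] at he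
    have h5 := hrho e he.1
    unfold loss
    simp only [← hps]
    split
    · rw [← h5]
      have h6 : capSum k (rho D'.sg (e + 1) + 1) = capSum k (rho D'.sg (e + 1)) +
          cap k (rho D'.sg (e + 1) + 1) := Finset.sum_range_succ _ _
      rw [h6]; ring
    · simp
  linarith

lemma term_of_sg {D D' : PathState} (hsg : ∀ e, D'.sg e = D.sg e) {h : ℕ} (hv : D'.val h = D.val h)
    (hr : D'.rm h = D.rm h) : term k D' h = term k D h := by
  have : D'.sg = D.sg := funext hsg
  unfold term; rw [hv, hr, this]

lemma loss_of_sg {D D' : PathState} (hps : ∀ e, D.ps e ↔ D'.ps e) (hsg : ∀ e, D'.sg e = D.sg e)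
    (h : ℕ) : loss k D' h = loss k D h := by
  have : D'.sg = D.sg := funext hsg
  unfold loss; simp only [hps, this]

/-- Tokens issued at the root. -/
lemma Covers.issue (hk : 1 ≤ k) {D D' : PathState} {R n : ℕ} (hC : Covers k L D R) (hL : 0 < L)
    (hps : ∀ e, D.ps e ↔ D'.ps e) (hsg : ∀ e, D'.sg e = D.sg e)
    (hval : ∀ h < L, h ≠ 0 → D'.val h = D.val h) (hval0 : D'.val 0 = D.val 0 + k * n)
    (hrm : ∀ h, D'.rm h = D.rm h) : Covers k L D' (R + n * (D.sg 0 + 1)) := by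
  unfold Covers at *
  simp only [loss_of_sg hps hsg]
  rw [← Finset.add_sum_erase _ _ (Finset.mem_range.2 hL)] at hC ⊢
  rw [Finset.sum_congr rfl fun h hh => term_of_sg (k := k) hsg (hval h
    (Finset.mem_range.1 (Finset.mem_of_mem_erase hh)) (Finset.ne_of_mem_erase hh)) (hrm h)]
  have h1 : term k D' 0 = term k D 0 + (1 + lam k * D.sg 0) * (k * n) := by
    have : D'.sg = D.sg := funext hsg
    unfold term
    simp only [true_or, if_true, hval0, hrm, this]
    simp [wt]
    ring
  rw [h1]
  have h2 := k_mul_lam hk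
  -- This exceeds the required `k * n * (D.sg 0 + 1)` by `2 * D.sg 0 * n`.
  have h3 : (1 + lam k * D.sg 0) * (k * n) = k * n + (k + 2) * D.sg 0 * n := by rw [← h2]; ring
  rw [h3]
  have : (0 : ℝ) ≤ 2 * D.sg 0 * n := by positivity
  push_cast
  nlinarith

/-- Tokens paid at a fork. -/
lemma Covers.pay (hk : 1 ≤ k) {D D' : PathState} {R n x h i : ℕ} (hC : Covers k L D R) (hL : i < L)
    (hhi : h < i) (hps : ∀ e, D.ps e ↔ D'.ps e) (hsg : ∀ e, D'.sg e = D.sg e)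
    (hsi : 1 ≤ D.sg i) (hbetween : ∀ l, h < l → l < i → D.sg l = 0)
    (hval : ∀ l < L, l ≠ h → l ≠ i → D'.val l = D.val l) (hvali : D'.val i = D.val i + k * n)
    (hvalh : D.val h ≤ D'.val h + (k + 1) * x)
    (hrm : ∀ l < L, l ≠ i → D'.rm l = D.rm l) (hrmi : x + D.rm i = n * (D.sg i + 1) + D'.rm i) :
    Covers k L D' R := by
  unfold Covers at *
  simp only [loss_of_sg hps hsg]
  have hi : i ∈ Finset.range L := Finset.mem_range.2 hL
  have hh : h ∈ (Finset.range L).erase i := by simp; omega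
  rw [← Finset.add_sum_erase _ _ hi, ← Finset.add_sum_erase _ _ hh] at hC ⊢
  rw [Finset.sum_congr rfl fun l hl => term_of_sg (k := k) hsg (hval l
    (Finset.mem_range.1 (Finset.mem_of_mem_erase (Finset.mem_of_mem_erase hl)))
    (Finset.ne_of_mem_erase hl)
    (Finset.ne_of_mem_erase (Finset.mem_of_mem_erase hl))) (hrm l
    (Finset.mem_range.1 (Finset.mem_of_mem_erase (Finset.mem_of_mem_erase hl)))
    (Finset.ne_of_mem_erase (Finset.mem_of_mem_erase hl)))]
  have hs : D'.sg = D.sg := funext hsg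
  -- The vertices between the fork of departure and the paying fork are not forks, so tokens in the
  -- purse already have the weight of the leftovers at `i`.
  have hw : wt k D.sg i = wt k D.sg (h + 1) := by
    unfold wt
    symm
    refine Finset.prod_subset (Finset.range_mono (by omega)) fun l hl hl' => ?_
    simp only [Finset.mem_range] at hl hl'
    rw [hbetween l (by omega) hl]; simp
  have hW := wt_pos hk D.sg i
  have h2 := k_mul_lam hk
  have hrmi' : (x : ℝ) + D.rm i = n * (D.sg i + 1) + D'.rm i := by exact_mod_cast hrmi
  have hvalh' : (D.val h : ℝ) ≤ D'.val h + (k + 1) * x := by exact_mod_cast hvalh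
  have hsi' : (1 : ℝ) ≤ D.sg i := by exact_mod_cast hsi
  have h1 : term k D' i = term k D i + wt k D.sg i * ((1 + lam k * D.sg i) * (k * n) +
      (k + 1) * (x - n * (D.sg i + 1))) := by
    unfold term
    rw [hs, if_pos (.inr hsi), if_pos (.inr hsi), hvali, wt_succ,
      show (D'.rm i : ℝ) = x + D.rm i - n * (D.sg i + 1) by linarith]
    push_cast
    ring
  have h3 : term k D h ≤ term k D' h + wt k D.sg i * ((k + 1) * x) := by
    unfold term
    rw [hs]
    split
    · rw [hrm h (by omega) (by omega), hw]
      have := mul_le_mul_of_nonneg_left hvalh' (wt_pos hk D.sg (h + 1)).le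
      linarith
    · positivity
  have h4 : (1 + lam k * D.sg i) * (k * n) = k * n + (k + 2) * D.sg i * n := by rw [← h2]; ring
  have h5 : 0 ≤ wt k D.sg i * (n * (D.sg i - 1)) :=
    mul_nonneg hW.le (mul_nonneg (by positivity) (by linarith))
  -- The surplus is `n * (D.sg i - 1)`, nonnegative because `i` is a fork.
  have h6 : wt k D.sg i * ((1 + lam k * D.sg i) * (k * n) + (k + 1) * (x - n * (D.sg i + 1))) =
      wt k D.sg i * (n * (D.sg i - 1)) + wt k D.sg i * ((k + 1) * x) := by
    rw [h4]; ring
  linarith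

/-- Here `1 + lam k = 2 * (1 + 1 / k)`, and `(1 + 1 / k) ^ k` is at most `e < 3`. -/
lemma pow_two_le (hk : 1 ≤ k) : (1 + lam k) ^ k ≤ 3 * 2 ^ k := by
  have hk' : (1 : ℝ) ≤ k := by exact_mod_cast hk
  have h1 : 1 + lam k = 2 * (1 + 1 / k) := by unfold lam; field_simp; ring
  rw [h1, mul_pow]
  have h2 : (1 + 1 / (k : ℝ)) ^ k ≤ Real.exp 1 := by
    have h3 : 1 + 1 / (k : ℝ) ≤ Real.exp (1 / k) := by
      have := Real.add_one_le_exp (1 / (k : ℝ)); linarith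
    calc (1 + 1 / (k : ℝ)) ^ k ≤ Real.exp (1 / k) ^ k := pow_le_pow_left₀ (by positivity) h3 k
      _ = Real.exp 1 := by
        rw [← Real.exp_nat_mul]; congr 1; field_simp
  have h4 := Real.exp_one_lt_d9
  have h5 : (0 : ℝ) < 2 ^ k := by positivity
  nlinarith

lemma capSum_le (hk : 1 ≤ k) : capSum k k ≤ 96 * k ^ 2 * 2 ^ k := by
  have hk' : (1 : ℝ) ≤ k := by exact_mod_cast hk
  have hl := lam_pos hk
  have hl1 : 1 ≤ lam k := by
    unfold lam; rw [le_div_iff₀ (by linarith)]; linarith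
  -- A geometric sum of ratio at least 2: a new factor `1 + lam k` halves the old bracket to `(k -
  -- m) + 4`, and adding the `(k - m) + 2` of the new cap gives the next bracket. At `m = k` the
  -- bracket is 8, and 96 is `4 * 8 * 3`.
  have key : ∀ m ≤ k, capSum k m ≤ (k + 1) ^ 2 * (2 * (k - m) + 8) * (1 + lam k) ^ m := by
    intro m
    induction m with
    | zero =>
      intro _
      simp [capSum, cap]
      have : (0 : ℝ) ≤ (k + 1) ^ 2 := by positivity
      nlinarith
    | succ m ih =>
      intro hm
      have h1 := ih (by omega)
      have h2 : capSum k (m + 1) = capSum k m + cap k (m + 1) := Finset.sum_range_succ _ _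
      have hm' : (m : ℝ) + 1 ≤ k := by exact_mod_cast hm
      rw [h2]
      unfold cap
      have hP : (0 : ℝ) < (1 + lam k) ^ m := by positivity
      have h3 : (k + 1 : ℝ) ^ 2 * (2 * (k - m) + 8) * (1 + lam k) ^ m ≤
          (k + 1) ^ 2 * ((k - m) + 4) * (1 + lam k) ^ (m + 1) := by
        rw [pow_succ (1 + lam k) m]
        have h4 : 0 ≤ (k + 1 : ℝ) ^ 2 * ((k - m) + 4) * (1 + lam k) ^ m := by
          have : (0 : ℝ) ≤ k - m + 4 := by linarith
          positivity
        nlinarith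
      refine (add_le_add (h1.trans h3) le_rfl).trans ?_
      push_cast
      rw [← add_mul]
      refine mul_le_mul_of_nonneg_right ?_ (by positivity)
      have : (0 : ℝ) ≤ (k + 1) ^ 2 := by positivity
      nlinarith
  have h1 := key k le_rfl
  rw [sub_self, mul_zero, zero_add] at h1
  have h2 := pow_two_le hk
  have h3 : ((k : ℝ) + 1) ^ 2 * 8 ≤ 4 * k ^ 2 * 8 := by nlinarith
  calc capSum k k ≤ ((k : ℝ) + 1) ^ 2 * 8 * (1 + lam k) ^ k := h1
    _ ≤ 4 * k ^ 2 * 8 * (3 * 2 ^ k) := by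
      refine mul_le_mul h3 h2 (by positivity) (by positivity)
    _ = 96 * k ^ 2 * 2 ^ k := by ring

/-- A bound for the number of tokens issued. -/
lemma Covers.le (hk : 1 ≤ k) {D : PathState} {seg n : ℕ → ℕ} {R : ℕ} (hD : Bounded k L D seg n)
    (hC : Covers k L D R) : R ≤ 96 * (k * 2 ^ k * L) := by
  have hk' : (1 : ℝ) ≤ k := by exact_mod_cast hk
  have h0 := hD.sum_le hk 0
  rw [← Finset.range_eq_Ico] at h0
  have h1 : (k : ℝ) * R ≤ ∑ e ∈ Finset.range L, capSum k k := by
    unfold Covers at hC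
    refine hC.trans ((add_le_add h0 le_rfl).trans ?_)
    rw [← Finset.sum_add_distrib]
    refine Finset.sum_le_sum fun e he => ?_
    rw [Finset.mem_range] at he
    unfold loss
    split
    · have h2 : cap k (rho D.sg (e + 1)) ≤ capSum k (rho D.sg (e + 1)) := by
        have hr := hD.rho_le he ‹_›
        refine Finset.single_le_sum (f := cap k) (fun x hx => cap_nonneg hk ?_) (by simp)
        simp at hx; omega
      linarith
    · rw [add_zero]
      exact Finset.sum_nonneg fun x hx => cap_nonneg hk (by simp at hx; omega)
  rw [Finset.sum_const, Finset.card_range, nsmul_eq_mul] at h1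
  have h2 : (L : ℝ) * capSum k k ≤ L * (96 * k ^ 2 * 2 ^ k) :=
    mul_le_mul_of_nonneg_left (capSum_le hk) (by positivity)
  have h3 : (k : ℝ) * R ≤ k * (96 * (k * 2 ^ k * L)) := by
    refine h1.trans (h2.trans (le_of_eq ?_)); ring
  have h4 := le_of_mul_le_mul_left h3 (by linarith)
  exact_mod_cast h4

end PathState

end TokenSearch

/-! ### The path to `u` in a configuration. -/

namespace TokenSearch

open Classical PortStatus

variable {k : ℕ} {V : Type} (T : PortTree V) (u : V)

/-- The port that leads towards `u` from its ancestor at depth `h`. -/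
noncomputable def pathPort (h : ℕ) : ℕ := T.portTo (T.anc u h) (T.anc u (h + 1))

/-- The ancestors of `u` down to depth `h` are saturated. -/
def PathSat (bd : V → Board) (h : ℕ) : Prop := ∀ j ≤ h, Saturated T bd (T.anc u j)

/-- The number of open ports beside the path to `u` at depth `h`. -/
noncomputable def side (bd : V → Board) (h : ℕ) : ℕ :=
  if PathSat T u bd h then nopen (T.degree (T.anc u h)) (bd (T.anc u h)) - 1 else 0

/-- An agent at `x` holds the purse `pu` that it took at depth `h` for the path to `u`. -/
def Held (x : V) (m : Mem) (h : ℕ) (pu : Purse) : Prop :=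
  h ≤ m.kd ∧ T.anc x h = T.anc u h ∧ m.fr (h + 1) = some pu ∧ pu.port = pathPort T u h

/-- The tokens in the purse that is held. -/
noncomputable def heldB (P : Purse → Prop) : ℕ := if h : ∃ pu, P pu then h.choose.B else 0

/-- The purse `pu` fits the segment below depth `h`, where `q` tokens were already paid. -/
def Fits (k : ℕ) (bd : V → Board) (q h : ℕ) (pu : Purse) : Prop :=
  pu.sd ≤ (bd (T.anc u h)).seg (pathPort T u h) ∧ pu.B + q ≤ (k + 1) * pu.sd ∧
  -- The payments `q` include those of earlier trips, which are covered by the segment already known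
  -- at departure; the present trip pays only for edges beyond `sd`.
  q ≤ max pu.sd (pu.far - h) ∧ h + 1 ≤ pu.far ∧ pu.far ≤ T.dep u ∧
  ∀ x, h < x → x < pu.far → PathSat T u bd x ∧ side T u bd x = 0

/-- Invariants of the path to `u`; the agent `a` has paid `np h a` tokens for the segment below
depth `h`. -/
structure PathInv (c : TokenConfig k V) (np : ℕ → Fin k → ℕ) : Prop where
  seg_le : ∀ h < T.dep u, h + (c.board (T.anc u h)).seg (pathPort T u h) ≤ T.dep u
  chain : ∀ h < T.dep u, ∀ x, h < x → x < h + (c.board (T.anc u h)).seg (pathPort T u h) →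
    PathSat T u c.board x ∧ side T u c.board x = 0
  zero : ∀ h < T.dep u, ¬ PathSat T u c.board h → (c.board (T.anc u h)).sav (pathPort T u h) = 0 ∧
    (c.board (T.anc u h)).rem = 0 ∧ ∀ a, np h a = 0
  fits : ∀ a, ∀ h < T.dep u, ∀ pu, Held T u (c.pos a) (c.mem a) h pu →
    Fits T u k c.board (np h a) h pu
  not_held : ∀ a, ∀ h < T.dep u, (∀ pu, ¬ Held T u (c.pos a) (c.mem a) h pu) →
    np h a ≤ (c.board (T.anc u h)).seg (pathPort T u h)

/-- The state of the path to `u`. -/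
noncomputable def pathState (c : TokenConfig k V) (np : ℕ → Fin k → ℕ) : PathState where
  ps := PathSat T u c.board
  sg := side T u c.board
  val h := k * (c.board (T.anc u h)).sav (pathPort T u h) +
    (k + 1) * ∑ a, (heldB (Held T u (c.pos a) (c.mem a) h) + np h a)
  rm h := (c.board (T.anc u h)).rem

variable {T u}

lemma heldB_eq {x : V} {m : Mem} {h : ℕ} {pu : Purse} (hp : Held T u x m h pu) :
    heldB (Held T u x m h) = pu.B := by
  have hex : ∃ pu, Held T u x m h pu := ⟨pu, hp⟩
  have h1 := hex.choose_spec
  rw [heldB, dif_pos hex]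
  have h2 := h1.2.2.1
  rw [hp.2.2.1] at h2
  simp only [Option.some.injEq] at h2
  rw [← h2]

lemma heldB_zero {x : V} {m : Mem} {h : ℕ} (hp : ∀ pu, ¬ Held T u x m h pu) :
    heldB (Held T u x m h) = 0 := by
  rw [heldB, dif_neg (by push Not; exact hp)]

lemma child_path {h : ℕ} (hL : h < T.dep u) :
    T.Child (T.anc u h) (pathPort T u h) (T.anc u (h + 1)) := T.child_anc hL

lemma anc_inj {h l : ℕ} (hh : h ≤ T.dep u) (hl : l ≤ T.dep u) (he : T.anc u h = T.anc u l) :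
    h = l := by
  rw [← T.dep_anc hh, he, T.dep_anc hl]

lemma PathSat.lt {c : TokenConfig k V} (hI : Inv T u c) {h : ℕ} (hs : PathSat T u c.board h) :
    h < T.dep u := by
  by_contra hlt
  have := hs h le_rfl
  rw [T.anc_of_le (by omega)] at this
  exact hI.board.unseen this.1

lemma PathSat.port_open {c : TokenConfig k V} (hI : Inv T u c) {h : ℕ}
    (hs : Saturated T c.board (T.anc u h)) (hL : h < T.dep u) :
    (c.board (T.anc u h)).st (pathPort T u h) = opn := by
  obtain ⟨p, w, hc, hw, ho⟩ := hI.board.exists_open hs (T.above_anc u h)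
  have hc' := child_path hL
  have := hw.child hc hc' (T.above_anc u (h + 1))
  rwa [← this]

lemma PathSat.nopen_pos {c : TokenConfig k V} (hI : Inv T u c) {h : ℕ}
    (hs : PathSat T u c.board h) :
    1 ≤ nopen (T.degree (T.anc u h)) (c.board (T.anc u h)) := by
  have hL := hs.lt hI
  have := PathSat.port_open hI (hs h le_rfl) hL
  rw [Nat.one_le_iff_ne_zero, Ne, nopen_eq_zero]
  intro h
  exact h _ (child_path hL).1 this

lemma PathSat.side_add_one {c : TokenConfig k V} (hI : Inv T u c) {h : ℕ}
    (hs : PathSat T u c.board h) :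
    side T u c.board h + 1 = nopen (T.degree (T.anc u h)) (c.board (T.anc u h)) := by
  have := hs.nopen_pos hI
  rw [side, if_pos hs]
  omega

lemma Held.anc {x : V} {m : Mem} {h : ℕ} {pu : Purse} (hp : Held T u x m h pu) {j : ℕ} (hj : j ≤ h) :
    T.anc x j = T.anc u j := by
  rw [← T.anc_anc hj, hp.2.1, T.anc_anc hj]

lemma Held.pathSat {c : TokenConfig k V} (hI : Inv T u c) {a : Fin k} {h : ℕ} {pu : Purse}
    (hp : Held T u (c.pos a) (c.mem a) h pu) : PathSat T u c.board h := by
  intro j hj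
  rw [← hp.anc hj]
  have hA := hI.agent a
  have h1 := hp.1
  rcases Nat.lt_or_ge j (c.mem a).kd with hlt | hge
  · exact hA.sat_above j hlt
  · obtain rfl : h = (c.mem a).kd := by omega
    obtain ⟨hd, -, -, hs⟩ := hA.fr_next pu hp.2.2.1
    rw [T.anc_of_le (by have := hA.depth; omega)]
    exact hs

lemma Held.next {c : TokenConfig k V} (hI : Inv T u c) {a : Fin k} {h : ℕ} {pu : Purse}
    (hp : Held T u (c.pos a) (c.mem a) h pu) (hk : h < (c.mem a).kd) :
    T.anc (c.pos a) (h + 1) = T.anc u (h + 1) := by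
  have h1 := (hI.agent a).fr_port h pu hk hp.2.2.1
  have h2 := child_path ((hp.pathSat hI).lt hI)
  rw [hp.2.1, hp.2.2.2] at h1
  rw [← h1.2.1, h2.2.1]

lemma side_of_unary {bd : V → Board} {h : ℕ} (hu : Unary T bd (T.anc u h)) : side T u bd h = 0 := by
  unfold side
  split
  · have : nopen (T.degree (T.anc u h)) (bd (T.anc u h)) ≤ 1 := by
      refine Finset.card_le_one.2 fun p hp q hq => ?_
      simp only [Finset.mem_filter, Finset.mem_range] at hp hq
      exact hu p hp.1 q hq.1 hp.2 hq.2
    omega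
  · rfl

/-- An agent whose last purse is held for the path to `u` is on this path. -/
lemma Held.active {c : TokenConfig k V} (hI : Inv T u c) {a : Fin k} {h : ℕ} {pu : Purse}
    (hp : Held T u (c.pos a) (c.mem a) h pu) (hj : Active (c.mem a) (h + 1)) {l : ℕ} (hl : h < l)
    (hlk : l ≤ (c.mem a).kd) :
    T.anc (c.pos a) l = T.anc u l ∧ (l < (c.mem a).kd → side T u c.board l = 0) := by
  induction l, hl using Nat.le_induction with
  | base =>
    have h1 := hp.next hI hj.1
    refine ⟨h1, fun hlt => ?_⟩
    have h2 := ((hI.agent a).through (h + 1) hlt (hj.2 _ (by omega) hlt) h1).2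
    rw [h1] at h2
    exact side_of_unary h2
  | succ l hl ih =>
    have h0 := (ih (by omega)).1
    have h1 := ((hI.agent a).through l hlk (hj.2 _ (by omega) hlk) h0).1
    refine ⟨h1, fun hlt => ?_⟩
    have h2 := ((hI.agent a).through (l + 1) hlt (hj.2 _ (by omega) hlt) h1).2
    rw [h1] at h2
    exact side_of_unary h2

/-- The open ports beside the path have distinct guards, and no guard holds a purse for level `h`: a
holder is below the path port at `h` or has just come back through it. -/
lemma PathInv.agents_le {c : TokenConfig k V} (hI : Inv T u c) {h : ℕ}
    (hs : PathSat T u c.board h) :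
    (Finset.univ.filter fun a => ∃ pu, Held T u (c.pos a) (c.mem a) h pu).card +
      PathState.rho (side T u c.board) (h + 1) ≤ k := by
  have hL := hs.lt hI
  have hsl : ∀ l ≤ h, PathSat T u c.board l := fun l hl j hj => hs j (hj.trans hl)
  set S : Finset ((_ : ℕ) × ℕ) := (Finset.range (h + 1)).sigma fun l =>
    ((Finset.range (T.degree (T.anc u l))).filter fun p => (c.board (T.anc u l)).st p = opn).erase
      (pathPort T u l) with hS
  have hmem : ∀ s ∈ S, s.1 ≤ h ∧ s.2 ≠ pathPort T u s.1 ∧ s.2 < T.degree (T.anc u s.1) ∧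
      (c.board (T.anc u s.1)).st s.2 = opn := by
    intro s hs
    simpa [hS, Nat.lt_succ_iff] using hs
  have hchild : ∀ s ∈ S, T.Child (T.anc u s.1) s.2 (T.nb (T.anc u s.1) s.2) := by
    intro s hs
    obtain ⟨h1, h2, h3, h4⟩ := hmem s hs
    exact hI.board.child (hsl _ h1 _ le_rfl).1 h3 (by rw [h4]; simp)
  have hcard : S.card = PathState.rho (side T u c.board) (h + 1) := by
    rw [hS, Finset.card_sigma]
    refine Finset.sum_congr rfl fun l hl => ?_
    rw [Finset.mem_range] at hl
    have h1 := hsl l (by omega)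
    rw [Finset.card_erase_of_mem, side, if_pos h1]
    · rfl
    · simp only [Finset.mem_filter, Finset.mem_range]
      exact ⟨(child_path (h1.lt hI)).1, PathSat.port_open hI (h1 l le_rfl) (h1.lt hI)⟩
  rw [← hcard, add_comm]
  have hdep : ∀ l ≤ h, T.dep (T.anc u l) = l := fun l hl => T.dep_anc (by omega)
  -- an agent below the path at depth `l + 1` guards nothing at depth `l`
  have hno : ∀ s ∈ S, ∀ x, T.anc x (s.1 + 1) = T.anc u (s.1 + 1) →
      ¬ T.Above (T.nb (T.anc u s.1) s.2) x := by
    intro s hs x hx hab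
    obtain ⟨h1, h2, h3, h4⟩ := hmem s hs
    have h5 := child_path (T := T) (u := u) (h := s.1) (by omega)
    refine h2 (hab.child (hchild s hs) h5 ?_)
    unfold PortTree.Above
    rw [h5.2.2, hdep _ h1]
    exact hx
  refine card_add_card_le S _ (fun s a => T.Above (T.nb (T.anc u s.1) s.2) (c.pos a) ∨
    c.pos a = T.anc u s.1 ∧ (c.mem a).cf ∧ c.entry a = some s.2) (fun s hs => ?_) ?_
  · obtain ⟨h1, h2, h3, h4⟩ := hmem s hs
    obtain ⟨a, ha⟩ := hI.guarded _ _ _ (hchild s hs) h4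
    refine ⟨a, ?_, ha⟩
    simp only [Finset.mem_filter, Finset.mem_univ, true_and]
    rintro ⟨pu, hp⟩
    have hkd := hp.1
    have hd := (hI.agent a).depth
    rcases ha with ha | ⟨ha, -, he⟩
    · rcases Nat.lt_or_ge s.1 h with hlt | hge
      · exact hno s hs _ (hp.anc hlt) ha
      · have hsh : s.1 = h := by omega
        have := ha.dep_le
        have h6 := (hchild s hs).2.2
        rw [hdep _ h1] at h6
        rcases Nat.lt_or_ge h (c.mem a).kd with hlt | hge'
        · refine hno s hs _ ?_ ha
          rw [hsh]
          exact hp.next hI hlt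
        · obtain rfl : h = (c.mem a).kd := by omega
          have := ((hI.agent a).fr_next pu hp.2.2.1).1
          omega
    · have h6 := hdep _ h1
      rw [← ha] at h6
      have h7 : h = (c.mem a).kd := by omega
      have h8 := hp.2.2.1
      rw [h7] at h8
      have h9 := ((hI.agent a).fr_next pu h8).2.2.1
      rw [he] at h9
      simp only [Option.some.injEq] at h9
      have h10 : s.1 = h := by omega
      exact h2 (by rw [h9, hp.2.2.2, h10])
  -- Whatever lies below a deeper vertex of the path cannot lie behind a port beside the path
  -- further up.
  · have key : ∀ s ∈ S, ∀ s' ∈ S, ∀ x, s.1 < s'.1 → T.Above (T.nb (T.anc u s.1) s.2) x →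
        T.anc x s'.1 = T.anc u s'.1 → False := by
      intro s hs s' hs' x hlt hab hx
      refine hno s hs x ?_ hab
      rw [← T.anc_anc (i := s.1 + 1) (j := s'.1) hlt, hx, T.anc_anc hlt]
    have key2 : ∀ s ∈ S, ∀ a, (T.Above (T.nb (T.anc u s.1) s.2) (c.pos a) ∨
        c.pos a = T.anc u s.1 ∧ (c.mem a).cf ∧ c.entry a = some s.2) →
        T.anc (c.pos a) s.1 = T.anc u s.1 ∧ s.1 ≤ T.dep (c.pos a) := by
      intro s hs a h
      have h1 := hdep _ (hmem s hs).1
      rcases h with h | ⟨h, -⟩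
      · have := (hchild s hs).above.trans h
        exact ⟨this.eq_anc h1, by rw [← h1]; exact this.dep_le⟩
      · rw [h, h1]
        exact ⟨by rw [T.anc_of_le (by omega)], le_rfl⟩
    have key3 : ∀ s ∈ S, ∀ s' ∈ S, ∀ a, (T.Above (T.nb (T.anc u s.1) s.2) (c.pos a) ∨
        c.pos a = T.anc u s.1 ∧ (c.mem a).cf ∧ c.entry a = some s.2) →
        (T.Above (T.nb (T.anc u s'.1) s'.2) (c.pos a) ∨
        c.pos a = T.anc u s'.1 ∧ (c.mem a).cf ∧ c.entry a = some s'.2) → ¬ s.1 < s'.1 := by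
      intro s hs s' hs' a h1 h2 hlt
      have h3 := key2 s' hs' a h2
      rcases h1 with h1 | ⟨h1, -⟩
      · exact key s hs s' hs' _ hlt h1 h3.1
      · have := h3.2
        rw [h1, hdep _ (hmem s hs).1] at this
        omega
    intro s hs s' hs' a h1 h2
    have h3 := key3 s hs s' hs' a h1 h2
    have h4 := key3 s' hs' s hs a h2 h1
    obtain ⟨l, p⟩ := s
    obtain ⟨l', p'⟩ := s'
    obtain rfl : l = l' := by simp only at h3 h4; omega
    have hc := hchild _ hs
    have hc' := hchild _ hs'
    simp only at hc hc' h1 h2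
    congr 1
    rcases h1 with h1 | ⟨h1, -, h1'⟩ <;> rcases h2 with h2 | ⟨h2, -, h2'⟩
    · exact h1.child hc hc' h2
    · have := h1.dep_le; have := hc.2.2; rw [h2] at *; omega
    · have := h2.dep_le; have := hc'.2.2; rw [h1] at *; omega
    · rw [h1'] at h2'; simpa using h2'

lemma PathInv.bounded {c : TokenConfig k V} (hI : Inv T u c) {np : ℕ → Fin k → ℕ}
    (hP : PathInv T u c np) : PathState.Bounded k (T.dep u) (pathState T u c np)
      (fun h => (c.board (T.anc u h)).seg (pathPort T u h))
      (fun h => (Finset.univ.filter fun a => ∃ pu, Held T u (c.pos a) (c.mem a) h pu).card) where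
  down e he j hj := he j (by omega)
  sg_zero e he := if_neg he
  seg_pos h := hI.board.seg_pos _ _
  seg_le h hL _ := hP.seg_le h hL
  chain h hL _ := hP.chain h hL
  val_le h hL hs := by
    have h1 := hI.board.sav_le (T.anc u h) (pathPort T u h) (child_path hL).1
    set s := (c.board (T.anc u h)).seg (pathPort T u h) with hs'
    set N := (Finset.univ.filter fun a => ∃ pu, Held T u (c.pos a) (c.mem a) h pu).card with hN
    -- An agent without the purse accounts for at most one segment length, a holder for at most `k +
    -- 1`.
    have h2 : ∑ a, (heldB (Held T u (c.pos a) (c.mem a) h) + np h a) ≤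
        ∑ a : Fin k, (s + if ∃ pu, Held T u (c.pos a) (c.mem a) h pu then (k + 1) * s else 0) := by
      refine Finset.sum_le_sum fun a _ => ?_
      split
      · obtain ⟨pu, hp⟩ := ‹∃ pu, _›
        rw [heldB_eq hp]
        obtain ⟨h3, h4, -⟩ := hP.fits a h hL pu hp
        have := Nat.mul_le_mul_left (k + 1) h3
        rw [← hs'] at this
        omega
      · rename_i hn
        push Not at hn
        rw [heldB_zero hn]
        have := hP.not_held a h hL hn
        omega
    rw [Finset.sum_add_distrib (f := fun _ => s), Finset.sum_const, ← Finset.sum_filter, Finset.sum_const,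
      Finset.card_univ, Fintype.card_fin, smul_eq_mul, smul_eq_mul] at h2
    have h3 := Nat.mul_le_mul_left k h1
    have h4 := Nat.mul_le_mul_left (k + 1) h2
    simp only [pathState]
    nlinarith
  agents h hL hs := PathInv.agents_le hI hs
  val_zero h hL hs := by
    obtain ⟨h1, -, h2⟩ := hP.zero h hL hs
    have h3 : ∀ a, heldB (Held T u (c.pos a) (c.mem a) h) = 0 := fun a =>
      heldB_zero fun pu hp => hs (hp.pathSat hI)
    simp [pathState, h1, h2, h3]
  rm_zero h hL hs := (hP.zero h hL hs).2.1
  rm_le h _ := hI.board.rem_le _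

end TokenSearch

/-! ### Local changes and their effect on the path. -/

namespace TokenSearch

open Classical PortStatus

variable {k : ℕ} {V : Type} {T : PortTree V} {u : V}

/-- The configurations differ only by the agent `i` and the whiteboard of its vertex. -/
structure Local (c c' : TokenConfig k V) (i : Fin k) : Prop where
  pos : ∀ a, a ≠ i → c'.pos a = c.pos a
  mem : ∀ a, a ≠ i → c'.mem a = c.mem a
  board : ∀ v, v ≠ c.pos i → c'.board v = c.board v
  evolves : Evolves (c.board (c.pos i)) (c'.board (c.pos i))

lemma Local.all {c c' : TokenConfig k V} {i : Fin k} (h : Local c c' i) (v : V) :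
    Evolves (c.board v) (c'.board v) := by
  by_cases hv : v = c.pos i
  · rw [hv]; exact h.evolves
  · rw [h.board v hv]; exact Evolves.refl _

lemma local_upd [DecidableEq V] {c : TokenConfig k V} {i : Fin k} {m : Mem} {b : Board}
    (h : Evolves (c.board (c.pos i)) b) : Local c (c.upd i m b) i where
  pos a _ := rfl
  mem a ha := by simp [TokenConfig.upd, ha]
  board v hv := by simp [TokenConfig.upd, hv]
  evolves := by simpa [TokenConfig.upd] using h

lemma local_go [DecidableEq V] {c : TokenConfig k V} {i : Fin k} {m : Mem} {b : Board} {p : ℕ}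
    (h : Evolves (c.board (c.pos i)) b) : Local c (c.go T i m b p) i where
  pos a ha := by simp [TokenConfig.go, ha]
  mem a ha := by simp [TokenConfig.go, ha]
  board v hv := by simp [TokenConfig.go, hv]
  evolves := by simpa [TokenConfig.go] using h

lemma PathSat.mono {bd bd' : V → Board} (hev : ∀ v, Evolves (bd v) (bd' v)) {h : ℕ}
    (hs : PathSat T u bd h) : PathSat T u bd' h := fun j hj => saturated_mono hev (hs j hj)

/-- At an unsaturated level `side` is 0 by convention and may jump when saturation arrives;
afterwards ports can only close. -/
lemma side_mono {bd bd' : V → Board} (hev : ∀ v, Evolves (bd v) (bd' v)) {h : ℕ}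
    (hs : PathSat T u bd h) : side T u bd' h ≤ side T u bd h := by
  rw [side, side, if_pos hs, if_pos (hs.mono hev)]
  refine Nat.sub_le_sub_right (Finset.card_le_card fun p hp => ?_) 1
  simp only [Finset.mem_filter, Finset.mem_range] at hp ⊢
  exact ⟨hp.1, (hev _).opn ((hs h le_rfl).2 p hp.1) hp.2⟩

lemma side_congr {bd bd' : V → Board} {h : ℕ} (hs : PathSat T u bd h ↔ PathSat T u bd' h)
    (hst : PathSat T u bd h → ∀ p, (bd' (T.anc u h)).st p = (bd (T.anc u h)).st p) :
    side T u bd' h = side T u bd h := by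
  unfold side
  rw [← hs]
  split
  · unfold nopen
    simp only [hst ‹_›]
  · rfl

lemma Fits.mono {bd bd' : V → Board} (hev : ∀ v, Evolves (bd v) (bd' v)) {q h : ℕ} {pu : Purse}
    (hseg : (bd (T.anc u h)).seg (pathPort T u h) ≤ (bd' (T.anc u h)).seg (pathPort T u h))
    (hf : Fits T u k bd q h pu) : Fits T u k bd' q h pu := by
  obtain ⟨h1, h2, h3, h4, h5, h6⟩ := hf
  refine ⟨h1.trans hseg, h2, h3, h4, h5, fun x hx hx' => ?_⟩
  obtain ⟨h7, h8⟩ := h6 x hx hx'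
  exact ⟨h7.mono hev, Nat.le_zero.1 (h8 ▸ side_mono hev h7)⟩

/-- How the invariants of the path are preserved. -/
lemma PathInv.of {c c' : TokenConfig k V} {np np' : ℕ → Fin k → ℕ}
    (hP : PathInv T u c np) (hev : ∀ v, Evolves (c.board v) (c'.board v))
    (hseg : ∀ h < T.dep u, (c'.board (T.anc u h)).seg (pathPort T u h) =
      (c.board (T.anc u h)).seg (pathPort T u h) ∨
      (c.board (T.anc u h)).seg (pathPort T u h) ≤ (c'.board (T.anc u h)).seg (pathPort T u h) ∧
      h + (c'.board (T.anc u h)).seg (pathPort T u h) ≤ T.dep u ∧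
      ∀ x, h < x → x < h + (c'.board (T.anc u h)).seg (pathPort T u h) →
        PathSat T u c.board x ∧ side T u c.board x = 0)
    (hzero : ∀ h < T.dep u, ¬ PathSat T u c.board h →
      (c'.board (T.anc u h)).sav (pathPort T u h) = (c.board (T.anc u h)).sav (pathPort T u h) ∧
      (c'.board (T.anc u h)).rem = (c.board (T.anc u h)).rem ∧ ∀ a, np' h a = np h a)
    (hheld : ∀ a, ∀ h < T.dep u, ∀ pu, Held T u (c'.pos a) (c'.mem a) h pu →
      Held T u (c.pos a) (c.mem a) h pu ∧ np' h a = np h a ∨ Fits T u k c.board (np' h a) h pu)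
    (hnot : ∀ a, ∀ h < T.dep u, (∀ pu, ¬ Held T u (c'.pos a) (c'.mem a) h pu) →
      (∀ pu, ¬ Held T u (c.pos a) (c.mem a) h pu) ∧ np' h a = np h a ∨
      np' h a ≤ (c'.board (T.anc u h)).seg (pathPort T u h)) : PathInv T u c' np' := by
  have hsegle : ∀ h < T.dep u, (c.board (T.anc u h)).seg (pathPort T u h) ≤
      (c'.board (T.anc u h)).seg (pathPort T u h) := fun h hh => by
    rcases hseg h hh with h1 | h1
    · exact h1.ge
    · exact h1.1
  constructor
  · intro h hh
    rcases hseg h hh with h1 | h1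
    · rw [h1]; exact hP.seg_le h hh
    · exact h1.2.1
  · intro h hh x hx hx'
    have : PathSat T u c.board x ∧ side T u c.board x = 0 := by
      rcases hseg h hh with h1 | h1
      · rw [h1] at hx'; exact hP.chain h hh x hx hx'
      · exact h1.2.2 x hx hx'
    exact ⟨this.1.mono hev, Nat.le_zero.1 (this.2 ▸ side_mono hev this.1)⟩
  · intro h hh hs
    have hs' : ¬ PathSat T u c.board h := fun h' => hs (h'.mono hev)
    obtain ⟨h1, h2, h3⟩ := hzero h hh hs'
    obtain ⟨h4, h5, h6⟩ := hP.zero h hh hs'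
    exact ⟨h1.trans h4, h2.trans h5, fun a => (h3 a).trans (h6 a)⟩
  · intro a h hh pu hp
    refine Fits.mono hev (hsegle h hh) ?_
    rcases hheld a h hh pu hp with ⟨h1, h2⟩ | h1
    · rw [h2]; exact hP.fits a h hh pu h1
    · exact h1
  · intro a h hh hn
    rcases hnot a h hh hn with ⟨h1, h2⟩ | h1
    · rw [h2]; exact (hP.not_held a h hh h1).trans (hsegle h hh)
    · exact h1

/-- The invariants and the potential of the path to `u`. -/
def PathGood (T : PortTree V) (u : V) (c : TokenConfig k V) : Prop :=
  ∃ np, PathInv T u c np ∧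
    PathState.Covers k (T.dep u) (pathState T u c np) (c.board T.root).tot

lemma heldB_congr {x x' : V} {m m' : Mem} {h : ℕ}
    (hh : ∀ pu, Held T u x' m' h pu ↔ Held T u x m h pu) :
    heldB (Held T u x' m' h) = heldB (Held T u x m h) := by
  have : Held T u x' m' h = Held T u x m h := funext fun pu => propext (hh pu)
  rw [this]

/-- Steps that do not affect the path, except that more levels may become saturated. -/
lemma PathGood.keep (hk : 1 ≤ k) {c c' : TokenConfig k V} {i : Fin k} (hI : Inv T u c)
    (hI' : Inv T u c') (hG : PathGood T u c) (hl : Local c c' i)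
    (htot : (c'.board (c.pos i)).tot = (c.board (c.pos i)).tot)
    (hst : ∀ h < T.dep u, T.anc u h = c.pos i → PathSat T u c.board h →
      ∀ p, (c'.board (c.pos i)).st p = (c.board (c.pos i)).st p)
    (hseg : ∀ h < T.dep u, T.anc u h = c.pos i →
      (c'.board (c.pos i)).seg (pathPort T u h) = (c.board (c.pos i)).seg (pathPort T u h))
    (hsav : ∀ h < T.dep u, T.anc u h = c.pos i →
      (c'.board (c.pos i)).sav (pathPort T u h) = (c.board (c.pos i)).sav (pathPort T u h))
    (hrem : ∀ h < T.dep u, T.anc u h = c.pos i →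
      (c'.board (c.pos i)).rem = (c.board (c.pos i)).rem)
    (hheld : ∀ h < T.dep u, ∀ pu, Held T u (c'.pos i) (c'.mem i) h pu ↔
      Held T u (c.pos i) (c.mem i) h pu) : PathGood T u c' := by
  obtain ⟨np, hP, hC⟩ := hG
  have hb : ∀ {α : Type} (f : Board → ℕ → α), (∀ h < T.dep u, T.anc u h = c.pos i →
      f (c'.board (c.pos i)) h = f (c.board (c.pos i)) h) →
      ∀ h < T.dep u, f (c'.board (T.anc u h)) h = f (c.board (T.anc u h)) h := by
    intro α f hf h hh
    by_cases he : T.anc u h = c.pos i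
    · rw [he]; exact hf h hh he
    · rw [hl.board _ he]
  have hseg' := hb (fun b h => b.seg (pathPort T u h)) hseg
  have hsav' := hb (fun b h => b.sav (pathPort T u h)) hsav
  have hrem' := hb (fun b _ => b.rem) hrem
  have hheld' : ∀ a, ∀ h < T.dep u, ∀ pu, Held T u (c'.pos a) (c'.mem a) h pu ↔
      Held T u (c.pos a) (c.mem a) h pu := by
    intro a h hh pu
    by_cases ha : a = i
    · rw [ha]; exact hheld h hh pu
    · rw [hl.pos a ha, hl.mem a ha]
  have hP' : PathInv T u c' np := hP.of hl.all (fun h hh => .inl (hseg' h hh))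
    (fun h hh _ => ⟨hsav' h hh, hrem' h hh, fun _ => rfl⟩)
    (fun a h hh pu hp => .inl ⟨(hheld' a h hh pu).1 hp, rfl⟩)
    (fun a h hh hn => .inl ⟨fun pu hp => hn pu ((hheld' a h hh pu).2 hp), rfl⟩)
  refine ⟨np, hP', ?_⟩
  have ht : (c'.board T.root).tot = (c.board T.root).tot := by
    by_cases hr : T.root = c.pos i
    · rw [hr]; exact htot
    · rw [hl.board _ hr]
  rw [ht]
  refine hC.mono hk (hP.bounded hI) (hP'.bounded hI') (fun e he => he.mono hl.all) ?_ ?_ ?_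
  · intro e he hs
    refine side_congr ⟨fun h => h.mono hl.all, fun _ => hs⟩ fun _ p => ?_
    by_cases hx : T.anc u e = c.pos i
    · rw [hx]; exact hst e he hx hs p
    · rw [hl.board _ hx]
  · intro h hh
    simp only [pathState, hsav' h hh]
    congr 2
    exact Finset.sum_congr rfl fun a _ => by rw [heldB_congr (hheld' a h hh)]
  · intro h hh
    simp only [pathState, hrem' h hh]

lemma held_move {x x' : V} {m m' : Mem} {h : ℕ} {pu : Purse} (h1 : h ≤ m'.kd ↔ h ≤ m.kd)
    (h2 : h ≤ m.kd → T.anc x' h = T.anc x h) (h3 : m'.fr (h + 1) = m.fr (h + 1)) :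
    Held T u x' m' h pu ↔ Held T u x m h pu := by
  unfold Held
  rw [h1, h3]
  constructor
  · rintro ⟨ha, hb, hc⟩
    exact ⟨ha, (h2 ha) ▸ hb, hc⟩
  · rintro ⟨ha, hb, hc⟩
    exact ⟨ha, (h2 ha).symm ▸ hb, hc⟩

lemma AgentInv.pathSat {bd : V → Board} {x : V} {e : Option ℕ} {m : Mem}
    (hA : AgentInv T u bd x e m) (hs : Saturated T bd x)
    (hx : T.anc u m.kd = x) : PathSat T u bd m.kd := by
  intro j hj
  rcases Nat.lt_or_ge j m.kd with h | h
  · rw [← T.anc_anc hj, hx]; exact hA.sat_above j h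
  · rw [show j = m.kd by omega, hx]; exact hs

lemma AgentInv.level {bd : V → Board} {x : V} {e : Option ℕ} {m : Mem}
    (hA : AgentInv T u bd x e m) (hd : m.dig = 0) {h : ℕ} (hh : h < T.dep u) (hx : T.anc u h = x) :
    h = m.kd := by
  have h1 := T.dep_anc hh.le
  have h2 := hA.depth
  rw [hx] at h1
  omega

lemma AgentInv.kd_lt {bd : V → Board} {x : V} {e : Option ℕ} {m : Mem}
    (hA : AgentInv T u bd x e m) (hx : T.anc u m.kd = x) : m.kd < T.dep u := by
  by_contra hlt
  rw [T.anc_of_le (by omega)] at hx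
  exact hA.unseen hx.symm

/-- The last purse of an agent on the path is held for the path. -/
lemma AgentInv.held {bd : V → Board} {x : V} {e : Option ℕ} {m : Mem}
    (hA : AgentInv T u bd x e m) (hx : T.anc u m.kd = x) {h : ℕ} {pu : Purse} (hh : h + 1 ≤ m.kd)
    (hp : m.fr (h + 1) = some pu) : Held T u x m h pu := by
  have h1 := hA.fr_port h pu hh hp
  have h2 : T.anc x h = T.anc u h := by rw [← hx, T.anc_anc (by omega)]
  have h3 : T.anc x (h + 1) = T.anc u (h + 1) := by rw [← hx, T.anc_anc (by omega)]
  rw [h2, h3] at h1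
  exact ⟨by omega, h2, hp, (h1.inj (child_path (by have := hA.kd_lt hx; omega))).2⟩

/-- Spending tokens beside the path does not affect the path. -/
lemma Inv.held_spend {c : TokenConfig k V} (hI : Inv T u c) {i : Fin k} {j y : ℕ} {pu pu' : Purse}
    (hd : (c.mem i).dig = 0)
    (hj : Active (c.mem i) j) (hp : (c.mem i).fr j = some pu) (hx : T.anc u (c.mem i).kd ≠ c.pos i)
    (h : ℕ) : Held T u (c.pos i) { c.mem i with
      fr := Function.update (c.mem i).fr j (some { pu with B := pu.B - y }) } h pu' ↔
      Held T u (c.pos i) (c.mem i) h pu' := by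
  by_cases hjh : h + 1 = j
  · subst hjh
    have key : ∀ pu', ¬ Held T u (c.pos i) (c.mem i) h pu' := by
      intro pu' hh
      have h1 := (hh.active hI hj (Nat.lt_of_lt_of_le (Nat.lt_succ_self h) hj.1) le_rfl).1
      rw [T.anc_of_le (by have := (hI.agent i).depth; omega)] at h1
      exact hx h1.symm
    constructor
    · rintro ⟨h1, h2, h3, h4⟩
      simp only [Function.update_self, Option.some.injEq] at h3
      subst h3
      exact absurd ⟨h1, h2, hp, h4⟩ (key pu)
    · intro hh
      exact absurd hh (key pu')
  · exact held_move Iff.rfl (fun _ => rfl) (by simp [hjh])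

end TokenSearch

/-! ### Closing ports, dissolving purses and issuing tokens. -/

namespace TokenSearch

open Classical PortStatus

variable {k : ℕ} {V : Type} {T : PortTree V} {u : V}

lemma saturated_congr {bd bd' : V → Board} {v : V} (hv : (bd' v).vis ↔ (bd v).vis)
    (hf : ∀ p, (bd' v).st p = fresh ↔ (bd v).st p = fresh) : Saturated T bd' v ↔ Saturated T bd v := by
  unfold Saturated NoFresh
  simp only [hv, Ne, hf]

/-- If an open port at a saturated level of the path is closed, `side` drops by one there, because
the port towards `u` stays open, and the potential is written off. Any other closing leaves the path
unchanged. -/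
lemma PathGood.close [DecidableEq V] (hk : 1 ≤ k) {c : TokenConfig k V} {i : Fin k}
    (hI : Inv T u c) (hG : PathGood T u c) {p : ℕ} (hv : (c.board (c.pos i)).vis)
    (hcf : (c.mem i).cf) (hp : c.entry i = some p) :
    PathGood T u (c.upd i { c.mem i with cf := False }
      { c.board (c.pos i) with st := Function.update (c.board (c.pos i)).st p closed }) := by
  have hprep : Prep k (T.degree (c.pos i)) (c.entry i) (c.mem i) (c.board (c.pos i)) _ _ :=
    Prep.close p hv hcf hp
  have hI' := hI.prep hprep
  obtain ⟨-, p', w, h2, h3, h4, h5⟩ := (hI.agent i).cf hcf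
  obtain rfl : p = p' := by rw [hp] at h2; simpa using h2
  have hev := hprep.evolves (hI.board.nonvis _) fun _ => ⟨p, hp, h4⟩
  have hl := local_upd (m := { c.mem i with cf := False }) hev
  set c' := c.upd i { c.mem i with cf := False }
    { c.board (c.pos i) with st := Function.update (c.board (c.pos i)).st p closed } with hc'
  have hbx : c'.board (c.pos i) =
      { c.board (c.pos i) with st := Function.update (c.board (c.pos i)).st p closed } := by
    simp [hc', TokenConfig.upd]
  have hmi : c'.mem i = { c.mem i with cf := False } := by simp [hc', TokenConfig.upd]
  have hheldi : ∀ h pu, Held T u (c'.pos i) (c'.mem i) h pu ↔ Held T u (c.pos i) (c.mem i) h pu := by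
    intro h pu
    rw [hmi]
    exact Iff.rfl
  by_cases hcase : ∃ l < T.dep u, T.anc u l = c.pos i ∧ PathSat T u c.board l ∧
      (c.board (c.pos i)).st p = opn
  swap
  · refine hG.keep hk hI hI' hl (by rw [hbx]) (fun h hh hx hs q => ?_) (fun h hh hx => by rw [hbx])
      (fun h hh hx => by rw [hbx]) (fun h hh hx => by rw [hbx]) fun h _ => hheldi h
    rw [hbx]
    by_cases hq : q = p
    · subst hq
      simp only [Function.update_self]
      rcases h4 with h4 | h4
      · exact absurd ⟨h, hh, hx, hs, h4⟩ hcase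
      · exact h4.symm
    · simp [hq]
  obtain ⟨l, hlL, hlx, hls, hlo⟩ := hcase
  obtain ⟨np, hP, hC⟩ := hG
  have hsame : ∀ v, (c'.board v).seg = (c.board v).seg ∧ (c'.board v).sav = (c.board v).sav ∧
      (c'.board v).rem = (c.board v).rem ∧ (c'.board v).tot = (c.board v).tot := by
    intro v
    by_cases hvx : v = c.pos i
    · rw [hvx, hbx]; exact ⟨rfl, rfl, rfl, rfl⟩
    · rw [hl.board v hvx]; exact ⟨rfl, rfl, rfl, rfl⟩
  have hheld : ∀ a h pu, Held T u (c'.pos a) (c'.mem a) h pu ↔ Held T u (c.pos a) (c.mem a) h pu := by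
    intro a h pu
    by_cases ha : a = i
    · rw [ha]; exact hheldi h pu
    · rw [hl.pos a ha, hl.mem a ha]
  have hsat : ∀ v, Saturated T c'.board v ↔ Saturated T c.board v := by
    intro v
    by_cases hvx : v = c.pos i
    · rw [hvx]
      refine saturated_congr (by rw [hbx]) fun q => ?_
      rw [hbx]
      by_cases hq : q = p
      · subst hq
        simp [hlo]
      · simp [hq]
    · exact saturated_congr (by rw [hl.board v hvx]) fun q => by rw [hl.board v hvx]
  have hps : ∀ e, PathSat T u c.board e ↔ PathSat T u c'.board e := fun e => by
    simp only [PathSat, hsat]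
  refine ⟨np, hP.of hl.all (fun h _ => .inl (by rw [(hsame _).1]))
    (fun h _ _ => ⟨by rw [(hsame _).2.1], (hsame _).2.2.1, fun _ => rfl⟩)
    (fun a h _ pu hp => .inl ⟨(hheld a h pu).1 hp, rfl⟩)
    (fun a h _ hn => .inl ⟨fun pu hp => hn pu ((hheld a h pu).2 hp), rfl⟩), ?_⟩
  rw [(hsame _).2.2.2]
  refine hC.close hk (hP.bounded hI) hlL hps (fun e he => ?_) ?_ ?_ ?_
  · refine side_congr (hps e) fun hs q => ?_
    have heL := hs.lt hI
    rw [hl.board]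
    intro hx
    exact he (anc_inj heL.le hlL.le (hx.trans hlx.symm))
  · have h6 := ((hps l).1 hls).side_add_one hI'
    have h7 := hls.side_add_one hI
    have h8 : nopen (T.degree (T.anc u l)) (c'.board (T.anc u l)) + 1 =
        nopen (T.degree (T.anc u l)) (c.board (T.anc u l)) := by
      rw [hlx, hbx]
      unfold nopen
      have hmem : p ∈ (Finset.range (T.degree (c.pos i))).filter fun q =>
          (c.board (c.pos i)).st q = opn := by
        rw [Finset.mem_filter, Finset.mem_range]
        exact ⟨h3.1, hlo⟩
      rw [← Finset.card_erase_add_one hmem]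
      congr 2
      ext q
      by_cases hq : q = p
      · subst hq; simp
      · simp [hq]
    show side T u c'.board l + 1 = side T u c.board l
    omega
  · intro h _
    simp only [pathState, (hsame _).2.1]
    congr 2
    exact Finset.sum_congr rfl fun a _ => by rw [heldB_congr (hheld a h)]
  · intro h _
    simp only [pathState, (hsame _).2.2.1]

/-- The purse is empty, so no value disappears. If it was held for the path, the new segment is long
enough to cover all that its owner has paid, and its inner levels are not forks by `Fits`. -/
lemma PathGood.dissolve [DecidableEq V] (hk : 1 ≤ k) {c : TokenConfig k V} {i : Fin k}
    (hI : Inv T u c) (hG : PathGood T u c) {pu : Purse} (hv : (c.board (c.pos i)).vis)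
    (hcf : ¬ (c.mem i).cf) (hp : (c.mem i).fr ((c.mem i).kd + 1) = some pu) :
    PathGood T u (c.upd i
      { c.mem i with fr := Function.update (c.mem i).fr ((c.mem i).kd + 1) none }
      { c.board (c.pos i) with
        seg := Function.update (c.board (c.pos i)).seg pu.port
          (max ((c.board (c.pos i)).seg pu.port) (pu.far - (c.mem i).kd)) }) := by
  have hprep : Prep k (T.degree (c.pos i)) (c.entry i) (c.mem i) (c.board (c.pos i)) _ _ :=
    Prep.dissolve pu hv hcf hp
  have hI' := hI.prep hprep
  have hev := hprep.evolves (hI.board.nonvis _) fun h => absurd h hcf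
  have hl := local_upd (i := i) (m := { c.mem i with
    fr := Function.update (c.mem i).fr ((c.mem i).kd + 1) none }) hev
  have hA := hI.agent i
  obtain ⟨hd, hB, he, hsat⟩ := hA.fr_next pu hp
  have hxk : T.anc (c.pos i) (c.mem i).kd = c.pos i := T.anc_of_le (by have := hA.depth; omega)
  set c' := c.upd i
      { c.mem i with fr := Function.update (c.mem i).fr ((c.mem i).kd + 1) none }
      { c.board (c.pos i) with
        seg := Function.update (c.board (c.pos i)).seg pu.port
          (max ((c.board (c.pos i)).seg pu.port) (pu.far - (c.mem i).kd)) } with hc'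
  have hbx : c'.board (c.pos i) = { c.board (c.pos i) with
      seg := Function.update (c.board (c.pos i)).seg pu.port
        (max ((c.board (c.pos i)).seg pu.port) (pu.far - (c.mem i).kd)) } := by
    simp [hc', TokenConfig.upd]
  have hmi : c'.mem i = { c.mem i with
      fr := Function.update (c.mem i).fr ((c.mem i).kd + 1) none } := by
    simp [hc', TokenConfig.upd]
  have hpi : c'.pos i = c.pos i := rfl
  have hheldi : ∀ h pu', h ≠ (c.mem i).kd → (Held T u (c'.pos i) (c'.mem i) h pu' ↔
      Held T u (c.pos i) (c.mem i) h pu') := by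
    intro h pu' hh
    rw [hmi, hpi]
    exact held_move Iff.rfl (fun _ => rfl) (by simp [hh])
  have hnone : ∀ pu', ¬ Held T u (c'.pos i) (c'.mem i) (c.mem i).kd pu' := by
    rintro pu' ⟨-, -, h3, -⟩
    rw [hmi] at h3
    simp at h3
  by_cases hcase : Held T u (c.pos i) (c.mem i) (c.mem i).kd pu
  swap
  · refine hG.keep hk hI hI' hl (by rw [hbx]) (fun h hh hx hs q => by rw [hbx]) (fun h hh hx => ?_)
      (fun h hh hx => by rw [hbx]) (fun h hh hx => by rw [hbx]) fun h hh pu' => ?_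
    · have hhk := hA.level hd hh hx
      rw [hbx]
      have : pathPort T u h ≠ pu.port := by
        intro hport
        rw [hhk] at hport hx
        exact hcase ⟨le_rfl, hxk.trans hx.symm, hp, hport.symm⟩
      simp [this]
    · by_cases hhk : h = (c.mem i).kd
      · rw [hhk]
        refine ⟨fun h => absurd h (hnone pu'), fun h => ?_⟩
        have h3 := h.2.2.1
        rw [hp] at h3
        simp only [Option.some.injEq] at h3
        rw [← h3] at h
        exact absurd h hcase
      · exact hheldi h pu' hhk
  have hx : T.anc u (c.mem i).kd = c.pos i := by rw [← hcase.2.1, hxk]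
  have hport := hcase.2.2.2
  have hs0 := hcase.pathSat hI
  have hL0 := hs0.lt hI
  obtain ⟨np, hP, hC⟩ := hG
  obtain ⟨f1, f2, f3, f4, f5, f6⟩ := hP.fits i _ hL0 pu hcase
  have hsame : ∀ v, (c'.board v).st = (c.board v).st ∧ (c'.board v).sav = (c.board v).sav ∧
      (c'.board v).rem = (c.board v).rem ∧ (c'.board v).tot = (c.board v).tot := by
    intro v
    by_cases hvx : v = c.pos i
    · rw [hvx, hbx]; exact ⟨rfl, rfl, rfl, rfl⟩
    · rw [hl.board v hvx]; exact ⟨rfl, rfl, rfl, rfl⟩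
  have hseg : (c'.board (T.anc u (c.mem i).kd)).seg (pathPort T u (c.mem i).kd) =
      max ((c.board (T.anc u (c.mem i).kd)).seg (pathPort T u (c.mem i).kd))
        (pu.far - (c.mem i).kd) := by
    rw [hx, hbx, hport]
    simp
  have hheld : ∀ a h pu', ¬ (a = i ∧ h = (c.mem i).kd) → (Held T u (c'.pos a) (c'.mem a) h pu' ↔
      Held T u (c.pos a) (c.mem a) h pu') := by
    intro a h pu' hah
    by_cases ha : a = i
    · subst ha
      exact hheldi h pu' fun hh => hah ⟨rfl, hh⟩
    · rw [hl.pos a ha, hl.mem a ha]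
  have hP' : PathInv T u c' np := by
    refine hP.of hl.all (fun h hh => ?_)
      (fun h _ _ => ⟨by rw [(hsame _).2.1], (hsame _).2.2.1, fun _ => rfl⟩)
      (fun a h hh pu' hp' => .inl ⟨?_, rfl⟩) (fun a h hh hn => ?_)
    · by_cases hhk : h = (c.mem i).kd
      · subst hhk
        right
        rw [hseg]
        have hsl := hP.seg_le _ hh
        refine ⟨le_max_left _ _, by omega, fun x hx hx' => ?_⟩
        by_cases hxs : x < (c.mem i).kd +
            (c.board (T.anc u (c.mem i).kd)).seg (pathPort T u (c.mem i).kd)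
        · exact hP.chain _ hh x hx hxs
        · exact f6 x hx (by omega)
      · left
        rw [hl.board]
        intro hx'
        exact hhk (hA.level hd hh hx')
    · by_cases hah : a = i ∧ h = (c.mem i).kd
      · obtain ⟨rfl, rfl⟩ := hah
        exact absurd hp' (hnone pu')
      · exact (hheld a h pu' hah).1 hp'
    · by_cases hah : a = i ∧ h = (c.mem i).kd
      · obtain ⟨rfl, rfl⟩ := hah
        right
        rw [hseg]
        omega
      · exact .inl ⟨fun pu' hp' => hn pu' ((hheld a h pu' hah).2 hp'), rfl⟩
  refine ⟨np, hP', ?_⟩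
  rw [(hsame _).2.2.2]
  refine hC.mono hk (hP.bounded hI) (hP'.bounded hI') (fun e he => he.mono hl.all)
    (fun e _ hs => side_congr ⟨fun h => h.mono hl.all, fun _ => hs⟩ fun _ q => by rw [(hsame _).1])
    (fun h _ => ?_) fun h _ => by simp only [pathState, (hsame _).2.2.1]
  simp only [pathState, (hsame _).2.1]
  congr 2
  refine Finset.sum_congr rfl fun a _ => ?_
  by_cases hah : a = i ∧ h = (c.mem i).kd
  · obtain ⟨rfl, rfl⟩ := hah
    rw [heldB_eq hcase, heldB_zero hnone, hB]
  · rw [heldB_congr fun pu' => hheld a h pu' hah]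

lemma PathGood.issue [DecidableEq V] (hk : 1 ≤ k) {c : TokenConfig k V} {i : Fin k}
    (hI : Inv T u c) (hG : PathGood T u c) {n : ℕ} (hr : Ready (c.mem i) (c.board (c.pos i)))
    (hf : NoFresh (T.degree (c.pos i)) (c.board (c.pos i))) (hd : (c.mem i).dig = 0)
    (h0 : (c.mem i).kd = 0) :
    PathGood T u (c.upd i (c.mem i) { addTokens (c.board (c.pos i)) n with
      tot := (c.board (c.pos i)).tot + n * nopen (T.degree (c.pos i)) (c.board (c.pos i)) }) := by
  have hA := hI.agent i
  have hxr : c.pos i = T.root := T.dep_eq_zero.1 (by have := hA.depth; omega)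
  have hx : T.anc u 0 = c.pos i := by rw [T.anc_zero, hxr]
  have hev : Evolves (c.board (c.pos i)) { addTokens (c.board (c.pos i)) n with
      tot := (c.board (c.pos i)).tot + n * nopen (T.degree (c.pos i)) (c.board (c.pos i)) } :=
    ⟨id, fun _ => .inr (.inl rfl)⟩
  have hl := local_upd (m := c.mem i) hev
  set c' := c.upd i (c.mem i) { addTokens (c.board (c.pos i)) n with
      tot := (c.board (c.pos i)).tot + n * nopen (T.degree (c.pos i)) (c.board (c.pos i)) } with hc'
  have hbx : c'.board (c.pos i) = { addTokens (c.board (c.pos i)) n with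
      tot := (c.board (c.pos i)).tot + n * nopen (T.degree (c.pos i)) (c.board (c.pos i)) } := by
    simp [hc', TokenConfig.upd]
  have hmem : ∀ a, c'.mem a = c.mem a := by
    intro a
    by_cases ha : a = i
    · subst ha; simp [hc', TokenConfig.upd]
    · exact hl.mem a ha
  have hpos : ∀ a, c'.pos a = c.pos a := fun a => rfl
  have hs0 : PathSat T u c.board 0 := by
    have := hA.pathSat ⟨hr.1, hf⟩ (by rw [h0]; exact hx)
    rwa [h0] at this
  have hL0 := hs0.lt hI
  have hne : ∀ h < T.dep u, h ≠ 0 → T.anc u h ≠ c.pos i := by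
    intro h hh hh0 he
    exact hh0 (anc_inj hh.le (Nat.zero_le _) (he.trans hx.symm))
  have hsame : ∀ v, (c'.board v).st = (c.board v).st ∧ (c'.board v).seg = (c.board v).seg ∧
      (c'.board v).rem = (c.board v).rem ∧ (c'.board v).vis = (c.board v).vis := by
    intro v
    by_cases hvx : v = c.pos i
    · rw [hvx, hbx]; exact ⟨rfl, rfl, rfl, rfl⟩
    · rw [hl.board v hvx]; exact ⟨rfl, rfl, rfl, rfl⟩
  have hps : ∀ e, PathSat T u c.board e ↔ PathSat T u c'.board e := fun e => by
    simp only [PathSat]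
    refine forall₂_congr fun j _ => (saturated_congr (by rw [(hsame _).2.2.2]) fun q => ?_).symm
    rw [(hsame _).1]
  have hside : ∀ e, side T u c'.board e = side T u c.board e := fun e =>
    side_congr (hps e) fun _ q => by rw [(hsame _).1]
  obtain ⟨np, hP, hC⟩ := hG
  refine ⟨np, hP.of hl.all (fun h _ => .inl (by rw [(hsame _).2.1])) (fun h hh hs => ?_)
    (fun a h _ pu hp => .inl ⟨?_, rfl⟩) (fun a h _ hn => .inl ⟨fun pu hp => hn pu ?_, rfl⟩), ?_⟩
  · have hh0 : h ≠ 0 := by rintro rfl; exact hs hs0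
    rw [hl.board _ (hne h hh hh0)]
    exact ⟨rfl, rfl, fun _ => rfl⟩
  · rwa [hmem, hpos] at hp
  · rwa [hmem, hpos]
  · have ht : (c'.board T.root).tot = (c.board T.root).tot + n * (side T u c.board 0 + 1) := by
      rw [hs0.side_add_one hI, hx, ← hxr, hbx]
    rw [ht]
    have hopn := PathSat.port_open hI (hs0 0 le_rfl) hL0
    rw [hx] at hopn
    refine PathState.Covers.issue hk hC hL0 hps hside (fun h hh hh0 => ?_) ?_ fun h => ?_
    · simp only [pathState, hmem, hpos]
      rw [hl.board _ (hne h hh hh0)]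
    · simp only [pathState, hmem, hpos]
      rw [hx, hbx]
      simp only [addTokens, hopn, if_true]
      ring
    · exact (hsame _).2.2.1

end TokenSearch

/-! ### Spending the tokens of a purse. -/

namespace TokenSearch

open Classical PortStatus

variable {k : ℕ} {V : Type} {T : PortTree V} {u : V}

/-- Spending tokens beside the path. -/
lemma PathGood.spend_beside [DecidableEq V] (hk : 1 ≤ k) {c : TokenConfig k V} {i : Fin k}
    (hI : Inv T u c) (hG : PathGood T u c) {j y : ℕ} {pu : Purse} {b : Board}
    (hd : (c.mem i).dig = 0) (hj : Active (c.mem i) j) (hp : (c.mem i).fr j = some pu)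
    (hx : T.anc u (c.mem i).kd ≠ c.pos i) (hev : Evolves (c.board (c.pos i)) b)
    (ht : b.tot = (c.board (c.pos i)).tot)
    (hI' : Inv T u (c.upd i { c.mem i with
      fr := Function.update (c.mem i).fr j (some { pu with B := pu.B - y }) } b)) :
    PathGood T u (c.upd i { c.mem i with
      fr := Function.update (c.mem i).fr j (some { pu with B := pu.B - y }) } b) := by
  have hne : ∀ h < T.dep u, T.anc u h ≠ c.pos i := fun h hh he => by
    have := (hI.agent i).level hd hh he
    rw [this] at he
    exact hx he
  refine hG.keep hk hI hI' (local_upd hev) (by simpa [TokenConfig.upd] using ht)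
    (fun h hh he => absurd he (hne h hh)) (fun h hh he => absurd he (hne h hh))
    (fun h hh he => absurd he (hne h hh)) (fun h hh he => absurd he (hne h hh)) fun h _ pu' => ?_
  simp only [TokenConfig.upd, Function.update_self]
  exact hI.held_spend hd hj hp hx h

/-- On the path, the last purse was taken at a fork of the path with no fork in between, so
`Covers.pay` applies. Beside the path, the last purse is not held for the path. -/
lemma PathGood.pay [DecidableEq V] (hk : 1 ≤ k) {c : TokenConfig k V} {i : Fin k}
    (hI : Inv T u c) (hG : PathGood T u c) {n y r j : ℕ} {pu : Purse}
    (hr : Ready (c.mem i) (c.board (c.pos i)))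
    (hf : NoFresh (T.degree (c.pos i)) (c.board (c.pos i))) (hd : (c.mem i).dig = 0)
    (hn : ∀ p < T.degree (c.pos i), (c.board (c.pos i)).st p = opn →
      (c.board (c.pos i)).sav p + n ≤ (k + 1) * (c.board (c.pos i)).seg p)
    (hj : Active (c.mem i) j) (hp : (c.mem i).fr j = some pu) (hy : y ≤ pu.B)
    (hs : y + (c.board (c.pos i)).rem = n * nopen (T.degree (c.pos i)) (c.board (c.pos i)) + r)
    (hrk : r ≤ k) (h2 : 2 ≤ nopen (T.degree (c.pos i)) (c.board (c.pos i))) :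
    PathGood T u (c.upd i { c.mem i with
      fr := Function.update (c.mem i).fr j (some { pu with B := pu.B - y }) }
      { addTokens (c.board (c.pos i)) n with rem := r }) := by
  have hprep : Prep k (T.degree (c.pos i)) (c.entry i) (c.mem i) (c.board (c.pos i)) _ _ :=
    Prep.pay n y r j pu hr hf hd hn hj hp hy hs hrk h2
  have hI' := hI.prep hprep
  have hA := hI.agent i
  have hev : Evolves (c.board (c.pos i)) { addTokens (c.board (c.pos i)) n with rem := r } :=
    ⟨id, fun _ => .inr (.inl rfl)⟩
  by_cases hx : T.anc u (c.mem i).kd = c.pos i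
  swap
  · exact hG.spend_beside hk hI hd hj hp hx hev rfl hI'
  have hl := local_upd (m := { c.mem i with
    fr := Function.update (c.mem i).fr j (some { pu with B := pu.B - y }) }) hev
  obtain ⟨h, rfl⟩ : ∃ h, j = h + 1 := by
    rcases j with - | h
    · rw [hA.fr_zero] at hp; simp at hp
    · exact ⟨h, rfl⟩
  have hhk : h < (c.mem i).kd := hj.1
  set c' := c.upd i { c.mem i with
      fr := Function.update (c.mem i).fr (h + 1) (some { pu with B := pu.B - y }) }
      { addTokens (c.board (c.pos i)) n with rem := r } with hc'
  have hbx : c'.board (c.pos i) = { addTokens (c.board (c.pos i)) n with rem := r } := by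
    simp [hc', TokenConfig.upd]
  have hmi : c'.mem i = { c.mem i with
      fr := Function.update (c.mem i).fr (h + 1) (some { pu with B := pu.B - y }) } := by
    simp [hc', TokenConfig.upd]
  have hpi : c'.pos i = c.pos i := rfl
  have hH := hA.held hx hj.1 hp
  have hs0 := hA.pathSat ⟨hr.1, hf⟩ hx
  have hL0 := hs0.lt hI
  have hact := fun l => hH.active hI hj (l := l)
  have hH' : Held T u (c'.pos i) (c'.mem i) h { pu with B := pu.B - y } := by
    rw [hmi, hpi]
    exact ⟨hH.1, hH.2.1, by simp, hH.2.2.2⟩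
  have hne : ∀ l < T.dep u, l ≠ (c.mem i).kd → T.anc u l ≠ c.pos i := fun l hl hlk he =>
    hlk (anc_inj hl.le hL0.le (he.trans hx.symm))
  have hheld : ∀ a l pu', ¬ (a = i ∧ l = h) → (Held T u (c'.pos a) (c'.mem a) l pu' ↔
      Held T u (c.pos a) (c.mem a) l pu') := by
    intro a l pu' hal
    by_cases ha : a = i
    · subst ha
      rw [hmi, hpi]
      exact held_move Iff.rfl (fun _ => rfl) (by
        have : l ≠ h := fun e => hal ⟨rfl, e⟩
        simp [this])
    · rw [hl.pos a ha, hl.mem a ha]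
  have hsame : ∀ v, (c'.board v).st = (c.board v).st ∧ (c'.board v).seg = (c.board v).seg ∧
      (c'.board v).tot = (c.board v).tot ∧ (c'.board v).vis = (c.board v).vis := by
    intro v
    by_cases hvx : v = c.pos i
    · rw [hvx, hbx]; exact ⟨rfl, rfl, rfl, rfl⟩
    · rw [hl.board v hvx]; exact ⟨rfl, rfl, rfl, rfl⟩
  have hps : ∀ e, PathSat T u c.board e ↔ PathSat T u c'.board e := fun e => by
    simp only [PathSat]
    refine forall₂_congr fun j _ => (saturated_congr (by rw [(hsame _).2.2.2]) fun q => ?_).symm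
    rw [(hsame _).1]
  have hside : ∀ e, side T u c'.board e = side T u c.board e := fun e =>
    side_congr (hps e) fun _ q => by rw [(hsame _).1]
  have hside0 := hs0.side_add_one hI
  rw [hx] at hside0
  obtain ⟨np, hP, hC⟩ := hG
  refine ⟨np, hP.of hl.all (fun h _ => .inl (by rw [(hsame _).2.1])) (fun l hl' hs => ?_)
    (fun a l hlL pu' hp' => ?_) (fun a l _ hn => .inl ⟨fun pu' hp' => ?_, rfl⟩), ?_⟩
  · rw [hl.board _ (hne l hl' fun he => hs (he ▸ hs0))]
    exact ⟨rfl, rfl, fun _ => rfl⟩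
  · by_cases hal : a = i ∧ l = h
    · obtain ⟨rfl, rfl⟩ := hal
      right
      have h3 := hp'.2.2.1
      rw [hH'.2.2.1] at h3
      simp only [Option.some.injEq] at h3
      subst h3
      obtain ⟨f1, f2, f3, f4, f5, f6⟩ := hP.fits a l hlL pu hH
      exact ⟨f1, by dsimp only; omega, f3, f4, f5, f6⟩
    · exact .inl ⟨(hheld a l pu' hal).1 hp', rfl⟩
  · by_cases hal : a = i ∧ l = h
    · obtain ⟨rfl, rfl⟩ := hal
      exact hn _ hH'
    · exact hn pu' ((hheld a l pu' hal).2 hp')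
  · rw [(hsame _).2.2.1]
    have hopn := PathSat.port_open hI (hs0 _ le_rfl) hL0
    rw [hx] at hopn
    have hsum : ∀ l, l ≠ h → ∑ a, (heldB (Held T u (c'.pos a) (c'.mem a) l) + np l a) =
        ∑ a, (heldB (Held T u (c.pos a) (c.mem a) l) + np l a) := by
      intro l hl
      refine Finset.sum_congr rfl fun a _ => ?_
      rw [heldB_congr fun pu' => hheld a l pu' fun hal => hl hal.2]
    refine PathState.Covers.pay hk hC hL0 hhk hps hside (n := n) (x := y) ?_
      (fun l hl hlk => (hact l hl hlk.le).2 hlk) (fun l hlL hlh hlk => ?_) ?_ ?_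
      (fun l hlL hlk => ?_) ?_
    · show 1 ≤ side T u c.board (c.mem i).kd
      omega
    · simp only [pathState]
      rw [hsum l hlh, hl.board _ (hne l hlL hlk)]
    · simp only [pathState]
      rw [hsum _ (by omega), hx, hbx]
      simp only [addTokens, hopn, if_true]
      ring
    · simp only [pathState]
      rw [hl.board _ (hne h (by omega) (by omega))]
      have h3 := sum_change (s := Finset.univ)
        (g := fun a => heldB (Held T u (c.pos a) (c.mem a) h) + np h a)
        (g' := fun a => heldB (Held T u (c'.pos a) (c'.mem a) h) + np h a) (i := i) (by simp)
        fun a ha => by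
          rw [heldB_congr fun pu' => hheld a h pu' fun hal => ha hal.1]
      simp only [heldB_eq hH, heldB_eq hH'] at h3
      rw [add_assoc, ← mul_add]
      refine Nat.add_le_add_left (Nat.mul_le_mul_left _ ?_) _
      omega
    · simp only [pathState]
      rw [hl.board _ (hne l hlL hlk)]
    · simp only [pathState]
      rw [hx, hbx, hside0]
      exact hs

/-- Operations that precede a move preserve the invariants of the path. -/
lemma PathGood.prep [DecidableEq V] (hk : 1 ≤ k) {c : TokenConfig k V} {i : Fin k} {m : Mem}
    {b : Board} (hI : Inv T u c) (hG : PathGood T u c)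
    (h : Prep k (T.degree (c.pos i)) (c.entry i) (c.mem i) (c.board (c.pos i)) m b) :
    PathGood T u (c.upd i m b) := by
  have hI' := hI.prep h
  have hev : Evolves (c.board (c.pos i)) b := h.evolves (hI.board.nonvis _) fun hc => by
    obtain ⟨-, p, w, h2, -, h4, -⟩ := (hI.agent i).cf hc
    exact ⟨p, h2, h4⟩
  cases h with
  | mark h =>
    refine hG.keep hk hI hI' (local_upd hev) (by simp [TokenConfig.upd]) (fun l _ he hs => ?_)
      (fun l _ _ => by simp [TokenConfig.upd]) (fun l _ _ => by simp [TokenConfig.upd])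
      (fun l _ _ => by simp [TokenConfig.upd]) fun l _ pu => by simp [TokenConfig.upd]
    have := (hs l le_rfl).1
    rw [he] at this
    exact absurd this h
  | close p hv h hp => exact hG.close hk hI hv h hp
  | dissolve pu hv hc h => exact hG.dissolve hk hI hv hc h
  | issue n hr hf hd h0 hn => exact hG.issue hk hI hr hf hd h0
  | pay n x r j pu hr hf hd hn hj hp hx hs hrk h2 =>
    exact hG.pay hk hI hr hf hd hn hj hp hx hs hrk h2
  | drop j pu hr hf hd ho hj hp =>
    -- A saturated vertex on the path has an open port, so tokens are dropped only beside the path.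
    refine hG.spend_beside hk hI hd hj hp (fun hx => ?_) hev rfl hI'
    obtain ⟨p, w, hc, -, hpo⟩ := hI.board.exists_open (v := c.pos i) ⟨hr.1, hf⟩ (by
      rw [← hx]; exact T.above_anc _ _)
    exact ho p hc.1 hpo

end TokenSearch

/-! ### Moves and the path; the final bound. -/

namespace TokenSearch

open Classical PortStatus

variable {k : ℕ} {V : Type} {T : PortTree V} {u : V}

/-- The value is unchanged: `(k + 1) * seg` saved tokens worth `k` each become `k * seg` carried
ones worth `k + 1` each. -/
lemma PathGood.depart [DecidableEq V] (hk : 1 ≤ k) {c : TokenConfig k V} {i : Fin k} {p : ℕ}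
    (hI : Inv T u c) (hG : PathGood T u c) (hr : Ready (c.mem i) (c.board (c.pos i)))
    (hf : NoFresh (T.degree (c.pos i)) (c.board (c.pos i))) (hd : (c.mem i).dig = 0)
    (hs : (k + 1) * (c.board (c.pos i)).seg p ≤ (c.board (c.pos i)).sav p)
    (hc : T.Child (c.pos i) p (T.nb (c.pos i) p))
    (hI' : Inv T u (c.go T i { c.mem i with
      kd := (c.mem i).kd + 1
      fr := Function.update (c.mem i).fr ((c.mem i).kd + 1) (some ⟨k * (c.board (c.pos i)).seg p,
        (c.board (c.pos i)).seg p, (c.mem i).kd + 1, p⟩) }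
      { c.board (c.pos i) with
        sav := Function.update (c.board (c.pos i)).sav p
          ((c.board (c.pos i)).sav p - (k + 1) * (c.board (c.pos i)).seg p) } p)) :
    PathGood T u (c.go T i { c.mem i with
      kd := (c.mem i).kd + 1
      fr := Function.update (c.mem i).fr ((c.mem i).kd + 1) (some ⟨k * (c.board (c.pos i)).seg p,
        (c.board (c.pos i)).seg p, (c.mem i).kd + 1, p⟩) }
      { c.board (c.pos i) with
        sav := Function.update (c.board (c.pos i)).sav p
          ((c.board (c.pos i)).sav p - (k + 1) * (c.board (c.pos i)).seg p) } p) := by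
  have hA := hI.agent i
  have hdep := hA.depth
  set pu : Purse := ⟨k * (c.board (c.pos i)).seg p, (c.board (c.pos i)).seg p, (c.mem i).kd + 1, p⟩
    with hpu
  set m' : Mem := { c.mem i with
      kd := (c.mem i).kd + 1
      fr := Function.update (c.mem i).fr ((c.mem i).kd + 1) (some pu) } with hm'
  set b' : Board := { c.board (c.pos i) with
        sav := Function.update (c.board (c.pos i)).sav p
          ((c.board (c.pos i)).sav p - (k + 1) * (c.board (c.pos i)).seg p) } with hb'
  have hev : Evolves (c.board (c.pos i)) b' := ⟨id, fun _ => .inr (.inl rfl)⟩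
  have hl : Local c (c.go T i m' b' p) i := local_go hev
  set c' := c.go T i m' b' p with hc'
  have hbx : c'.board (c.pos i) = b' := by simp [hc', TokenConfig.go]
  have hmi : c'.mem i = m' := by simp [hc', TokenConfig.go]
  have hpi : c'.pos i = T.nb (c.pos i) p := by simp [hc', TokenConfig.go]
  have hxk : T.anc (c.pos i) (c.mem i).kd = c.pos i := T.anc_of_le (by omega)
  have hanc : ∀ l ≤ (c.mem i).kd, T.anc (T.nb (c.pos i) p) l = T.anc (c.pos i) l := fun l hl =>
    hc.anc (by omega)
  have hheldi : ∀ l pu', l ≠ (c.mem i).kd → (Held T u (c'.pos i) (c'.mem i) l pu' ↔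
      Held T u (c.pos i) (c.mem i) l pu') := by
    intro l pu' hlk
    rw [hmi, hpi]
    rcases Nat.lt_or_ge l (c.mem i).kd with hlt | hge
    · exact held_move (by dsimp only [m']; omega) (hanc l) (by simp [hm', hlk])
    · constructor
      · rintro ⟨h1, -, h3, -⟩
        dsimp only [m'] at h1 h3
        rw [Function.update_of_ne (by omega), hA.fr_beyond _ (by omega)] at h3
        simp at h3
      · rintro ⟨h1, -⟩
        omega
  have hnone : ∀ pu', ¬ Held T u (c.pos i) (c.mem i) (c.mem i).kd pu' := by
    rintro pu' ⟨-, -, h3, -⟩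
    rw [hr.2.2] at h3
    simp at h3
  by_cases hcase : T.anc u (c.mem i).kd = c.pos i ∧ p = pathPort T u (c.mem i).kd
  swap
  · refine hG.keep hk hI hI' hl (by rw [hbx]) (fun h hh hx hs q => by rw [hbx])
      (fun h hh hx => by rw [hbx]) (fun h hh hx => ?_) (fun h hh hx => by rw [hbx])
      fun h hh pu' => ?_
    · have hhk := hA.level hd hh hx
      rw [hbx]
      have : pathPort T u h ≠ p := by
        intro hport
        rw [hhk] at hport hx
        exact hcase ⟨hx, hport.symm⟩
      simp [hb', this]
    · by_cases hhk : h = (c.mem i).kd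
      · rw [hhk]
        refine ⟨fun h => ?_, fun h => absurd h (hnone pu')⟩
        rw [hmi, hpi] at h
        obtain ⟨-, h2, h3, h4⟩ := h
        simp only [hm', Function.update_self, Option.some.injEq] at h3
        rw [hanc _ le_rfl, hxk] at h2
        rw [← h3] at h4
        exact absurd ⟨h2.symm, h4⟩ hcase
      · exact hheldi h pu' hhk
  obtain ⟨hx, hport⟩ := hcase
  have hs0 := hA.pathSat ⟨hr.1, hf⟩ hx
  have hL0 := hs0.lt hI
  have hH' : Held T u (c'.pos i) (c'.mem i) (c.mem i).kd pu := by
    rw [hmi, hpi]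
    exact ⟨Nat.le_succ _, by rw [hanc _ le_rfl, hxk, hx], by simp [hm'], hport⟩
  have hheld : ∀ a l pu', ¬ (a = i ∧ l = (c.mem i).kd) → (Held T u (c'.pos a) (c'.mem a) l pu' ↔
      Held T u (c.pos a) (c.mem a) l pu') := by
    intro a l pu' hal
    by_cases ha : a = i
    · subst ha
      exact hheldi l pu' fun e => hal ⟨rfl, e⟩
    · rw [hl.pos a ha, hl.mem a ha]
  have hsame : ∀ v, (c'.board v).st = (c.board v).st ∧ (c'.board v).seg = (c.board v).seg ∧
      (c'.board v).tot = (c.board v).tot ∧ (c'.board v).rem = (c.board v).rem := by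
    intro v
    by_cases hvx : v = c.pos i
    · rw [hvx, hbx]; exact ⟨rfl, rfl, rfl, rfl⟩
    · rw [hl.board v hvx]; exact ⟨rfl, rfl, rfl, rfl⟩
  have hne : ∀ l < T.dep u, l ≠ (c.mem i).kd → T.anc u l ≠ c.pos i := fun l hl hlk he =>
    hlk (anc_inj hl.le hL0.le (he.trans hx.symm))
  obtain ⟨np, hP, hC⟩ := hG
  have hnp := hP.not_held i _ hL0 hnone
  rw [hx, ← hport] at hnp
  have hP' : PathInv T u c' np := by
    refine hP.of hl.all (fun h _ => .inl (by rw [(hsame _).2.1])) (fun l hl' hs => ?_)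
      (fun a l hlL pu' hp' => ?_) (fun a l _ hn => .inl ⟨fun pu' hp' => ?_, rfl⟩)
    · rw [hl.board _ (hne l hl' fun he => hs (he ▸ hs0))]
      exact ⟨rfl, rfl, fun _ => rfl⟩
    · by_cases hal : a = i ∧ l = (c.mem i).kd
      · obtain ⟨rfl, rfl⟩ := hal
        right
        have h3 := hp'.2.2.1
        rw [hH'.2.2.1] at h3
        simp only [Option.some.injEq] at h3
        subst h3
        refine ⟨?_, ?_, ?_, le_rfl, hlL, fun x h1 h2 => ?_⟩
        · rw [hx, ← hport]
        · dsimp only [pu]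
          rw [add_mul]
          omega
        · dsimp only [pu]
          omega
        · dsimp only [pu] at h2
          omega
      · exact .inl ⟨(hheld a l pu' hal).1 hp', rfl⟩
    · by_cases hal : a = i ∧ l = (c.mem i).kd
      · obtain ⟨rfl, rfl⟩ := hal
        exact hn _ hH'
      · exact hn pu' ((hheld a l pu' hal).2 hp')
  refine ⟨np, hP', ?_⟩
  rw [(hsame _).2.2.1]
  refine hC.mono hk (hP.bounded hI) (hP'.bounded hI') (fun e he => he.mono hl.all)
    (fun e _ hs => side_congr ⟨fun h => h.mono hl.all, fun _ => hs⟩ fun _ q => by rw [(hsame _).1])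
    (fun h hh => ?_) fun h _ => by simp only [pathState, (hsame _).2.2.2]
  simp only [pathState]
  by_cases hhk : h = (c.mem i).kd
  · have h3 := sum_change (s := Finset.univ)
      (g := fun a => heldB (Held T u (c.pos a) (c.mem a) h) + np h a)
      (g' := fun a => heldB (Held T u (c'.pos a) (c'.mem a) h) + np h a) (i := i) (by simp)
      fun a ha => by rw [heldB_congr fun pu' => hheld a h pu' fun hal => ha hal.1]
    subst hhk
    simp only [heldB_eq hH', heldB_zero hnone] at h3
    rw [hx, hbx, ← hport]
    simp only [hb', Function.update_self]
    obtain ⟨s, hs'⟩ := Nat.exists_eq_add_of_le hs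
    rw [hs', Nat.add_sub_cancel_left]
    have h4 : ∑ a, (heldB (Held T u (c'.pos a) (c'.mem a) (c.mem i).kd) + np (c.mem i).kd a) =
        ∑ a, (heldB (Held T u (c.pos a) (c.mem a) (c.mem i).kd) + np (c.mem i).kd a) +
          k * (c.board (c.pos i)).seg p := by
      have : pu.B = k * (c.board (c.pos i)).seg p := rfl
      omega
    rw [h4]
    ring
  · rw [hl.board _ (hne h hh hhk)]
    congr 2
    refine Finset.sum_congr rfl fun a _ => ?_
    rw [heldB_congr fun pu' => hheld a h pu' fun hal => hhk hal.2]

/-- A paid token moves from the purse to the record `np` of payments, where it keeps its value; `np`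
stays bounded because `far` grows with each passed edge. -/
lemma PathGood.pass [DecidableEq V] (hk : 1 ≤ k) {c : TokenConfig k V} {i : Fin k} {p j y : ℕ}
    {pu : Purse} (hI : Inv T u c) (hG : PathGood T u c)
    (hr : Ready (c.mem i) (c.board (c.pos i)))
    (hf : NoFresh (T.degree (c.pos i)) (c.board (c.pos i))) (hd : (c.mem i).dig = 0)
    (hun : ∀ q < T.degree (c.pos i), (c.board (c.pos i)).st q = opn → q = p)
    (hj : Active (c.mem i) j) (hpu : (c.mem i).fr j = some pu) (hB : 1 ≤ pu.B)
    (hy : y = 0 ∧ (c.mem i).kd + 2 ≤ pu.sd + j ∨ y = 1 ∧ pu.sd + j < (c.mem i).kd + 2)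
    (hc : T.Child (c.pos i) p (T.nb (c.pos i) p))
    (hI' : Inv T u (c.go T i { c.mem i with
      kd := (c.mem i).kd + 1
      fr := Function.update (c.mem i).fr j
        (some { pu with B := pu.B - y, far := (c.mem i).kd + 1 }) } (c.board (c.pos i)) p)) :
    PathGood T u (c.go T i { c.mem i with
      kd := (c.mem i).kd + 1
      fr := Function.update (c.mem i).fr j
        (some { pu with B := pu.B - y, far := (c.mem i).kd + 1 }) } (c.board (c.pos i)) p) := by
  have hA := hI.agent i
  have hdep := hA.depth
  obtain ⟨h, rfl⟩ : ∃ h, j = h + 1 := by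
    rcases j with - | h
    · rw [hA.fr_zero] at hpu; simp at hpu
    · exact ⟨h, rfl⟩
  have hhk : h < (c.mem i).kd := hj.1
  set pu1 : Purse := { pu with B := pu.B - y, far := (c.mem i).kd + 1 } with hpu1
  set m' : Mem := { c.mem i with
      kd := (c.mem i).kd + 1
      fr := Function.update (c.mem i).fr (h + 1) (some pu1) } with hm'
  have hev : Evolves (c.board (c.pos i)) (c.board (c.pos i)) := Evolves.refl _
  have hl : Local c (c.go T i m' (c.board (c.pos i)) p) i := local_go hev
  set c' := c.go T i m' (c.board (c.pos i)) p with hc'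
  have hb : c'.board = c.board := by simp [hc', TokenConfig.go]
  have hmi : c'.mem i = m' := by simp [hc', TokenConfig.go]
  have hpi : c'.pos i = T.nb (c.pos i) p := by simp [hc', TokenConfig.go]
  have hxk : T.anc (c.pos i) (c.mem i).kd = c.pos i := T.anc_of_le (by omega)
  have hanc : ∀ l ≤ (c.mem i).kd, T.anc (T.nb (c.pos i) p) l = T.anc (c.pos i) l := fun l hl =>
    hc.anc (by omega)
  have hheldi : ∀ l pu', l ≠ h → (Held T u (c'.pos i) (c'.mem i) l pu' ↔
      Held T u (c.pos i) (c.mem i) l pu') := by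
    intro l pu' hlh
    rw [hmi, hpi]
    by_cases hlk : l ≤ (c.mem i).kd
    · exact held_move (by dsimp only [m']; omega) (hanc l) (by simp [hm', hlh])
    · constructor
      · rintro ⟨h1, -, h3, -⟩
        dsimp only [m'] at h1 h3
        rw [Function.update_of_ne (by omega), hA.fr_beyond _ (by omega)] at h3
        simp at h3
      · rintro ⟨h1, -⟩
        omega
  by_cases hH : Held T u (c.pos i) (c.mem i) h pu
  swap
  · refine hG.keep hk hI hI' hl (by rw [hb]) (fun h hh hx hs q => by rw [hb])
      (fun h hh hx => by rw [hb]) (fun h hh hx => by rw [hb]) (fun h hh hx => by rw [hb])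
      fun l _ pu' => ?_
    by_cases hlh : l = h
    · subst hlh
      constructor
      · rw [hmi, hpi]
        rintro ⟨-, h2, h3, h4⟩
        simp only [hm', Function.update_self, Option.some.injEq] at h3
        rw [hanc _ hhk.le] at h2
        rw [← h3] at h4
        exact absurd ⟨hhk.le, h2, hpu, h4⟩ hH
      · intro h
        have h3 := h.2.2.1
        rw [hpu] at h3
        simp only [Option.some.injEq] at h3
        rw [← h3] at h
        exact absurd h hH
    · exact hheldi l pu' hlh
  have hact := fun l => hH.active hI hj (l := l)
  have hx : T.anc u (c.mem i).kd = c.pos i := by rw [← (hact _ hhk le_rfl).1, hxk]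
  have hs0 := hA.pathSat ⟨hr.1, hf⟩ hx
  have hL0 := hs0.lt hI
  have hH' : Held T u (c'.pos i) (c'.mem i) h pu1 := by
    rw [hmi, hpi]
    exact ⟨hhk.le.trans (Nat.le_succ _), by rw [hanc _ hhk.le, hH.2.1], by simp [hm'], hH.2.2.2⟩
  have hheld : ∀ a l pu', ¬ (l = h ∧ a = i) → (Held T u (c'.pos a) (c'.mem a) l pu' ↔
      Held T u (c.pos a) (c.mem a) l pu') := by
    intro a l pu' hal
    by_cases ha : a = i
    · subst ha
      exact hheldi l pu' fun e => hal ⟨e, rfl⟩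
    · rw [hl.pos a ha, hl.mem a ha]
  have hfar : pu.far ≤ (c.mem i).kd := by
    by_contra hlt
    have := hA.reach _ pu hpu hB ((c.mem i).kd + 1) (by omega) (by omega)
    omega
  obtain ⟨np, hP, hC⟩ := hG
  have hP' : PathInv T u c' fun l a => if l = h ∧ a = i then np l a + y else np l a := by
    refine hP.of hl.all (fun h _ => .inl (by rw [hb])) (fun l hl' hs => ?_)
      (fun a l hlL pu' hp' => ?_) (fun a l _ hn => .inl ⟨fun pu' hp' => ?_, ?_⟩)
    · have hlh : l ≠ h := fun e => hs (e ▸ hH.pathSat hI)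
      rw [hb]
      exact ⟨rfl, rfl, fun _ => by simp [hlh]⟩
    · by_cases hal : l = h ∧ a = i
      · obtain ⟨rfl, rfl⟩ := hal
        right
        have h3 := hp'.2.2.1
        rw [hH'.2.2.1] at h3
        simp only [Option.some.injEq] at h3
        subst h3
        obtain ⟨f1, f2, f3, f4, f5, f6⟩ := hP.fits a l hlL pu hH
        simp only [and_self, if_true]
        refine ⟨f1, ?_, ?_, ?_, hL0, fun x h1 h2 => ?_⟩
        · dsimp only [pu1]
          omega
        · dsimp only [pu1]
          omega
        · dsimp only [pu1]
          omega
        · dsimp only [pu1] at h2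
          refine ⟨fun j hj => hs0 j (by omega), ?_⟩
          rcases Nat.lt_or_ge x (c.mem a).kd with hlt | hge
          · exact (hact x h1 hlt.le).2 hlt
          · have hxe : x = (c.mem a).kd := by omega
            subst hxe
            refine side_of_unary ?_
            rw [hx]
            intro q hq q' hq' h4 h5
            rw [hun q hq h4, hun q' hq' h5]
      · exact .inl ⟨(hheld a l pu' hal).1 hp', if_neg hal⟩
    · by_cases hal : l = h ∧ a = i
      · obtain ⟨rfl, rfl⟩ := hal
        exact hn _ hH'
      · exact hn pu' ((hheld a l pu' hal).2 hp')
    · refine if_neg ?_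
      rintro ⟨rfl, rfl⟩
      exact hn _ hH'
  refine ⟨_, hP', ?_⟩
  rw [hb]
  refine hC.mono hk (hP.bounded hI) (hP'.bounded hI') (fun e he => he.mono hl.all)
    (fun e _ hs => by simp only [pathState, hb]) (fun l _ => ?_) fun l _ => by
      simp only [pathState, hb]
  simp only [pathState, hb]
  congr 2
  refine Finset.sum_congr rfl fun a _ => ?_
  by_cases hal : l = h ∧ a = i
  · obtain ⟨rfl, rfl⟩ := hal
    simp only [heldB_eq hH, heldB_eq hH', and_self, if_true]
    dsimp only [pu1]
    omega
  · rw [heldB_congr fun pu' => hheld a l pu' hal, if_neg hal]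

/-- Moves preserve the invariants of the path. -/
lemma PathGood.move [DecidableEq V] (hk : 1 ≤ k) {c : TokenConfig k V} {i : Fin k} {m : Mem}
    {b : Board} {p : ℕ} (hI : Inv T u c) (hG : PathGood T u c)
    (h : Move k (T.degree (c.pos i)) (c.mem i) (c.board (c.pos i)) m b p)
    (hu : T.nb (c.pos i) p ≠ u) : PathGood T u (c.go T i m b p) := by
  have hI' := hI.move h hu
  have hdir := h.direction hI.board
  have hl : Local c (c.go T i m b p) i := local_go h.evolves
  have hr := h.ready
  have hdep := (hI.agent i).depth
  have hbx : (c.go T i m b p).board (c.pos i) = b := by simp [TokenConfig.go]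
  have hmi : (c.go T i m b p).mem i = m := by simp [TokenConfig.go]
  have hpi : (c.go T i m b p).pos i = T.nb (c.pos i) p := by simp [TokenConfig.go]
  have hdown : (c.board (c.pos i)).st p ≠ up → T.Child (c.pos i) p (T.nb (c.pos i) p) :=
    hI.board.child hr.1 h.lt
  have hupw : (c.board (c.pos i)).st p = up →
      T.Child (T.nb (c.pos i) p) (T.portTo (T.nb (c.pos i) p) (c.pos i)) (c.pos i) := by
    intro hup
    have := (hI.board.up_iff _ p hr.1 h.lt).1 hup
    exact ⟨T.portTo_lt (T.adj_nb h.lt).symm, T.nb_portTo (T.adj_nb h.lt).symm, this⟩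
  cases h with
  | fresh p _ hp h =>
    have hc := hdown (by rw [h]; simp)
    refine hG.keep hk hI hI' hl (by rw [hbx]) (fun l _ he hs => ?_)
      (fun l _ _ => by rw [hbx]) (fun l _ _ => by rw [hbx])
      (fun l _ _ => by rw [hbx]) fun l _ pu => ?_
    · have := (hs l le_rfl).2
      rw [he] at this
      exact absurd h (this p hp)
    · rw [hmi, hpi]
      exact held_move Iff.rfl (fun h => hc.anc (by omega)) rfl
  | digUp p _ hf hd hp h =>
    have hc := hupw h
    have hcd := hc.2.2
    refine hG.keep hk hI hI' hl (by rw [hbx]) (fun l _ he hs q => by rw [hbx])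
      (fun l _ _ => by rw [hbx]) (fun l _ _ => by rw [hbx])
      (fun l _ _ => by rw [hbx]) fun l _ pu => ?_
    rw [hmi, hpi]
    exact held_move Iff.rfl (fun h => (hc.anc (by omega)).symm) rfl
  | kUp p _ hf hd hkd hp h hB =>
    have hc := hupw h
    have hcd := hc.2.2
    refine hG.keep hk hI hI' hl (by rw [hbx]) (fun l _ he hs q => by rw [hbx])
      (fun l _ _ => by rw [hbx]) (fun l _ _ => by rw [hbx])
      (fun l _ _ => by rw [hbx]) fun l _ pu => ?_
    rw [hmi, hpi]
    rcases Nat.lt_or_ge l (c.mem i).kd with hlt | hge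
    · refine held_move ?_ (fun h => (hc.anc (by omega)).symm) rfl
      dsimp only; omega
    · constructor
      · rintro ⟨h1, -⟩
        dsimp only at h1
        omega
      · rintro ⟨h1, -, h3, -⟩
        rw [show l = (c.mem i).kd by omega, hr.2.2] at h3
        simp at h3
  | depart p _ hf hd hp h hs =>
    exact hG.depart hk hI hr hf hd hs (hdown (by rw [h]; simp)) hI'
  | pass p j x pu _ hf hd hp h hun hj hpu hB hx =>
    exact hG.pass hk hI hr hf hd hun hj hpu hB hx (hdown (by rw [h]; simp)) hI'

lemma pathGood_start : PathGood T u (TokenConfig.start T : TokenConfig k V) := by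
  have h0 : ∀ l, ¬ PathSat T u (TokenConfig.start T : TokenConfig k V).board l := fun l h =>
    (h l le_rfl).1
  have h1 : ∀ a l pu, ¬ Held T u ((TokenConfig.start T : TokenConfig k V).pos a)
      ((TokenConfig.start T : TokenConfig k V).mem a) l pu := by
    rintro a l pu ⟨-, -, h3, -⟩
    simp [TokenConfig.start, init] at h3
  refine ⟨fun _ _ => 0, ⟨fun h hh => hh, fun h hh x hx hx' => ?_, fun h hh _ => ⟨rfl, rfl, fun _ => rfl⟩,
    fun a h hh pu hp => absurd hp (h1 a h pu), fun a h hh _ => Nat.zero_le _⟩, ?_⟩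
  · simp only [TokenConfig.start, blank] at hx'
    omega
  · unfold PathState.Covers
    simp only [TokenConfig.start, blank, Nat.cast_zero, mul_zero]
    refine add_nonneg (Finset.sum_nonneg fun h _ => ?_) (Finset.sum_nonneg fun e _ => ?_)
    · have h2 : heldB (Held T u T.root init h) = 0 :=
        heldB_zero fun pu hp => by simpa [init] using hp.2.2.1
      have h3 : (pathState T u (TokenConfig.start T : TokenConfig k V) fun _ _ => 0).val h = 0 := by
        simp [pathState, h2, TokenConfig.start, blank]
      have h4 : (pathState T u (TokenConfig.start T : TokenConfig k V) fun _ _ => 0).rm h = 0 := rfl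
      unfold PathState.term
      simp only [TokenConfig.start, blank] at h3 h4
      rw [h3, h4]
      simp
    · unfold PathState.loss
      have : ¬ (pathState T u (TokenConfig.start T : TokenConfig k V) fun _ _ => 0).ps e := h0 e
      exact (if_neg this).ge

/-- All invariants after `t` moves. -/
def Good [Fintype V] (T : PortTree V) (u : V) (c : TokenConfig k V) (t : ℕ) : Prop :=
  Inv T u c ∧ PathGood T u c ∧ Count T c t

lemma Good.preps [Fintype V] [DecidableEq V] (hk : 1 ≤ k) {d : ℕ} {e : Option ℕ} {m m' : Mem}
    {b b' : Board} (h : Preps k d e m b m' b') {t : ℕ} {i : Fin k} {c : TokenConfig k V}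
    (hG : Good T u c t) (hm : c.mem i = m) (hb : c.board (c.pos i) = b)
    (hd : T.degree (c.pos i) = d) (he : c.entry i = e) : Good T u (c.upd i m' b') t := by
  induction h generalizing c with
  | refl =>
    subst hm hb
    simpa [TokenConfig.upd] using hG
  | head h _ ih =>
    subst hm hb hd he
    have hG' : Good T u (c.upd i _ _) t := ⟨hG.1.prep h, hG.2.1.prep hk hG.1 h, hG.2.2.prep hG.1 h⟩
    have := ih hG' (by simp [TokenConfig.upd]) (by simp [TokenConfig.upd]) rfl rfl
    rwa [TokenConfig.upd_upd] at this

lemma Good.next [Fintype V] [DecidableEq V] (hk : 1 ≤ k) {t : ℕ} {i : Fin k} {c c' : TokenConfig k V}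
    (hG : Good T u c t) (h : c.Next T i c') (hu : c'.pos i ≠ u) : Good T u c' (t + 1) := by
  obtain ⟨m', b', p, ⟨m, b, h1, h2⟩, rfl⟩ := h
  have hG' := hG.preps hk h1 rfl rfl rfl rfl
  have hu' : T.nb (c.pos i) p ≠ u := by simpa [TokenConfig.go] using hu
  have e1 : (c.upd i m b).mem i = m := by simp [TokenConfig.upd]
  have e2 : (c.upd i m b).board (c.pos i) = b := by simp [TokenConfig.upd]
  have h3 : Move k (T.degree ((c.upd i m b).pos i)) ((c.upd i m b).mem i)
      ((c.upd i m b).board ((c.upd i m b).pos i)) m' b' p := by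
    rw [e1, TokenConfig.upd_pos, e2]
    exact h2
  have := And.intro (hG'.1.move h3 hu') (And.intro (hG'.2.1.move hk hG'.1 h3 hu') (hG'.2.2.move hG'.1 h3))
  rwa [TokenConfig.upd_go] at this

/-- Each token issued costs at most two moves, which doubles the 96 of `Covers.le`. -/
lemma Good.time_le [Fintype V] (hk : 1 ≤ k) {t : ℕ} {c : TokenConfig k V} (hG : Good T u c t) :
    t + 2 ≤ 2 * Fintype.card V + 192 * (k * 2 ^ k * T.depth) := by
  obtain ⟨hI, ⟨np, hP, hC⟩, hT⟩ := hG
  have h1 := hT.le hI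
  have h2 := hC.le hk (hP.bounded hI)
  have h3 := Nat.mul_le_mul_left (k * 2 ^ k) (T.dep_le_depth u)
  omega

end TokenSearch

open TokenSearch in
theorem corollary5 :
    ∃ C : ℕ, ∀ k : ℕ, 1 ≤ k → ∃ A : DistributedAlgorithm k,
      ∀ (V : Type) [Fintype V] [DecidableEq V] (T : PortTree V) (σ : ℕ → Fin k),
        A.ExploredWithin T σ (2 * Fintype.card V + C * (k * 2 ^ k * T.depth)) := by
  refine ⟨192, fun k hk => ⟨algo k, fun V _ _ T σ u => ?_⟩⟩
  by_contra hno
  push Not at hno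
  have hroot : u ≠ T.root := fun h => hno 0 (Nat.zero_le _) ⟨0, hk⟩ h.symm
  -- As long as `u` is missed, a step is permitted and all invariants persist; at the last time this
  -- contradicts `Good.time_le`.
  have key : ∀ t ≤ 2 * Fintype.card V + 192 * (k * 2 ^ k * T.depth),
      Good T u (TokenConfig.of T ((algo k).run T σ t)) t := by
    intro t
    induction t with
    | zero => exact fun _ => ⟨inv_start hroot, pathGood_start, count_start⟩
    | succ t ih =>
      intro ht
      have hG := ih (by omega)
      exact hG.next hk (TokenConfig.next_activate T _ (σ t) (hG.1.exists_step (σ t)))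
        (hno (t + 1) ht (σ t))
  have := (key _ le_rfl).time_le hk
  omega
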